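/- Let $d\ge 1$, $L>0$, $\mathcal V=[0,L]^d$. Let $K_T$ (Teacher) and $K_S$ (Student) be real, continuous, even functions on $\mathbb R^d$, $L$-periodic in each coordinate, that define positive definite translation-invariant kernels $K(x-y)$ on the periodic cube, i.e. $\int_{\mathcal V}\int_{\mathcal V} f(x)K(x-y)f(y)\,dx\,dy>0$ for every $f\in L^2(\mathcal V)$ that is not almost everywhere zero. For $w\in\mathbb L=\frac{2\pi}{L}\mathbb Z^d$ let $\tilde K(w)=L^{-d/2}\int_{\mathcal V}e^{-iw\cdot x}K(x)\,dx$ (in particular $\tilde K(0)$ is finite), and assume that $K_T(0)$ and $K_S(0)$ are finite in the sense that $\sum_{w\in\mathbb L}\tilde K_T(w)<\infty$ and $\sum_{w\in\mathbb L}\tilde K_S(w)<\infty$. Let $Z$ be a centered Gaussian random field with $\mathbb E\,Z(x)Z(y)=K_T(x-y)$. For $n=N^d$ let $x_1,\dots,x_n$ be the points of the regular lattice $\frac LN\{0,\dots,N-1\}^d$, let $\hat Z_S(x)=k_S(x)\cdot\mathbb K_S^{-1}\,(Z(x_\mu))_{\mu=1}^n$ with $k_S(x)=(K_S(x_\mu-x))_\mu$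 and $\mathbb K_S=(K_S(x_\mu-x_\nu))_{\mu,\nu}$ be the kernel regression predictor, and let $$\mathbb E\,\mathrm{MSE}(n)=L^{-d}\int_{\mathcal V}\mathbb E\big[(Z(x)-\hat Z_S(x))^2\big]\,dx .$$ **Theorem.** All asymptotics are for $n=N^d\to\infty$. 1. Suppose $\tilde K_T(w)=c_T|w|^{-\alpha_T}+o(|w|^{-\alpha_T})$ and $\tilde K_S(w)=c_S|w|^{-\alpha_S}+o(|w|^{-\alpha_S})$ as $|w|\to\infty$, with $c_T,c_S>0$ and $\alpha_T,\alpha_S\in\mathbb R$, and let $\beta=\frac1d\min(\alpha_T-d,\,2\alpha_S)$. If $\alpha_T-d\neq 2\alpha_S$, there is a constant $C>0$ with $\mathbb E\,\mathrm{MSE}(n)=C\,n^{-\beta}+o(n^{-\beta})$. If $\alpha_T-d=2\alpha_S$, then $\mathbb E\,\mathrm{MSE}(n)$ is bounded above and below, for large $n$, by positive constants times $n^{-\beta}\log n$. In both cases $\log\mathbb E\,\mathrm{MSE}(n)/\log n\to-\beta$. 2. The result holds with exponent $\alpha=\infty$ for a Gaussian kernel, i.e. $\tilde K(w)=c\,e^{-\sigma^2|w|^2/2}$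 for all $w\in\mathbb L$ with $c,\sigma>0$. That is: if the Teacher is Gaussian and the Student is as in 1, then $\mathbb E\,\mathrm{MSE}(n)=Cn^{-\beta}+o(n^{-\beta})$ for some $C>0$ with $\beta=2\alpha_S/d$; if the Teacher is as in 1 and the Student is Gaussian, the same holds with $\beta=(\alpha_T-d)/d$; if both are Gaussian, then $\mathbb E\,\mathrm{MSE}(n)=o(n^{-b})$ for every $b\in\mathbb R$. -/

import Mathlib

open MeasureTheory ProbabilityTheory Filter Topology Asymptotics Matrix

namespace TeacherStudent

/-- The hypercube `[0, L]^d`. -/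
def cube (d : ℕ) (L : ℝ) : Set (Fin d → ℝ) :=
  Set.Icc (fun _ => 0) (fun _ => L)

/-- The frequency `w = (2π / L) k` of the dual lattice `(2π / L) ℤ^d`. -/
noncomputable def freq {d : ℕ} (L : ℝ) (k : Fin d → ℤ) : Fin d → ℝ :=
  fun i => 2 * Real.pi / L * (k i : ℝ)

/-- The Euclidean length `|w|` of the frequency `w = (2π / L) k`. -/
noncomputable def freqNorm {d : ℕ} (L : ℝ) (k : Fin d → ℤ) : ℝ :=
  Real.sqrt (∑ i, freq L k i ^ 2)

/-- The Fourier transform `L^(-d/2) ∫_{[0,L]^d} exp(-i w·x) F(x) dx` at `w = (2π / L) k`. -/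
noncomputable def fourierTransform {d : ℕ} (L : ℝ) (F : (Fin d → ℝ) → ℝ) (k : Fin d → ℤ) : ℂ :=
  ((L ^ (-(d : ℝ) / 2) : ℝ) : ℂ) *
    ∫ x in cube d L, Complex.exp (-Complex.I * ((∑ i, freq L k i * x i : ℝ) : ℂ)) * ((F x : ℝ) : ℂ)

/-- `K` gives a translation-invariant positive definite kernel `K(x - y)` on the periodic cube:
`K` is continuous, `L`-periodic in each coordinate, even, and the quadratic form of the kernel is
strictly positive on every square-integrable function that is not almost everywhere zero. -/
structure IsPositiveDefiniteKernel {d : ℕ} (L : ℝ) (K : (Fin d → ℝ) → ℝ) : Prop where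
  continuous : Continuous K
  periodic : ∀ (x : Fin d → ℝ) (i : Fin d), K (x + Pi.single i L) = K x
  even : ∀ x, K (-x) = K x
  posDef : ∀ f : (Fin d → ℝ) → ℝ, MemLp f 2 (volume.restrict (cube d L)) →
    ¬ (f =ᵐ[volume.restrict (cube d L)] 0) →
    0 < ∫ x in cube d L, ∫ y in cube d L, f x * K (x - y) * f y

/-- `K̃(w) = c |w|^(-α) + o(|w|^(-α))` as `|w| → ∞` in the dual lattice. -/
def HasPowerLawDecay {d : ℕ} (L : ℝ) (K : (Fin d → ℝ) → ℝ) (c α : ℝ) : Prop :=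
  (fun k : Fin d → ℤ => fourierTransform L K k - ((c * freqNorm L k ^ (-α) : ℝ) : ℂ))
    =o[comap (freqNorm L) atTop] fun k : Fin d → ℤ => freqNorm L k ^ (-α)

/-- A (periodized) Gaussian kernel: `K̃(w) = c exp(-σ² |w|² / 2)`, with `c > 0` and `σ > 0`. -/
def IsGaussianKernel {d : ℕ} (L : ℝ) (K : (Fin d → ℝ) → ℝ) : Prop :=
  ∃ c σ : ℝ, 0 < c ∧ 0 < σ ∧ ∀ k : Fin d → ℤ,
    fourierTransform L K k = ((c * Real.exp (-(σ ^ 2 * freqNorm L k ^ 2) / 2) : ℝ) : ℂ)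

/-- `Z ~ N(0, K)`: a centered Gaussian random field with `E Z(x) Z(y) = K(x - y)`. -/
structure IsGaussianField {d : ℕ} {Ω : Type*} [MeasurableSpace Ω] (K : (Fin d → ℝ) → ℝ)
    (Z : (Fin d → ℝ) → Ω → ℝ) (P : Measure Ω) : Prop where
  gaussian : IsGaussianProcess Z P
  mean_zero : ∀ x, ∫ ω, Z x ω ∂P = 0
  covariance : ∀ x y, ∫ ω, Z x ω * Z y ω ∂P = K (x - y)

/-- The `N^d` points of the regular lattice of spacing `δ = L / N` in the cube. -/
noncomputable def latticePoint {d : ℕ} (L : ℝ) (N : ℕ) (j : Fin d → Fin N) : Fin d → ℝ :=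
  fun i => L / N * ((j i : ℕ) : ℝ)

/-- The Gram matrix `K(x_μ - x_ν)` of the lattice points. -/
noncomputable def gram {d : ℕ} (L : ℝ) (K : (Fin d → ℝ) → ℝ) (N : ℕ) :
    Matrix (Fin d → Fin N) (Fin d → Fin N) ℝ :=
  Matrix.of fun μ ν => K (latticePoint L N μ - latticePoint L N ν)

/-- Kernel regression from the values of `z` at the lattice points: `k(x) · 𝕂⁻¹ z`. -/
noncomputable def prediction {d : ℕ} (L : ℝ) (K : (Fin d → ℝ) → ℝ) (N : ℕ)
    (z : (Fin d → ℝ) → ℝ) (x : Fin d → ℝ) : ℝ :=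
  (fun μ => K (latticePoint L N μ - x)) ⬝ᵥ ((gram L K N)⁻¹ *ᵥ fun μ => z (latticePoint L N μ))

/-- The mean-square error of the regression of `Z` with kernel `K` from the `N^d` lattice points,
averaged over the field and over a uniform test point in the cube. -/
noncomputable def expectedMSE {d : ℕ} {Ω : Type*} [MeasurableSpace Ω] (L : ℝ)
    (K : (Fin d → ℝ) → ℝ) (Z : (Fin d → ℝ) → Ω → ℝ) (P : Measure Ω) (N : ℕ) : ℝ :=
  (L ^ d)⁻¹ * ∫ x in cube d L, ∫ ω, (Z x ω - prediction L K N (fun y => Z y ω) x) ^ 2 ∂P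

/-- `E = C n^(-β) + o(n^(-β))` for some `C > 0`, where `n = N^d` and `N → ∞`. -/
def ScalesWithExponent (d : ℕ) (E : ℕ → ℝ) (β : ℝ) : Prop :=
  ∃ C : ℝ, 0 < C ∧
    (fun N : ℕ => E N - C * ((N : ℝ) ^ d) ^ (-β)) =o[atTop] fun N : ℕ => ((N : ℝ) ^ d) ^ (-β)

end TeacherStudent

open TeacherStudent

namespace TeacherStudent

/-! Translation invariance diagonalises the problem. On the periodic cube a kernel is a Fourier
series with summable positive coefficients (`hasSum_spectrum`, `spectrum_pos`). On the grid, waves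
whose indices are congruent mod `N` coincide, so the Gram matrix has the waves as eigenvectors, with
eigenvalue `N^d` times the spectrum summed over a residue class. The Student therefore replaces the
wave `k` by the average of its aliases `k + N m` with weights proportional to `S (k + N m)`
(`sum_weights_mul_wave`). Expanding the covariance and applying Parseval gives `E MSE = ∑ T k * M_N
k` (`hasSum_expectedMSE`), where `M_N k = (t₁² + t₂) / (S k + t₁)²` and `t_p` sums `S^p` over the
aliases other than `k` itself (`modeError_eq`).

For a power-law Student `t₁` is of order `N^(-α_S)` when `|k| ≤ N/2`, so `M_N k` is of order
`(|k|/N)^(2 α_S)` there, and `M_N ≤ 2` everywhere. Against `T k ~ |k|^(-α_T)`, fixed modes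
contribute order `N^(-2 α_S)` and modes with `|k| ~ N` order `N^(d - α_T)`. If `2 α_S < α_T - d`,
dominated convergence over fixed `k` gives the constant (`exists_tendsto_tsum`). If `2 α_S > α_T -
d`, put `k ≈ N u`: the rescaled sum is the integral of a step function on `ℝ^d`, and dominated
convergence applies in `u` (`exists_tendsto_tsum_of_modeBound`). At equality every dyadic shell
contributes the same amount, hence the logarithm (`exists_log_bounds`). Summability of the spectra
forces both exponents above `d` (`lt_exponent`).

A Gaussian spectrum concentrates each residue class on its smallest element: `M_N` tends to `0`
inside the fundamental cell and to `2` outside, and satisfies the mode bound for every exponent. A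
Gaussian Teacher has all polynomial moments. With these facts the same two arguments cover the
Gaussian cases. -/

/-- The plane wave `exp (i w·x)` of frequency `w = (2π / L) k`. -/
noncomputable def wave {d : ℕ} (L : ℝ) (k : Fin d → ℤ) (x : Fin d → ℝ) : ℂ :=
  Complex.exp (Complex.I * ((∑ i, freq L k i * x i : ℝ) : ℂ))

/-! ### Plane waves: orthogonality on the cube and on the grid -/

section wave
variable {d : ℕ} {L : ℝ}

lemma wave_add_left (k l : Fin d → ℤ) (x : Fin d → ℝ) :
    wave L (k + l) x = wave L k x * wave L l x := by
  rw [wave, wave, wave, ← Complex.exp_add, ← mul_add, ← Complex.ofReal_add,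
    ← Finset.sum_add_distrib]
  congr 3
  refine Finset.sum_congr rfl fun i _ => ?_
  simp only [freq, Pi.add_apply, Int.cast_add]; ring

lemma wave_add_right (k : Fin d → ℤ) (x y : Fin d → ℝ) :
    wave L k (x + y) = wave L k x * wave L k y := by
  rw [wave, wave, wave, ← Complex.exp_add, ← mul_add, ← Complex.ofReal_add,
    ← Finset.sum_add_distrib]
  congr 3
  refine Finset.sum_congr rfl fun i _ => ?_
  simp only [Pi.add_apply]; ring

lemma wave_zero_left (x : Fin d → ℝ) : wave L 0 x = 1 := by simp [wave, freq]

lemma wave_neg_right (k : Fin d → ℤ) (x : Fin d → ℝ) : wave L k (-x) = wave L (-k) x := by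
  simp [wave, freq]

lemma wave_mul_wave_neg (k : Fin d → ℤ) (x : Fin d → ℝ) : wave L k x * wave L (-k) x = 1 := by
  rw [← wave_add_left, add_neg_cancel, wave_zero_left]

lemma wave_sub_right (k : Fin d → ℤ) (x y : Fin d → ℝ) :
    wave L k (x - y) = wave L k x * wave L (-k) y := by
  rw [sub_eq_add_neg, wave_add_right, wave_neg_right]

lemma norm_wave (k : Fin d → ℤ) (x : Fin d → ℝ) : ‖wave L k x‖ = 1 := by
  rw [wave, mul_comm, Complex.norm_exp_ofReal_mul_I]

lemma conj_wave (k : Fin d → ℤ) (x : Fin d → ℝ) :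
    (starRingEnd ℂ) (wave L k x) = wave L (-k) x := by
  rw [wave, wave, ← Complex.exp_conj, map_mul, Complex.conj_I, Complex.conj_ofReal]
  simp [freq]

@[fun_prop]
lemma continuous_wave (k : Fin d → ℤ) : Continuous (wave L k) := by
  unfold wave; fun_prop

lemma wave_eq_prod (k : Fin d → ℤ) (x : Fin d → ℝ) :
    wave L k x = ∏ i, Complex.exp (Complex.I * (freq L k i : ℂ) * (x i : ℂ)) := by
  rw [wave, ← Complex.exp_sum]
  congr 1
  push_cast
  rw [Finset.mul_sum]
  exact Finset.sum_congr rfl fun i _ => by ring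

lemma mFourier_coe (hL : L ≠ 0) (k : Fin d → ℤ) (x : Fin d → ℝ) :
    UnitAddTorus.mFourier k (fun i => ((x i : ℝ) : UnitAddCircle)) = wave L k (L • x) := by
  rw [wave_eq_prod]
  simp only [UnitAddTorus.mFourier, ContinuousMap.coe_mk]
  refine Finset.prod_congr rfl fun i _ => ?_
  rw [fourier_coe_apply]
  congr 1
  have : (L : ℂ) ≠ 0 := by exact_mod_cast hL
  simp [freq]
  field_simp

lemma cube_eq_pi : cube d L = Set.univ.pi fun _ => Set.Icc 0 L := by
  rw [cube, ← Set.pi_univ_Icc]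

lemma volume_real_cube (hL : 0 < L) : volume.real (cube d L) = L ^ d := by
  rw [measureReal_def, cube, Real.volume_Icc_pi]
  simp [hL.le]

lemma isCompact_cube : IsCompact (cube d L) := isCompact_Icc

/-- The integral factors over coordinates, and a coordinate with `k i ≠ 0` integrates a nontrivial
exponential over a whole number of periods. -/
lemma setIntegral_wave (hL : 0 < L) (k : Fin d → ℤ) :
    ∫ x in cube d L, wave L k x = if k = 0 then (L : ℂ) ^ d else 0 := by
  split_ifs with hk
  · subst hk
    simp [wave_zero_left, volume_real_cube hL]
  · simp_rw [wave_eq_prod]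
    rw [cube_eq_pi, volume_pi, Measure.restrict_pi_pi,
      integral_fintype_prod_eq_prod (fun (i : Fin d) (y : ℝ) =>
        Complex.exp (Complex.I * (freq L k i : ℂ) * (y : ℂ)))]
    obtain ⟨i, hi⟩ := Function.ne_iff.mp hk
    refine Finset.prod_eq_zero (Finset.mem_univ i) ?_
    rw [integral_Icc_eq_integral_Ioc, ← intervalIntegral.integral_of_le hL.le]
    have hi' : (k i : ℂ) ≠ 0 := by exact_mod_cast hi
    have hL' : (L : ℂ) ≠ 0 := by exact_mod_cast hL.ne'
    have hpi : (Real.pi : ℂ) ≠ 0 := by exact_mod_cast Real.pi_ne_zero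
    have hc : Complex.I * (freq L k i : ℂ) ≠ 0 := by
      simp [freq, hi', hL', hpi]
    rw [integral_exp_mul_complex hc]
    have : Complex.I * (freq L k i : ℂ) * L = k i * (2 * Real.pi * Complex.I) := by
      simp only [freq]; push_cast; field_simp
    rw [this, Complex.exp_int_mul_two_pi_mul_I]
    simp

lemma wave_latticePoint {N : ℕ} (hL : L ≠ 0) (k : Fin d → ℤ) (j : Fin d → Fin N) :
    wave L k (latticePoint L N j) =
      ∏ i, Complex.exp (2 * Real.pi * Complex.I * (k i / N)) ^ (j i : ℕ) := by
  rw [wave_eq_prod]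
  refine Finset.prod_congr rfl fun i _ => ?_
  rw [← Complex.exp_nat_mul]
  have : (L : ℂ) ≠ 0 := by exact_mod_cast hL
  congr 1
  simp only [freq, latticePoint]
  push_cast
  field_simp

lemma wave_smul_latticePoint {N : ℕ} (hL : L ≠ 0) (hN : N ≠ 0) (m : Fin d → ℤ)
    (j : Fin d → Fin N) : wave L ((N : ℤ) • m) (latticePoint L N j) = 1 := by
  rw [wave_latticePoint hL]
  refine Finset.prod_eq_one fun i _ => ?_
  have : (N : ℂ) ≠ 0 := by exact_mod_cast hN
  have : 2 * Real.pi * Complex.I * ((((N : ℤ) • m) i : ℤ) / N : ℂ)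
      = m i * (2 * Real.pi * Complex.I) := by
    simp only [Pi.smul_apply, smul_eq_mul]; push_cast; field_simp
  rw [this, Complex.exp_int_mul_two_pi_mul_I, one_pow]

/-- Aliasing: the grid cannot tell apart frequencies that are congruent mod `N`. -/
lemma wave_add_smul_latticePoint {N : ℕ} (hL : L ≠ 0) (hN : N ≠ 0) (k m : Fin d → ℤ)
    (j : Fin d → Fin N) :
    wave L (k + (N : ℤ) • m) (latticePoint L N j) = wave L k (latticePoint L N j) := by
  rw [wave_add_left, wave_smul_latticePoint hL hN, mul_one]

/-- The sum factors into geometric sums of `N`-th roots of unity; a coordinate not divisible by `N`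
gives a root other than `1`, whose sum vanishes. -/
lemma sum_wave_latticePoint {N : ℕ} (hL : L ≠ 0) (hN : N ≠ 0) (k : Fin d → ℤ)
    (hk : ¬ ∃ m : Fin d → ℤ, k = (N : ℤ) • m) :
    ∑ j : Fin d → Fin N, wave L k (latticePoint L N j) = 0 := by
  simp_rw [wave_latticePoint hL]
  rw [← Fintype.prod_sum
    (fun i (j : Fin N) => Complex.exp (2 * Real.pi * Complex.I * (k i / N)) ^ (j : ℕ))]
  have : ∃ i, ¬ (N : ℤ) ∣ k i := by
    by_contra! h
    choose m hm using h
    exact hk ⟨m, funext fun i => by simpa using hm i⟩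
  obtain ⟨i, hi⟩ := this
  refine Finset.prod_eq_zero (Finset.mem_univ i) ?_
  have hN' : (N : ℂ) ≠ 0 := by exact_mod_cast hN
  have hne : Complex.exp (2 * Real.pi * Complex.I * (k i / N)) ≠ 1 := by
    intro h
    obtain ⟨n, hn⟩ := Complex.exp_eq_one_iff.mp h
    apply hi
    refine ⟨n, ?_⟩
    have h2 : (2 * Real.pi * Complex.I : ℂ) ≠ 0 := Complex.two_pi_I_ne_zero
    have : (k i : ℂ) / N = n := by
      apply mul_left_cancel₀ h2
      rw [hn]; ring
    rw [div_eq_iff hN'] at this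
    have h3 : (k i : ℂ) = ((N * n : ℤ) : ℂ) := by push_cast; rw [this]; ring
    exact_mod_cast h3
  rw [Fin.sum_univ_eq_sum_range
    (fun j => Complex.exp (2 * Real.pi * Complex.I * (k i / N)) ^ j), geom_sum_eq hne,
    ← Complex.exp_nat_mul]
  have : (N : ℂ) * (2 * Real.pi * Complex.I * (k i / N)) = k i * (2 * Real.pi * Complex.I) := by
    field_simp
  rw [this, Complex.exp_int_mul_two_pi_mul_I]
  simp

end wave

/-! ### Fourier inversion for periodic kernels -/

section inversion
variable {d : ℕ} {L : ℝ} {K : (Fin d → ℝ) → ℝ}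

lemma fourierTransform_eq (k : Fin d → ℤ) :
    fourierTransform L K k = ((L ^ (-(d : ℝ) / 2) : ℝ) : ℂ) *
      ∫ x in cube d L, wave L (-k) x * (K x : ℂ) := by
  rw [fourierTransform]
  congr 2
  ext x
  simp [wave, freq]

lemma IsPositiveDefiniteKernel.add_period (hK : IsPositiveDefiniteKernel L K)
    (m : Fin d → ℤ) (x : Fin d → ℝ) : K (x + fun i => L * m i) = K x := by
  have hnat : ∀ (n : ℕ) (i : Fin d) (x : Fin d → ℝ), K (x + Pi.single i (L * n)) = K x := by
    intro n i
    induction n with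
    | zero => intro x; simp
    | succ n ih =>
      intro x
      have : x + Pi.single i (L * (n + 1 : ℕ)) = (x + Pi.single i (L * n)) + Pi.single i L := by
        rw [add_assoc, ← Pi.single_add]; push_cast; congr 2; ring
      rw [this, hK.periodic, ih]
  have hint : ∀ (n : ℤ) (i : Fin d) (x : Fin d → ℝ), K (x + Pi.single i (L * n)) = K x := by
    intro n i x
    obtain ⟨n, rfl | rfl⟩ := n.eq_nat_or_neg
    · exact_mod_cast hnat n i x
    · rw [← hnat n i (x + _), add_assoc, ← Pi.single_add]
      simp
  have hsum : ∀ (s : Finset (Fin d)) (x : Fin d → ℝ),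
      K (x + ∑ i ∈ s, Pi.single i (L * (m i : ℝ))) = K x := by
    intro s
    induction s using Finset.induction_on with
    | empty => intro x; simp
    | insert i s hi ih =>
      intro x
      rw [Finset.sum_insert hi, ← add_assoc, ih, hint]
  have := hsum Finset.univ x
  rwa [Finset.univ_sum_single (fun i => L * (m i : ℝ))] at this

/-- Periodicity makes the kernel independent of the representative chosen in `[0, 1)^d`; continuity
descends because the projection to the torus is a quotient map. This gives access to Fourier series
on `UnitAddTorus`. -/
lemma IsPositiveDefiniteKernel.exists_lift (hK : IsPositiveDefiniteKernel L K) :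
    ∃ f : C(UnitAddTorus (Fin d), ℂ), ∀ x : Fin d → ℝ,
      f (fun i => ((x i : ℝ) : UnitAddCircle)) = (K (L • x) : ℂ) := by
  set q : (Fin d → ℝ) → UnitAddTorus (Fin d) := fun x i => ((x i : ℝ) : UnitAddCircle) with hq
  have hqq : IsOpenQuotientMap q :=
    IsOpenQuotientMap.piMap fun _ : Fin d =>
      QuotientAddGroup.isOpenQuotientMap_mk (N := AddSubgroup.zmultiples (1 : ℝ))
  let f : UnitAddTorus (Fin d) → ℂ := fun y =>
    (K (L • fun i => ((AddCircle.equivIco 1 0 (y i) : ℝ))) : ℂ)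
  have hf : ∀ x, f (q x) = (K (L • x) : ℂ) := by
    intro x
    have : ∀ i, ∃ m : ℤ, x i = (AddCircle.equivIco 1 0 (q x i) : ℝ) + m := by
      intro i
      have h : (((AddCircle.equivIco 1 0 (q x i) : ℝ)) : UnitAddCircle) = (x i : UnitAddCircle) :=
        AddCircle.coe_equivIco
      rw [eq_comm, QuotientAddGroup.eq_iff_sub_mem] at h
      obtain ⟨m, hm⟩ := h
      refine ⟨m, ?_⟩
      simp only [zsmul_eq_mul, mul_one] at hm
      rw [hm]; ring
    choose m hm using this
    have hx : L • x = (L • fun i => ((AddCircle.equivIco 1 0 (q x i) : ℝ)))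
        + fun i => L * (m i : ℝ) := by
      ext i
      simp only [Pi.smul_apply, Pi.add_apply, smul_eq_mul]
      rw [← mul_add, ← hm i]
    simp only [f]
    rw [hx, hK.add_period]
  refine ⟨⟨f, ?_⟩, hf⟩
  rw [hqq.isQuotientMap.continuous_iff]
  have : f ∘ q = fun x => (K (L • x) : ℂ) := funext hf
  rw [this]
  have := hK.continuous
  fun_prop

open scoped Pointwise in
lemma IsPositiveDefiniteKernel.hasSum (hL : 0 < L) (hK : IsPositiveDefiniteKernel L K)
    (hs : Summable (fourierTransform L K)) (x : Fin d → ℝ) :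
    HasSum (fun k => ((L ^ (-(d : ℝ) / 2) : ℝ) : ℂ) * fourierTransform L K k * wave L k x)
      (K x : ℂ) := by
  obtain ⟨f, hf⟩ := hK.exists_lift
  have hcoef : ∀ k, UnitAddTorus.mFourierCoeff f k =
      ((L ^ (-(d : ℝ) / 2) : ℝ) : ℂ) * fourierTransform L K k := by
    intro k
    rw [UnitAddTorus.mFourierCoeff_eq_integral f k 0]
    simp_rw [hf, mFourier_coe hL.ne', smul_eq_mul]
    -- Rescaling the unit cell to side `L` costs the Jacobian `L^(-d)`, which is the square of the
    -- normalisation `L^(-d/2)`.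
    rw [Measure.setIntegral_comp_smul volume (fun x => wave L (-k) x * (K x : ℂ)) _ hL.ne',
      fourierTransform_eq, ← mul_assoc, ← Complex.ofReal_mul, ← Real.rpow_add hL]
    have hset : L • {x : Fin d → ℝ | ∀ i, x i ∈ Set.Ioc ((0 : Fin d → ℝ) i) ((0 : Fin d → ℝ) i + 1)}
        = Set.univ.pi fun _ => Set.Ioc 0 L := by
      ext x
      rw [Set.mem_smul_set_iff_inv_smul_mem₀ hL.ne']
      simp only [Set.mem_ofPred_eq, Pi.zero_apply, Pi.smul_apply, smul_eq_mul, Set.mem_Ioc,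
        Set.mem_univ_pi, zero_add]
      refine forall_congr' fun i => ?_
      rw [inv_mul_le_iff₀ hL, mul_one]
      simp [hL]
    -- The half-open fundamental cell and the closed cube differ by a null set.
    have hae : (Set.univ.pi fun _ : Fin d => Set.Ioc 0 L) =ᵐ[volume] cube d L :=
      Measure.univ_pi_Ioc_ae_eq_Icc
    rw [hset, setIntegral_congr_set hae]
    rw [Module.finrank_fin_fun, abs_of_pos (by positivity), Complex.real_smul]
    congr 2
    rw [← Real.rpow_natCast, ← Real.rpow_neg hL.le]
    congr 1; ring
  have hsum : Summable (UnitAddTorus.mFourierCoeff f) := by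
    simp_rw [funext hcoef]
    exact hs.mul_left _
  have := UnitAddTorus.hasSum_mFourier_series_apply_of_summable hsum
    (fun i => (((L⁻¹ • x) i : ℝ) : UnitAddCircle))
  rw [hf] at this
  simp_rw [mFourier_coe hL.ne', hcoef, smul_inv_smul₀ hL.ne', smul_eq_mul] at this
  exact this

end inversion

/-! ### Coefficient extraction and Parseval for absolutely convergent wave series -/

section parseval
variable {d : ℕ} {L : ℝ} {ι : Type*} {φ : ι → Fin d → ℤ} {c : ι → ℂ}

lemma integrableOn_cube {E : Type*} [NormedAddCommGroup E] {f : (Fin d → ℝ) → E}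
    (hf : Continuous f) : IntegrableOn f (cube d L) :=
  hf.continuousOn.integrableOn_compact isCompact_cube

lemma summable_mul_wave (hc : Summable c) (x : Fin d → ℝ) :
    Summable fun i => c i * wave L (φ i) x := by
  refine Summable.of_norm ?_
  simpa [norm_wave] using hc.norm

lemma continuous_tsum_wave (hc : Summable c) :
    Continuous fun x => ∑' i, c i * wave L (φ i) x := by
  refine continuous_tsum (fun i => by fun_prop) hc.norm fun i x => ?_
  simp [norm_wave]

lemma norm_tsum_wave_le (hc : Summable c) (x : Fin d → ℝ) :
    ‖∑' i, c i * wave L (φ i) x‖ ≤ ∑' i, ‖c i‖ := by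
  refine tsum_of_norm_bounded hc.norm.hasSum fun i => ?_
  simp [norm_wave]

/-- Absolute summability allows termwise integration, and orthogonality with injectivity of `φ`
leaves only the term `j`. The indexing `φ` is general so that a series may run over a single residue
class mod `N`. -/
lemma setIntegral_wave_neg_mul_tsum [Countable ι] (hL : 0 < L) (hφ : Function.Injective φ)
    (hc : Summable c) (j : ι) :
    ∫ x in cube d L, wave L (-φ j) x * ∑' i, c i * wave L (φ i) x = (L : ℂ) ^ d * c j := by
  have hterm : ∀ i x, wave L (-φ j) x * (c i * wave L (φ i) x) = c i * wave L (φ i - φ j) x := by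
    intro i x
    rw [sub_eq_add_neg, wave_add_left]; ring
  have h := hasSum_integral_of_summable_integral_norm (μ := volume.restrict (cube d L))
    (F := fun i x => c i * wave L (φ i - φ j) x)
    (fun i => integrableOn_cube (by fun_prop)) (by
      simp only [norm_mul, norm_wave, mul_one, integral_const, smul_eq_mul]
      exact hc.norm.mul_left _)
  simp_rw [← tsum_mul_left, hterm]
  rw [← h.tsum_eq]
  simp_rw [integral_const_mul, setIntegral_wave hL]
  rw [tsum_eq_single j fun i hi => by rw [if_neg (sub_ne_zero.2 (hφ.ne hi)), mul_zero]]
  simp [mul_comm]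

lemma setIntegral_norm_sq_tsum [Countable ι] (hL : 0 < L) (hφ : Function.Injective φ)
    (hc : Summable c) :
    ∫ x in cube d L, ‖∑' i, c i * wave L (φ i) x‖ ^ 2 = L ^ d * ∑' i, ‖c i‖ ^ 2 := by
  set F : (Fin d → ℝ) → ℂ := fun x => ∑' i, c i * wave L (φ i) x with hF
  have hFc : Continuous F := continuous_tsum_wave hc
  have h := hasSum_integral_of_summable_integral_norm (μ := volume.restrict (cube d L))
    (F := fun i x => (starRingEnd ℂ) (c i) * (wave L (-φ i) x * F x))
    (fun i => integrableOn_cube (by fun_prop)) (by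
      simp only [norm_mul, norm_wave, one_mul, integral_const_mul, RCLike.norm_conj]
      exact hc.norm.mul_right _)
  have hpt : ∀ x, ∑' i, (starRingEnd ℂ) (c i) * (wave L (-φ i) x * F x)
      = ((‖F x‖ ^ 2 : ℝ) : ℂ) := by
    intro x
    have : ∑' i, (starRingEnd ℂ) (c i) * (wave L (-φ i) x * F x)
        = (starRingEnd ℂ) (F x) * F x := by
      simp only [hF]
      rw [Complex.conj_tsum, ← tsum_mul_right]
      exact tsum_congr fun i => by rw [map_mul, conj_wave]; ring
    rw [this, mul_comm, Complex.mul_conj, Complex.normSq_eq_norm_sq]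
  simp_rw [hpt] at h
  rw [integral_complex_ofReal] at h
  have h2 := h.tsum_eq
  simp_rw [integral_const_mul, hF, setIntegral_wave_neg_mul_tsum hL hφ hc] at h2
  have h3 : ∀ i, (starRingEnd ℂ) (c i) * ((L : ℂ) ^ d * c i) = ((L ^ d * ‖c i‖ ^ 2 : ℝ) : ℂ) := by
    intro i
    rw [← Complex.normSq_eq_norm_sq]
    push_cast
    rw [Complex.normSq_eq_conj_mul_self]; ring
  simp_rw [h3, ← Complex.ofReal_tsum] at h2
  rw [← tsum_mul_left]
  exact_mod_cast h2.symm

end parseval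

/-! ### Reality, symmetry and positivity of the spectrum -/

/-- The coefficients of the Fourier series `K x = ∑ kernelSpectrum L K k * wave L k x`. -/
noncomputable def kernelSpectrum {d : ℕ} (L : ℝ) (K : (Fin d → ℝ) → ℝ) (k : Fin d → ℤ) : ℝ :=
  L ^ (-(d : ℝ) / 2) * (fourierTransform L K k).re

section kernelSpectrum
variable {d : ℕ} {L : ℝ} {K : (Fin d → ℝ) → ℝ}

/-- Replacing `x` by `-x` in the inversion series exchanges the coefficients at `k` and `-k`;
evenness of `K` makes the two series equal, and extraction compares their coefficients. -/
lemma IsPositiveDefiniteKernel.fourierTransform_neg (hL : 0 < L)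
    (hK : IsPositiveDefiniteKernel L K) (hs : Summable (fourierTransform L K)) (k : Fin d → ℤ) :
    fourierTransform L K (-k) = fourierTransform L K k := by
  set r : ℂ := ((L ^ (-(d : ℝ) / 2) : ℝ) : ℂ)
  have hr : r ≠ 0 := by
    simp only [r, ne_eq, Complex.ofReal_eq_zero]; positivity
  have h1 := setIntegral_wave_neg_mul_tsum hL (φ := id) Function.injective_id
    (hs.mul_left r) (-k)
  have h2 := setIntegral_wave_neg_mul_tsum hL (φ := fun k => -k) neg_injective
    (hs.mul_left r) k
  have h3 : ∀ x, ∑' i, r * fourierTransform L K i * wave L (id i) x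
      = ∑' i, r * fourierTransform L K i * wave L (-i) x := by
    intro x
    simp_rw [← wave_neg_right]
    rw [(hK.hasSum hL hs (-x)).tsum_eq, hK.even]
    exact (hK.hasSum hL hs x).tsum_eq
  simp_rw [h3] at h1
  simp only [id, neg_neg] at h1 h2
  rw [h2] at h1
  have hL' : (L : ℂ) ^ d ≠ 0 := by exact_mod_cast (pow_pos hL d).ne'
  exact (mul_left_cancel₀ hr (mul_left_cancel₀ hL' h1)).symm

lemma IsPositiveDefiniteKernel.fourierTransform_eq_spectrum (hL : 0 < L)
    (hK : IsPositiveDefiniteKernel L K) (hs : Summable (fourierTransform L K)) (k : Fin d → ℤ) :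
    ((L ^ (-(d : ℝ) / 2) : ℝ) : ℂ) * fourierTransform L K k = (kernelSpectrum L K k : ℂ) := by
  have h : (starRingEnd ℂ) (fourierTransform L K k) = fourierTransform L K k := by
    conv_rhs => rw [← hK.fourierTransform_neg hL hs]
    rw [fourierTransform_eq, fourierTransform_eq, map_mul, Complex.conj_ofReal,
      ← integral_conj]
    simp [conj_wave]
  rw [kernelSpectrum, Complex.ofReal_mul, Complex.conj_eq_iff_re.mp h]

lemma IsPositiveDefiniteKernel.spectrum_neg (hL : 0 < L)
    (hK : IsPositiveDefiniteKernel L K) (hs : Summable (fourierTransform L K)) (k : Fin d → ℤ) :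
    kernelSpectrum L K (-k) = kernelSpectrum L K k := by
  rw [kernelSpectrum, kernelSpectrum, hK.fourierTransform_neg hL hs]

lemma summable_spectrum (hs : Summable (fourierTransform L K)) : Summable (kernelSpectrum L K) :=
  ((Complex.hasSum_re hs.hasSum).summable).mul_left _

lemma IsPositiveDefiniteKernel.hasSum_spectrum (hL : 0 < L)
    (hK : IsPositiveDefiniteKernel L K) (hs : Summable (fourierTransform L K)) (x : Fin d → ℝ) :
    HasSum (fun k => (kernelSpectrum L K k : ℂ) * wave L k x) (K x : ℂ) := by
  simpa only [hK.fourierTransform_eq_spectrum hL hs] using hK.hasSum hL hs x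

lemma IsPositiveDefiniteKernel.hasSum_spectrum_sub (hL : 0 < L)
    (hK : IsPositiveDefiniteKernel L K) (hs : Summable (fourierTransform L K))
    (x y : Fin d → ℝ) :
    HasSum (fun k => (kernelSpectrum L K k : ℂ) * (wave L k x * wave L (-k) y))
      (K (x - y) : ℂ) := by
  simpa only [wave_sub_right] using hK.hasSum_spectrum hL hs (x - y)

/-- Plane waves are eigenfunctions of the integral operator with kernel `K (x - y)`. -/
lemma IsPositiveDefiniteKernel.setIntegral_wave_mul (hL : 0 < L)
    (hK : IsPositiveDefiniteKernel L K) (hs : Summable (fourierTransform L K))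
    (j : Fin d → ℤ) (x : Fin d → ℝ) :
    ∫ y in cube d L, wave L j y * (K (x - y) : ℂ) =
      (L : ℂ) ^ d * kernelSpectrum L K j * wave L j x := by
  have hsum : Summable fun k => (kernelSpectrum L K k : ℂ) * wave L k x :=
    (hK.hasSum_spectrum hL hs x).summable
  have := setIntegral_wave_neg_mul_tsum hL (φ := fun k => -k) neg_injective hsum j
  simp_rw [mul_assoc, (hK.hasSum_spectrum_sub hL hs x _).tsum_eq, neg_neg] at this
  rw [this, mul_assoc]

/-- The real part of the wave `j` is an admissible real test function. By the symmetry of the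
spectrum it is again an eigenfunction, so the quadratic form equals the eigenvalue times a
nonnegative integral. -/
lemma IsPositiveDefiniteKernel.spectrum_pos (hL : 0 < L)
    (hK : IsPositiveDefiniteKernel L K) (hs : Summable (fourierTransform L K))
    (j : Fin d → ℤ) : 0 < kernelSpectrum L K j := by
  set f : (Fin d → ℝ) → ℝ := fun x => (wave L j x).re with hf
  have hfc : Continuous f := Complex.continuous_re.comp (continuous_wave j)
  have hfe : ∀ x, ((f x : ℝ) : ℂ) = (wave L j x + wave L (-j) x) / 2 := by
    intro x
    rw [hf, Complex.re_eq_add_conj, conj_wave]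
  have hfL : MemLp f 2 (volume.restrict (cube d L)) := by
    have : IsFiniteMeasure (volume.restrict (cube d L)) :=
      ⟨by simpa using isCompact_cube.measure_lt_top⟩
    refine MemLp.of_bound hfc.aestronglyMeasurable 1 (ae_of_all _ fun x => ?_)
    exact (Complex.abs_re_le_norm _).trans (norm_wave j x).le
  have hne : ¬ f =ᵐ[volume.restrict (cube d L)] 0 := by
    intro h
    -- Pairing `f` with the wave `-j` yields `L^d / 2`, or `L^d` when `j = 0`; neither is zero.
    have h0 : ∫ x in cube d L, wave L (-j) x * (f x : ℂ) = 0 := by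
      refine integral_eq_zero_of_ae ?_
      filter_upwards [h] with x hx
      simp [hx]
    have h1 : ∀ x, wave L (-j) x * (f x : ℂ) = (1 + wave L (-(2 • j)) x) / 2 := by
      intro x
      rw [hfe, mul_div_assoc', mul_add, mul_comm, wave_mul_wave_neg, ← wave_add_left, two_nsmul,
        neg_add]
    simp_rw [h1] at h0
    rw [integral_div, integral_add (integrableOn_cube (by fun_prop))
      (integrableOn_cube (by fun_prop)), setIntegral_wave hL] at h0
    have hLp : (0 : ℝ) < L ^ d := by positivity
    have hL' : (L : ℂ) ^ d ≠ 0 := by exact_mod_cast hLp.ne'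
    simp only [integral_const, measureReal_restrict_apply_univ, volume_real_cube hL] at h0
    split_ifs at h0 <;> simp [hL', ← two_mul] at h0
  have hin : ∀ x, ∫ y in cube d L, f x * K (x - y) * f y
      = L ^ d * kernelSpectrum L K j * f x ^ 2 := by
    intro x
    have hKc := hK.continuous
    have h1 : (((∫ y in cube d L, f y * K (x - y) : ℝ)) : ℂ)
        = ((L ^ d * kernelSpectrum L K j * f x : ℝ) : ℂ) := by
      rw [← integral_complex_ofReal]
      have : ∀ y, ((f y * K (x - y) : ℝ) : ℂ) = (wave L j y * (K (x - y) : ℂ)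
          + wave L (-j) y * (K (x - y) : ℂ)) / 2 := by
        intro y; rw [Complex.ofReal_mul, hfe]; ring
      simp_rw [this]
      rw [integral_div, integral_add (integrableOn_cube (by fun_prop))
        (integrableOn_cube (by fun_prop)), hK.setIntegral_wave_mul hL hs,
        hK.setIntegral_wave_mul hL hs, hK.spectrum_neg hL hs]
      push_cast
      rw [hfe]; ring
    have h2 : ∫ y in cube d L, f y * K (x - y) = L ^ d * kernelSpectrum L K j * f x := by
      exact_mod_cast h1
    calc ∫ y in cube d L, f x * K (x - y) * f y = ∫ y in cube d L, f x * (f y * K (x - y)) := by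
          congr 1; ext y; ring
      _ = _ := by rw [integral_const_mul, h2]; ring
  have hpos := hK.posDef f hfL hne
  simp_rw [hin, integral_const_mul] at hpos
  have h1 : 0 ≤ ∫ x in cube d L, f x ^ 2 := integral_nonneg fun x => sq_nonneg _
  have h2 : 0 < L ^ d * kernelSpectrum L K j := pos_of_mul_pos_left hpos h1
  exact pos_of_mul_pos_right h2 (by positivity)

end kernelSpectrum

/-! ### Residue classes of frequencies -/

section aliasing
variable {d : ℕ}

lemma add_smul_injective {N : ℕ} (hN : N ≠ 0) (k : Fin d → ℤ) :
    Function.Injective fun m : Fin d → ℤ => k + (N : ℤ) • m := by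
  intro m m' h
  have h' := add_left_cancel h
  funext i
  have := congrFun h' i
  simp only [Pi.smul_apply, smul_eq_mul] at this
  exact mul_left_cancel₀ (by exact_mod_cast hN) this

/-- The sum of `S` over the residue class of `k` modulo `N`. -/
noncomputable def aliasSum (S : (Fin d → ℤ) → ℝ) (N : ℕ) (k : Fin d → ℤ) : ℝ :=
  ∑' m : Fin d → ℤ, S (k + (N : ℤ) • m)

/-- The coefficient at frequency `k + N m` of the error in predicting the plane wave of
frequency `k`. -/
noncomputable def residual (S : (Fin d → ℤ) → ℝ) (N : ℕ) (k m : Fin d → ℤ) : ℝ :=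
  (if m = 0 then 1 else 0) - S (k + (N : ℤ) • m) / aliasSum S N k

/-- The mean-square error in predicting the plane wave of frequency `k`. -/
noncomputable def modeError (S : (Fin d → ℤ) → ℝ) (N : ℕ) (k : Fin d → ℤ) : ℝ :=
  ∑' m : Fin d → ℤ, residual S N k m ^ 2

variable {S : (Fin d → ℤ) → ℝ} {N : ℕ}

lemma summable_alias (hS : Summable S) (hN : N ≠ 0) (k : Fin d → ℤ) :
    Summable fun m : Fin d → ℤ => S (k + (N : ℤ) • m) :=
  hS.comp_injective (add_smul_injective hN k)

lemma aliasSum_pos (hS : Summable S) (hpos : ∀ k, 0 < S k) (hN : N ≠ 0) (k : Fin d → ℤ) :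
    0 < aliasSum S N k :=
  (summable_alias hS hN k).tsum_pos (fun _ => (hpos _).le) 0 (hpos _)

lemma hasSum_alias_div (hS : Summable S) (hpos : ∀ k, 0 < S k) (hN : N ≠ 0) (k : Fin d → ℤ) :
    HasSum (fun m => S (k + (N : ℤ) • m) / aliasSum S N k) 1 := by
  rw [← div_self (aliasSum_pos hS hpos hN k).ne']
  exact (summable_alias hS hN k).hasSum.div_const _

lemma summable_residual (hS : Summable S) (hN : N ≠ 0) (k : Fin d → ℤ) :
    Summable (residual S N k) :=
  (summable_of_hasFiniteSupport ((Set.finite_singleton (0 : Fin d → ℤ)).subset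
    fun _ hm => by by_contra h; simp_all)).sub ((summable_alias hS hN k).div_const _)

end aliasing

/-! ### Diagonalisation of the Gram matrix and the predictor of a wave -/

section gram
variable {d : ℕ} {L : ℝ} {K : (Fin d → ℝ) → ℝ} {N : ℕ}

/-- In the Fourier series of `K`, summation over the grid annihilates every frequency that is not
congruent to `j` mod `N` and multiplies the others by `N^d`. -/
lemma sum_wave_mul_kernel (hL : 0 < L) (hK : IsPositiveDefiniteKernel L K)
    (hs : Summable (fourierTransform L K)) (hN : N ≠ 0) (j : Fin d → ℤ) (x : Fin d → ℝ) :
    ∑ ν, wave L j (latticePoint L N ν) * (K (latticePoint L N ν - x) : ℂ) =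
      (N : ℂ) ^ d * ∑' m : Fin d → ℤ,
        (kernelSpectrum L K (j + (N : ℤ) • m) : ℂ) * wave L (j + (N : ℤ) • m) x := by
  have h1 : ∀ ν, HasSum (fun k => (kernelSpectrum L K k : ℂ) * wave L k x *
      wave L (j - k) (latticePoint L N ν))
      (wave L j (latticePoint L N ν) * (K (latticePoint L N ν - x) : ℂ)) := by
    intro ν
    rw [← hK.even, neg_sub]
    convert! (hK.hasSum_spectrum_sub hL hs x (latticePoint L N ν)).mul_left
      (wave L j (latticePoint L N ν)) using 2 with k
    rw [sub_eq_add_neg, wave_add_left]; ring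
  have h2 := hasSum_sum fun ν (_ : ν ∈ Finset.univ) => h1 ν
  simp_rw [← Finset.mul_sum] at h2
  rw [← h2.tsum_eq, ← tsum_mul_left, ← (add_smul_injective hN j).tsum_eq]
  · refine tsum_congr fun m => ?_
    have : j - (j + (N : ℤ) • m) = (N : ℤ) • (-m) := by simp
    rw [this]
    simp_rw [wave_smul_latticePoint hL.ne' hN]
    simp [mul_comm]
  · intro k hk
    by_contra hk'
    refine hk ?_
    dsimp only
    rw [sum_wave_latticePoint hL.ne' hN, mul_zero]
    rintro ⟨m, hm⟩
    exact hk' ⟨-m, by simp [← hm]⟩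

/-- The discrete Fourier transform turns the Gram matrix into multiplication by `N^d` times the
alias sum. -/
lemma sum_wave_mul_vecMul_gram (hL : 0 < L) (hK : IsPositiveDefiniteKernel L K)
    (hs : Summable (fourierTransform L K)) (hN : N ≠ 0) (j : Fin d → ℤ)
    (v : (Fin d → Fin N) → ℝ) :
    ∑ ν, wave L j (latticePoint L N ν) * ((v ᵥ* gram L K N) ν : ℂ) =
      (N : ℂ) ^ d * (aliasSum (kernelSpectrum L K) N j *
        ∑ μ, (v μ : ℂ) * wave L j (latticePoint L N μ)) := by
  have h1 : ∀ ν, wave L j (latticePoint L N ν) * ((v ᵥ* gram L K N) ν : ℂ) =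
      ∑ μ, (v μ : ℂ) * (wave L j (latticePoint L N ν) *
        (K (latticePoint L N ν - latticePoint L N μ) : ℂ)) := by
    intro ν
    simp only [vecMul, dotProduct, gram, of_apply]
    push_cast
    rw [Finset.mul_sum]
    refine Finset.sum_congr rfl fun μ _ => ?_
    rw [← hK.even, neg_sub]; ring
  simp_rw [h1]
  rw [Finset.sum_comm]
  simp_rw [← Finset.mul_sum, sum_wave_mul_kernel hL hK hs hN, wave_add_smul_latticePoint hL.ne' hN,
    tsum_mul_right]
  rw [Finset.mul_sum, Finset.mul_sum]
  refine Finset.sum_congr rfl fun μ _ => ?_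
  rw [aliasSum, Complex.ofReal_tsum]; ring

lemma eq_zero_of_sum_wave_eq_zero (hL : 0 < L) (hN : N ≠ 0) (v : (Fin d → Fin N) → ℝ)
    (h : ∀ j, ∑ μ, (v μ : ℂ) * wave L j (latticePoint L N μ) = 0) : v = 0 := by
  funext ν
  have h0 : ∑ j : Fin d → Fin N, (∑ μ, (v μ : ℂ) *
      wave L (fun i => ((j i : ℕ) : ℤ)) (latticePoint L N μ)) *
      wave L (-fun i => ((j i : ℕ) : ℤ)) (latticePoint L N ν) = 0 :=
    Finset.sum_eq_zero fun j _ => by rw [h, zero_mul]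
  -- The phase depends on `j` and `μ - ν` only through their dot product, so frequency and position
  -- may be exchanged: the sum over `j` becomes a grid sum of the wave `μ - ν`.
  have hsym : ∀ (j μ : Fin d → Fin N), wave L (fun i => ((j i : ℕ) : ℤ)) (latticePoint L N μ) *
      wave L (-fun i => ((j i : ℕ) : ℤ)) (latticePoint L N ν) =
      wave L (fun i => ((μ i : ℕ) : ℤ) - ((ν i : ℕ) : ℤ)) (latticePoint L N j) := by
    intro j μ
    rw [← wave_sub_right, wave, wave]
    congr 3
    refine Finset.sum_congr rfl fun i _ => ?_
    simp only [freq, latticePoint, Pi.sub_apply]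
    push_cast; ring
  simp_rw [Finset.sum_mul, mul_assoc, hsym] at h0
  rw [Finset.sum_comm] at h0
  simp_rw [← Finset.mul_sum] at h0
  rw [Finset.sum_eq_single ν] at h0
  · have : (fun i => ((ν i : ℕ) : ℤ) - ((ν i : ℕ) : ℤ)) = 0 := by ext i; simp
    rw [this] at h0
    simp only [wave_zero_left, Finset.sum_const, Finset.card_univ, Fintype.card_pi,
      Fintype.card_fin, Finset.prod_const] at h0
    simpa [hN] using h0
  · intro μ _ hμ
    rw [sum_wave_latticePoint hL.ne' hN, mul_zero]
    rintro ⟨m, hm⟩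
    apply hμ
    funext i
    have h1 := congrFun hm i
    simp only [Pi.smul_apply, smul_eq_mul] at h1
    have h2 := (μ i).2
    have h3 := (ν i).2
    ext
    -- Two grid indices differ by less than `N`, so `0` is the only multiple of `N` available.
    have h4 : m i = 0 := by
      by_contra hne
      rcases lt_or_gt_of_ne hne with h5 | h5
      · have : (N : ℤ) * m i ≤ -N := by nlinarith
        omega
      · have : (N : ℤ) ≤ N * m i := by nlinarith
        omega
    rw [h4] at h1
    omega
  · simp

lemma det_gram_ne_zero (hL : 0 < L) (hK : IsPositiveDefiniteKernel L K)
    (hs : Summable (fourierTransform L K)) (hN : N ≠ 0) : (gram L K N).det ≠ 0 := by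
  intro hdet
  obtain ⟨v, hv0, hv⟩ := exists_vecMul_eq_zero_iff.mpr hdet
  refine hv0 (eq_zero_of_sum_wave_eq_zero hL hN v fun j => ?_)
  have := sum_wave_mul_vecMul_gram hL hK hs hN j v
  rw [hv] at this
  have hA : (aliasSum (kernelSpectrum L K) N j : ℂ) ≠ 0 := by
    exact_mod_cast (aliasSum_pos (summable_spectrum hs) (hK.spectrum_pos hL hs) hN j).ne'
  have hN' : (N : ℂ) ^ d ≠ 0 := pow_ne_zero _ (by exact_mod_cast hN)
  simpa [hA, hN, Finset.sum_const_zero] using this.symm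

/-- The weights of the values at the lattice points in the prediction at `x`. -/
noncomputable def weights (L : ℝ) (K : (Fin d → ℝ) → ℝ) (N : ℕ) (x : Fin d → ℝ) :
    (Fin d → Fin N) → ℝ :=
  (fun μ => K (latticePoint L N μ - x)) ᵥ* (gram L K N)⁻¹

lemma prediction_eq_sum_weights (z : (Fin d → ℝ) → ℝ) (x : Fin d → ℝ) :
    prediction L K N z x = ∑ μ, weights L K N x μ * z (latticePoint L N μ) := by
  rw [prediction, dotProduct_mulVec]; rfl

/-- The inverse matrix need not be computed: the weights solve `w ᵥ* gram = k_S(x)`, and the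
transform of both sides only has to be divided by the positive eigenvalue. -/
lemma sum_weights_mul_wave (hL : 0 < L) (hK : IsPositiveDefiniteKernel L K)
    (hs : Summable (fourierTransform L K)) (hN : N ≠ 0) (j : Fin d → ℤ) (x : Fin d → ℝ) :
    ∑ μ, (weights L K N x μ : ℂ) * wave L j (latticePoint L N μ) =
      ∑' m : Fin d → ℤ,
        ((kernelSpectrum L K (j + (N : ℤ) • m) / aliasSum (kernelSpectrum L K) N j : ℝ) : ℂ) *
          wave L (j + (N : ℤ) • m) x := by
  have h1 : weights L K N x ᵥ* gram L K N = fun μ => K (latticePoint L N μ - x) := by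
    rw [weights, vecMul_vecMul, nonsing_inv_mul _ (det_gram_ne_zero hL hK hs hN).isUnit, vecMul_one]
  have h2 := sum_wave_mul_vecMul_gram hL hK hs hN j (weights L K N x)
  rw [h1, sum_wave_mul_kernel hL hK hs hN] at h2
  have hN' : (N : ℂ) ^ d ≠ 0 := pow_ne_zero _ (by exact_mod_cast hN)
  have hA : (aliasSum (kernelSpectrum L K) N j : ℂ) ≠ 0 := by
    exact_mod_cast (aliasSum_pos (summable_spectrum hs) (hK.spectrum_pos hL hs) hN j).ne'
  have h3 := mul_left_cancel₀ hN' h2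
  rw [mul_comm, eq_comm, ← eq_div_iff hA] at h3
  rw [h3, ← tsum_div_const]
  refine tsum_congr fun m => ?_
  push_cast; ring

lemma wave_sub_sum_weights (hL : 0 < L) (hK : IsPositiveDefiniteKernel L K)
    (hs : Summable (fourierTransform L K)) (hN : N ≠ 0) (j : Fin d → ℤ) (x : Fin d → ℝ) :
    wave L j x - ∑ μ, (weights L K N x μ : ℂ) * wave L j (latticePoint L N μ) =
      ∑' m : Fin d → ℤ, (residual (kernelSpectrum L K) N j m : ℂ) * wave L (j + (N : ℤ) • m) x := by
  have hsum := summable_spectrum hs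
  have h1 : HasSum (fun m : Fin d → ℤ => ((if m = 0 then 1 else 0 : ℝ) : ℂ) *
      wave L (j + (N : ℤ) • m) x) (wave L j x) := by
    convert hasSum_ite_eq (0 : Fin d → ℤ) (wave L j x) using 2 with m
    split_ifs with h <;> simp [h]
  have h2 := summable_mul_wave (L := L) (φ := fun m => j + (N : ℤ) • m)
    (Complex.hasSum_ofReal.mpr
      ((summable_alias hsum hN j).div_const (aliasSum (kernelSpectrum L K) N j)).hasSum).summable x
  rw [sum_weights_mul_wave hL hK hs hN, ← h1.tsum_eq, ← h1.summable.tsum_sub h2]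
  refine tsum_congr fun m => ?_
  rw [residual, Complex.ofReal_sub, sub_mul]

end gram

/-! ### Second moments of the field in Fourier space -/

section field
variable {d : ℕ} {L : ℝ} {K : (Fin d → ℝ) → ℝ} {Ω : Type*} [MeasurableSpace Ω] {P : Measure Ω}
  {Z : (Fin d → ℝ) → Ω → ℝ}

/-- The second moment is a quadratic form in the covariance, and each covariance is a Fourier series
whose terms recombine into squared moduli. Gaussianity serves only to make the products integrable.
-/
lemma IsGaussianField.hasSum_integral_sq (hL : 0 < L) (hK : IsPositiveDefiniteKernel L K)
    (hs : Summable (fourierTransform L K)) (hZ : IsGaussianField K Z P) {ι : Type*} [Fintype ι]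
    (c : ι → ℝ) (y : ι → Fin d → ℝ) :
    HasSum (fun k => kernelSpectrum L K k * ‖∑ i, (c i : ℂ) * wave L k (y i)‖ ^ 2)
      (∫ ω, (∑ i, c i * Z (y i) ω) ^ 2 ∂P) := by
  have hint : ∀ x y, Integrable (fun ω => Z x ω * Z y ω) P := fun x y =>
    (hZ.gaussian.hasGaussianLaw_eval x).memLp_two.integrable_mul
      (hZ.gaussian.hasGaussianLaw_eval y).memLp_two
  have h1 : ∫ ω, (∑ i, c i * Z (y i) ω) ^ 2 ∂P = ∑ i, ∑ j, c i * c j * K (y i - y j) := by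
    have : ∀ ω, (∑ i, c i * Z (y i) ω) ^ 2
        = ∑ i, ∑ j, c i * c j * (Z (y i) ω * Z (y j) ω) := by
      intro ω
      rw [sq, Finset.sum_mul_sum]
      exact Finset.sum_congr rfl fun i _ => Finset.sum_congr rfl fun j _ => by ring
    simp_rw [this]
    rw [integral_finsetSum _ fun i _ => integrable_finsetSum _ fun j _ => (hint _ _).const_mul _]
    refine Finset.sum_congr rfl fun i _ => ?_
    rw [integral_finsetSum _ fun j _ => (hint _ _).const_mul _]
    refine Finset.sum_congr rfl fun j _ => ?_
    rw [integral_const_mul, hZ.covariance]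
  rw [h1, ← Complex.hasSum_ofReal]
  have h2 := hasSum_sum fun i (_ : i ∈ Finset.univ) => hasSum_sum fun j (_ : j ∈ Finset.univ) =>
    (hK.hasSum_spectrum_sub hL hs (y i) (y j)).mul_left ((c i : ℂ) * c j)
  push_cast
  convert! h2 using 2 with k
  rw [← Complex.ofReal_pow, ← Complex.normSq_eq_norm_sq, ← Complex.mul_conj, map_sum,
    Finset.sum_mul_sum, Finset.mul_sum]
  refine Finset.sum_congr rfl fun i _ => ?_
  rw [Finset.mul_sum]
  refine Finset.sum_congr rfl fun j _ => ?_
  rw [map_mul, conj_wave, Complex.conj_ofReal]; ring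

end field

/-! ### The error as a spectral sum -/

section mse
variable {d : ℕ} {L : ℝ} {K_T K_S : (Fin d → ℝ) → ℝ} {Ω : Type*} [MeasurableSpace Ω]
  {P : Measure Ω} {Z : (Fin d → ℝ) → Ω → ℝ} {N : ℕ}

/-- The residual is the difference of two probability vectors. The resulting uniform bound justifies
integrating the mode expansion over the test point. -/
lemma tsum_abs_residual_le {S : (Fin d → ℤ) → ℝ} (hS : Summable S) (hpos : ∀ k, 0 < S k)
    (hN : N ≠ 0) (k : Fin d → ℤ) : ∑' m, ‖(residual S N k m : ℂ)‖ ≤ 2 := by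
  have h1 : HasSum (fun m : Fin d → ℤ => (if m = 0 then 1 else 0 : ℝ)) 1 := hasSum_ite_eq 0 1
  have h2 := h1.add (hasSum_alias_div hS hpos hN k)
  rw [one_add_one_eq_two] at h2
  refine tsum_le_of_sum_le' (by norm_num) fun s => (Finset.sum_le_sum fun m _ => ?_).trans
    (sum_le_hasSum s (fun m _ => ?_) h2)
  · rw [Complex.norm_real, residual, sub_eq_add_neg]
    refine (norm_add_le _ _).trans (add_le_add ?_ ?_)
    · split_ifs <;> simp
    · rw [norm_neg, Real.norm_of_nonneg]
      exact div_nonneg (hpos _).le (aliasSum_pos hS hpos hN k).le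
  · have := div_nonneg (hpos (k + (N : ℤ) • m)).le (aliasSum_pos hS hpos hN k).le
    split_ifs <;> linarith

theorem hasSum_expectedMSE (hL : 0 < L)
    (hT : IsPositiveDefiniteKernel L K_T) (hS : IsPositiveDefiniteKernel L K_S)
    (hT₀ : Summable (fourierTransform L K_T)) (hS₀ : Summable (fourierTransform L K_S))
    (hZ : IsGaussianField K_T Z P) (hN : N ≠ 0) :
    HasSum (fun k => kernelSpectrum L K_T k * modeError (kernelSpectrum L K_S) N k)
      (expectedMSE L K_S Z P N) := by
  set S := kernelSpectrum L K_S with hSdef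
  have hSs : Summable S := summable_spectrum hS₀
  have hSp : ∀ k, 0 < S k := hS.spectrum_pos hL hS₀
  have hTp := hT.spectrum_pos hL hT₀
  set g : (Fin d → ℤ) → (Fin d → ℝ) → ℂ := fun k x =>
    ∑' m : Fin d → ℤ, (residual S N k m : ℂ) * wave L (k + (N : ℤ) • m) x with hg
  have hrs : ∀ k, Summable fun m => (residual S N k m : ℂ) := fun k =>
    (Complex.hasSum_ofReal.mpr (summable_residual hSs hN k).hasSum).summable
  have hgc : ∀ k, Continuous (g k) := fun k => continuous_tsum_wave (hrs k)
  have hgb : ∀ k x, ‖g k x‖ ≤ 2 := fun k x =>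
    (norm_tsum_wave_le (hrs k) x).trans (tsum_abs_residual_le hSs hSp hN k)
  have hpt : ∀ x, HasSum (fun k => kernelSpectrum L K_T k * ‖g k x‖ ^ 2)
      (∫ ω, (Z x ω - prediction L K_S N (fun y => Z y ω) x) ^ 2 ∂P) := by
    intro x
    -- The prediction error is one linear combination of field values: the test point (`none`) with
    -- coefficient `1`, each grid point with minus its weight.
    have h := hZ.hasSum_integral_sq hL hT hT₀ (ι := Option (Fin d → Fin N))
      (fun o => o.elim 1 fun μ => -weights L K_S N x μ)
      (fun o => o.elim x fun μ => latticePoint L N μ)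
    simp only [Fintype.sum_option, Option.elim, one_mul, neg_mul, Finset.sum_neg_distrib,
      ← sub_eq_add_neg, Complex.ofReal_one, Complex.ofReal_neg] at h
    simp_rw [prediction_eq_sum_weights, hg, hSdef, ← wave_sub_sum_weights hL hS hS₀ hN]
    exact h
  have hint := hasSum_integral_of_summable_integral_norm (μ := volume.restrict (cube d L))
    (F := fun k x => kernelSpectrum L K_T k * ‖g k x‖ ^ 2)
    (fun k => integrableOn_cube (by have := hgc k; fun_prop)) (by
      refine Summable.of_nonneg_of_le (fun k => by positivity) (fun k => ?_)
        ((summable_spectrum hT₀).mul_right (4 * L ^ d))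
      have : ‖∫ x in cube d L, ‖kernelSpectrum L K_T k * ‖g k x‖ ^ 2‖‖
          ≤ kernelSpectrum L K_T k * 4 * volume.real (cube d L) := by
        refine norm_setIntegral_le_of_norm_le_const isCompact_cube.measure_lt_top fun x _ => ?_
        rw [norm_norm, norm_mul, norm_pow, norm_norm, Real.norm_of_nonneg (hTp k).le]
        have := hgb k x
        have := norm_nonneg (g k x)
        exact mul_le_mul_of_nonneg_left (by nlinarith) (hTp k).le
      rw [volume_real_cube hL, mul_assoc] at this
      exact (le_abs_self _).trans this)
  simp_rw [(hpt _).tsum_eq] at hint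
  have hfin := hint.mul_left (L ^ d)⁻¹
  rw [expectedMSE]
  convert! hfin using 2 with k
  rw [integral_const_mul, hg, setIntegral_norm_sq_tsum hL (add_smul_injective hN k) (hrs k)]
  have : L ^ d ≠ 0 := by positivity
  simp only [modeError, Complex.norm_real, Real.norm_eq_abs, sq_abs]
  field_simp

end mse

/-! ### Lattice sums as integrals of step functions -/

section floor
variable {d : ℕ}

/-- The coordinatewise floor of `r u`. -/
noncomputable def gridFloor (r : ℝ) (u : Fin d → ℝ) : Fin d → ℤ := fun i => ⌊r * u i⌋

lemma measurable_gridFloor (r : ℝ) : Measurable (gridFloor r : (Fin d → ℝ) → Fin d → ℤ) :=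
  measurable_pi_lambda _ fun i =>
    Int.measurable_floor.comp (measurable_const.mul (measurable_pi_apply i))

lemma volume_real_gridFloor_preimage {r : ℝ} (hr : 0 < r) (k : Fin d → ℤ) :
    volume (gridFloor r ⁻¹' {k}) = ENNReal.ofReal ((r ^ d)⁻¹) := by
  have : gridFloor r ⁻¹' {k}
      = Set.univ.pi fun i => Set.Ico ((k i : ℝ) / r) (((k i : ℝ) + 1) / r) := by
    ext u
    simp only [Set.mem_preimage, Set.mem_singleton_iff, funext_iff, gridFloor, Set.mem_univ_pi,
      Set.mem_Ico, Int.floor_eq_iff, div_le_iff₀ hr, lt_div_iff₀ hr, mul_comm r]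
  rw [this, volume_pi_pi]
  simp only [Real.volume_Ico]
  rw [← ENNReal.ofReal_prod_of_nonneg (fun i _ => by rw [← sub_div]; simp [hr.le])]
  congr 1
  simp [← sub_div]

lemma integrable_gridFloor {r : ℝ} (hr : 0 < r) {g : (Fin d → ℤ) → ℝ} (hg : Summable g) :
    Integrable fun u => g (gridFloor r u) := by
  rw [← integrableOn_univ, ← Set.preimage_univ (f := gridFloor r), ← Set.iUnion_of_singleton,
    Set.preimage_iUnion]
  have hm : ∀ k, MeasurableSet (gridFloor r ⁻¹' {k} : Set (Fin d → ℝ)) := fun k =>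
    measurable_gridFloor r (measurableSet_singleton k)
  have hc : ∀ k, Set.EqOn (fun u => g (gridFloor r u)) (fun _ => g k)
      (gridFloor r ⁻¹' {k} : Set (Fin d → ℝ)) := fun k u hu => by
    rw [Set.mem_preimage, Set.mem_singleton_iff] at hu
    simp [hu]
  have hv := volume_real_gridFloor_preimage (d := d) hr
  refine integrableOn_iUnion_of_summable_integral_norm (fun k => ?_) ?_
  · rw [integrableOn_congr_fun (hc k) (hm k)]
    exact integrableOn_const (by rw [hv]; exact ENNReal.ofReal_ne_top)
  · have : ∀ k, ∫ u in (gridFloor r ⁻¹' {k} : Set (Fin d → ℝ)), ‖g (gridFloor r u)‖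
        = (r ^ d)⁻¹ * ‖g k‖ := by
      intro k
      rw [setIntegral_congr_fun (hm k) (g := fun _ => ‖g k‖) fun u hu => by
        simpa using congrArg norm (hc k hu)]
      rw [setIntegral_const, measureReal_def, hv, ENNReal.toReal_ofReal (by positivity),
        smul_eq_mul]
    simp_rw [this]
    exact hg.norm.mul_left _

/-- The cells on which `gridFloor r` is constant tile space and have volume `r^(-d)`. With `r = N`
this replaces a limit of lattice sums by a limit of integrals over a fixed space. -/
lemma hasSum_gridFloor {r : ℝ} (hr : 0 < r) {g : (Fin d → ℤ) → ℝ}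
    (hg : Integrable fun u => g (gridFloor r u)) :
    HasSum g (r ^ d * ∫ u, g (gridFloor r u)) := by
  have hm : ∀ k, MeasurableSet (gridFloor r ⁻¹' {k} : Set (Fin d → ℝ)) := fun k =>
    measurable_gridFloor r (measurableSet_singleton k)
  have hU : (⋃ k, gridFloor r ⁻¹' {k} : Set (Fin d → ℝ)) = Set.univ := by
    rw [← Set.preimage_iUnion, Set.iUnion_of_singleton, Set.preimage_univ]
  have h := hasSum_integral_iUnion (f := fun u => g (gridFloor r u)) (μ := volume) hm
    (fun k l hkl => Disjoint.preimage _ (by simpa using hkl)) (by rwa [hU, integrableOn_univ])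
  rw [hU, setIntegral_univ] at h
  convert! h.mul_left (r ^ d) using 2 with k
  rw [setIntegral_congr_fun (hm k) (g := fun _ => g k) fun u hu => by
    rw [Set.mem_preimage, Set.mem_singleton_iff] at hu
    simp [hu]]
  rw [setIntegral_const, measureReal_def, volume_real_gridFloor_preimage hr,
    ENNReal.toReal_ofReal (by positivity), smul_eq_mul]
  field_simp

lemma norm_intCast_fun (k : Fin d → ℤ) : ‖fun i => (k i : ℝ)‖ = ‖k‖ := by
  simp only [Pi.norm_def, nnnorm, Int.norm_eq_abs, Real.norm_eq_abs]

lemma norm_gridFloor_sub_le (r : ℝ) (u : Fin d → ℝ) :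
    ‖(fun i => (gridFloor r u i : ℝ)) - r • u‖ ≤ 1 := by
  refine (pi_norm_le_iff_of_nonneg zero_le_one).2 fun i => ?_
  simp only [gridFloor, Pi.sub_apply, Pi.smul_apply, smul_eq_mul, Real.norm_eq_abs]
  rw [abs_sub_comm, abs_of_nonneg (sub_nonneg.2 (Int.floor_le _))]
  linarith [Int.lt_floor_add_one (r * u i)]

lemma norm_le_one_add_norm_gridFloor (r : ℝ) (u : Fin d → ℝ) :
    ‖r • u‖ ≤ 1 + ‖gridFloor r u‖ := by
  have := norm_sub_norm_le (r • u) (fun i => (gridFloor r u i : ℝ))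
  rw [norm_sub_rev, norm_intCast_fun] at this
  linarith [norm_gridFloor_sub_le r u]

lemma norm_gridFloor_le (r : ℝ) (u : Fin d → ℝ) : ‖gridFloor r u‖ ≤ 1 + ‖r • u‖ := by
  have := norm_sub_norm_le (fun i => (gridFloor r u i : ℝ)) (r • u)
  rw [norm_intCast_fun] at this
  linarith [norm_gridFloor_sub_le r u]

end floor

/-! ### Convergent and critical lattice sums -/

section latticeSums
variable {d : ℕ}

lemma hasSum_floor {g : (Fin d → ℤ) → ℝ} (hg : Integrable fun u => g (gridFloor 1 u)) :
    HasSum g (∫ u, g (gridFloor 1 u)) := by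
  simpa using hasSum_gridFloor one_pos hg

lemma one_add_norm_le_floor (u : Fin d → ℝ) : (1 + ‖u‖) / 2 ≤ 1 + ‖gridFloor 1 u‖ := by
  have := norm_le_one_add_norm_gridFloor 1 u
  rw [one_smul] at this
  linarith [norm_nonneg (gridFloor 1 u)]

lemma one_add_norm_floor_le (u : Fin d → ℝ) : 1 + ‖gridFloor 1 u‖ ≤ 2 * (1 + ‖u‖) := by
  have := norm_gridFloor_le 1 u
  rw [one_smul] at this
  linarith [norm_nonneg u]

lemma measurable_comp_gridFloor (g : (Fin d → ℤ) → ℝ) (r : ℝ) :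
    Measurable fun u : Fin d → ℝ => g (gridFloor r u) :=
  (measurable_of_countable g).comp (measurable_gridFloor r)

lemma summable_one_add_norm_rpow {s : ℝ} (hs : (d : ℝ) < s) :
    Summable fun k : Fin d → ℤ => (1 + ‖k‖) ^ (-s) := by
  have hs0 : 0 ≤ s := (Nat.cast_nonneg d).trans hs.le
  have h1 : Integrable fun u : Fin d → ℝ => (1 + ‖u‖) ^ (-s) :=
    integrable_one_add_norm (by simpa using hs)
  refine (hasSum_floor (Integrable.mono' (h1.const_mul ((2 : ℝ) ^ s))
    (measurable_comp_gridFloor _ 1).aestronglyMeasurable (ae_of_all _ fun u => ?_))).summable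
  have h2 : 0 < 1 + ‖u‖ := by positivity
  rw [Real.norm_of_nonneg (by positivity)]
  calc (1 + ‖gridFloor 1 u‖) ^ (-s) ≤ ((1 + ‖u‖) / 2) ^ (-s) :=
        Real.rpow_le_rpow_of_nonpos (by positivity) (one_add_norm_le_floor u) (by linarith)
    _ = 2 ^ s * (1 + ‖u‖) ^ (-s) := by
        rw [Real.div_rpow h2.le (by norm_num), Real.rpow_neg (by norm_num : (0 : ℝ) ≤ 2),
          div_inv_eq_mul, mul_comm]

lemma finite_norm_le (M : ℝ) : {k : Fin d → ℤ | ‖k‖ ≤ M}.Finite := by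
  refine (Set.Finite.pi' fun _ => Set.finite_Icc (-⌈M⌉) ⌈M⌉).subset fun k hk i => ?_
  have h1 : ‖k i‖ ≤ M := (norm_le_pi_norm k i).trans hk
  rw [Int.norm_eq_abs] at h1
  have h2 : ((|k i| : ℤ) : ℝ) ≤ (⌈M⌉ : ℝ) := by push_cast; exact h1.trans (Int.le_ceil M)
  exact Set.mem_Icc.2 (abs_le.1 (by exact_mod_cast h2))

lemma tendsto_norm_cofinite : Tendsto (fun k : Fin d → ℤ => ‖k‖) cofinite atTop := by
  rw [tendsto_atTop]
  intro M
  exact (finite_norm_le M).eventually_cofinite_notMem.mono fun k hk =>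
    (not_le.1 hk).le

/-- The truncated critical lattice sum is at least of logarithmic size. -/
lemma exists_log_le_tsum (hd : 0 < d) : ∃ c : ℝ, 0 < c ∧ ∀ M : ℝ, 1 ≤ M →
    c * Real.log M ≤ ∑' k : Fin d → ℤ, if ‖k‖ ≤ M + 1 then (1 + ‖k‖) ^ (-(d : ℝ)) else 0 := by
  have : Nonempty (Fin d) := ⟨⟨0, hd⟩⟩
  set V : ℝ := volume.real (Metric.ball (0 : Fin d → ℝ) 1) with hV
  have hVp : 0 < V := ENNReal.toReal_pos
    (Metric.measure_ball_pos volume _ one_pos).ne' measure_ball_lt_top.ne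
  -- One factor `2^(-d)` pays for comparing a lattice point with its cell, `d * V` comes from polar
  -- coordinates, and the other `2^(-d)` from `1 + y ≤ 2 y` for `y ≥ 1`.
  refine ⟨(2 : ℝ) ^ (-(d : ℝ)) * (d * V * 2 ^ (-(d : ℝ))), by positivity, fun M hM => ?_⟩
  set f : ℝ → ℝ := fun y => if y ≤ M then (1 + y) ^ (-(d : ℝ)) else 0 with hf
  have hsum : Summable fun k : Fin d → ℤ =>
      if ‖k‖ ≤ M + 1 then (1 + ‖k‖) ^ (-(d : ℝ)) else 0 :=
    summable_of_hasFiniteSupport ((finite_norm_le (M + 1)).subset fun k hk => by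
      by_contra h
      exact hk (if_neg h))
  have hint := integrable_gridFloor one_pos hsum
  have hle : ∀ u : Fin d → ℝ, (2 : ℝ) ^ (-(d : ℝ)) * f ‖u‖ ≤
      if ‖gridFloor 1 u‖ ≤ M + 1 then (1 + ‖gridFloor 1 u‖) ^ (-(d : ℝ)) else 0 := by
    intro u
    have h2 : 0 < 1 + ‖u‖ := by positivity
    by_cases h : ‖u‖ ≤ M
    · have h' := norm_gridFloor_le 1 u
      rw [one_smul] at h'
      rw [if_pos (by linarith), hf]
      simp only [h, if_true]
      rw [← Real.mul_rpow (by norm_num) h2.le]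
      exact Real.rpow_le_rpow_of_nonpos (by positivity) (one_add_norm_floor_le u) (by simp)
    · simp only [hf, h, if_false, mul_zero]
      split_ifs <;> positivity
  have hfm : Measurable f := by
    refine Measurable.ite measurableSet_Iic ?_ measurable_const
    fun_prop
  have hfi : Integrable fun u : Fin d → ℝ => f ‖u‖ := by
    refine (Integrable.mono' hint (g := fun u => if ‖gridFloor 1 u‖ ≤ M + 1 then
      (1 + ‖gridFloor 1 u‖) ^ (-(d : ℝ)) else 0) (f := fun u => (2 : ℝ) ^ (-(d : ℝ)) * f ‖u‖)
      ((hfm.comp measurable_norm).const_mul _).aestronglyMeasurable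
      (ae_of_all _ fun u => ?_)).const_mul ((2 : ℝ) ^ (d : ℝ)) |>.congr
      (ae_of_all _ fun u => ?_)
    · rw [Real.norm_of_nonneg]
      · exact hle u
      · simp only [hf]; split_ifs <;> positivity
    · simp only
      rw [← mul_assoc, ← Real.rpow_add (by norm_num)]
      simp
  have h1 := integral_mono (hfi.const_mul ((2 : ℝ) ^ (-(d : ℝ)))) hint hle
  rw [(hasSum_floor hint).tsum_eq]
  refine le_trans ?_ h1
  rw [integral_const_mul, integral_fun_norm_addHaar, Module.finrank_fin_fun, nsmul_eq_mul,
    smul_eq_mul, ← hV, mul_assoc, mul_assoc, mul_assoc]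
  gcongr ?_ * (?_ * (?_ * ?_))
  have hfi' := (integrable_fun_norm_addHaar (volume : Measure (Fin d → ℝ))).1 hfi
  rw [Module.finrank_fin_fun] at hfi'
  -- Radii in `(1, M]` suffice: there the radial integrand is at least a multiple of `1 / y`.
  have hsub : Set.Ioc 1 M ⊆ Set.Ioi (0 : ℝ) := fun y hy => zero_lt_one.trans hy.1
  have hnn : ∀ y ∈ Set.Ioi (0 : ℝ), 0 ≤ y ^ (d - 1) • f y := by
    intro y hy
    have : (0 : ℝ) < y := hy
    simp only [hf, smul_eq_mul]; split_ifs <;> positivity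
  refine le_trans ?_ (setIntegral_mono_set hfi' (ae_restrict_of_forall_mem measurableSet_Ioi hnn)
    (Eventually.of_forall hsub))
  have hlog : ∫ y in Set.Ioc 1 M, (2 : ℝ) ^ (-(d : ℝ)) * y⁻¹ = 2 ^ (-(d : ℝ)) * Real.log M := by
    rw [integral_const_mul, ← intervalIntegral.integral_of_le hM,
      integral_inv_of_pos one_pos (by linarith), div_one]
  rw [← hlog]
  refine setIntegral_mono_on ?_ (hfi'.mono_set hsub) measurableSet_Ioc fun y hy => ?_
  · refine IntegrableOn.mono_set (t := Set.Icc 1 M) (ContinuousOn.integrableOn_Icc ?_)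
      Set.Ioc_subset_Icc_self
    refine continuousOn_const.mul (continuousOn_id.inv₀ fun y hy => ?_)
    exact (zero_lt_one.trans_le hy.1).ne'
  · have hy1 : 1 < y := hy.1
    have hy0 : 0 < y := by linarith
    simp only [hf, hy.2, if_true, smul_eq_mul]
    have h3 : (2 * y) ^ (-(d : ℝ)) ≤ (1 + y) ^ (-(d : ℝ)) :=
      Real.rpow_le_rpow_of_nonpos (by linarith) (by linarith) (by simp)
    calc (2 : ℝ) ^ (-(d : ℝ)) * y⁻¹ = y ^ (d - 1) * (2 * y) ^ (-(d : ℝ)) := by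
          rw [Real.mul_rpow (by norm_num) hy0.le, mul_left_comm, ← Real.rpow_natCast y,
            ← Real.rpow_add hy0, Nat.cast_sub hd, ← Real.rpow_neg_one]
          congr 2; push_cast; ring
      _ ≤ _ := by gcongr

/-- For `s ≤ d` the series dominates every truncation of the critical one, and these grow like a
logarithm. -/
lemma lt_of_summable_one_add_norm_rpow (hd : 0 < d) {s : ℝ}
    (h : Summable fun k : Fin d → ℤ => (1 + ‖k‖) ^ (-s)) : (d : ℝ) < s := by
  by_contra! hs
  obtain ⟨c, hc, hlog⟩ := exists_log_le_tsum hd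
  set A := ∑' k : Fin d → ℤ, (1 + ‖k‖) ^ (-s)
  obtain ⟨M, hM, hM'⟩ := ((Real.tendsto_log_atTop.eventually_gt_atTop (A / c)).and
    (eventually_ge_atTop 1)).exists
  have h1 := hlog M hM'
  rw [div_lt_iff₀ hc] at hM
  have hle : ∀ k : Fin d → ℤ, (if ‖k‖ ≤ M + 1 then (1 + ‖k‖) ^ (-(d : ℝ)) else 0)
      ≤ (1 + ‖k‖) ^ (-s) := by
    intro k
    split_ifs
    · exact Real.rpow_le_rpow_of_exponent_le (by linarith [norm_nonneg k]) (by linarith)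
    · positivity
  have h2 : ∑' k : Fin d → ℤ, (if ‖k‖ ≤ M + 1 then (1 + ‖k‖) ^ (-(d : ℝ)) else 0) ≤ A :=
    Summable.tsum_le_tsum hle (Summable.of_nonneg_of_le
      (fun k => by split_ifs <;> positivity) hle h) h
  linarith

/-- The critical lattice sum, cut off at radius `R`, is at most of logarithmic size. -/
lemma exists_tsum_le_log (hd : 0 < d) {a : ℝ} (ha : 0 < a) : ∃ C : ℝ, 0 < C ∧ ∀ R : ℝ, 1 ≤ R →
    Summable (fun k : Fin d → ℤ => (1 + ‖k‖) ^ (-(d + a)) * min 1 (((1 + ‖k‖) / R) ^ a)) ∧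
    ∑' k : Fin d → ℤ, (1 + ‖k‖) ^ (-(d + a)) * min 1 (((1 + ‖k‖) / R) ^ a) ≤
      C * R ^ (-a) * (1 + Real.log R) := by
  have : Nonempty (Fin d) := ⟨⟨0, hd⟩⟩
  set V : ℝ := volume.real (Metric.ball (0 : Fin d → ℝ) 1) with hV
  have hVp : 0 < V := ENNReal.toReal_pos
    (Metric.measure_ball_pos volume _ one_pos).ne' measure_ball_lt_top.ne
  set B : ℝ := 2 ^ (d + a) * 2 ^ a with hB
  refine ⟨B * (d * V * (2 + 1 / a)), by positivity, fun R hR => ?_⟩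
  have hR0 : 0 < R := by linarith
  have hda : 0 ≤ d + a := by positivity
  have hsum : Summable fun k : Fin d → ℤ =>
      (1 + ‖k‖) ^ (-(d + a)) * min 1 (((1 + ‖k‖) / R) ^ a) := by
    refine Summable.of_nonneg_of_le (fun k => by positivity) (fun k => ?_)
      (summable_one_add_norm_rpow (d := d) (s := d + a) (by linarith))
    exact mul_le_of_le_one_right (by positivity) (min_le_left _ _)
  refine ⟨hsum, ?_⟩
  set f : ℝ → ℝ := fun y => (1 + y) ^ (-(d + a)) * min 1 (((1 + y) / R) ^ a) with hf
  have hle : ∀ u : Fin d → ℝ,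
      (1 + ‖gridFloor 1 u‖) ^ (-(d + a)) * min 1 (((1 + ‖gridFloor 1 u‖) / R) ^ a) ≤
        B * f ‖u‖ := by
    intro u
    have h2 : 0 < 1 + ‖u‖ := by positivity
    have h3 : (1 + ‖gridFloor 1 u‖) ^ (-(d + a)) ≤ 2 ^ (d + a) * (1 + ‖u‖) ^ (-(d + a)) := by
      calc (1 + ‖gridFloor 1 u‖) ^ (-(d + a)) ≤ ((1 + ‖u‖) / 2) ^ (-(d + a)) :=
            Real.rpow_le_rpow_of_nonpos (by positivity) (one_add_norm_le_floor u) (by linarith)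
        _ = _ := by
            rw [Real.div_rpow h2.le (by norm_num), Real.rpow_neg (by norm_num : (0 : ℝ) ≤ 2),
              div_inv_eq_mul, mul_comm]
    have h4 : min 1 (((1 + ‖gridFloor 1 u‖) / R) ^ a) ≤ 2 ^ a * min 1 (((1 + ‖u‖) / R) ^ a) := by
      rw [mul_min_of_nonneg _ _ (by positivity), mul_one,
        ← Real.mul_rpow (by norm_num) (by positivity)]
      refine min_le_min (Real.one_le_rpow (by norm_num) ha.le) ?_
      refine Real.rpow_le_rpow (by positivity) ?_ ha.le
      rw [← mul_div_assoc]
      exact div_le_div_of_nonneg_right (one_add_norm_floor_le u) hR0.le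
    calc _ ≤ (2 ^ (d + a) * (1 + ‖u‖) ^ (-(d + a))) * (2 ^ a * min 1 (((1 + ‖u‖) / R) ^ a)) := by
          gcongr
      _ = _ := by simp only [hB, hf]; ring
  have hfm : Measurable f := by fun_prop
  have hf0 : ∀ y, 0 ≤ y → 0 ≤ f y := fun y hy => by simp only [hf]; positivity
  have hfi : Integrable fun u : Fin d → ℝ => f ‖u‖ := by
    refine (integrable_one_add_norm (E := Fin d → ℝ) (r := d + a)
      (by simpa using ha)).mono' (hfm.comp measurable_norm).aestronglyMeasurable
      (ae_of_all _ fun u => ?_)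
    rw [Real.norm_of_nonneg (hf0 _ (norm_nonneg _))]
    exact mul_le_of_le_one_right (by positivity) (min_le_left _ _)
  rw [(hasSum_floor (integrable_gridFloor one_pos hsum)).tsum_eq]
  refine (integral_mono (integrable_gridFloor one_pos hsum) (hfi.const_mul B) hle).trans ?_
  rw [integral_const_mul, integral_fun_norm_addHaar, Module.finrank_fin_fun, nsmul_eq_mul,
    smul_eq_mul, ← hV]
  have hfi' := (integrable_fun_norm_addHaar (volume : Measure (Fin d → ℝ))).1 hfi
  rw [Module.finrank_fin_fun] at hfi'
  have hpow : ∀ y : ℝ, 0 < y → y ^ (d - 1) ≤ (1 + y) ^ ((d : ℝ) - 1) := by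
    intro y hy
    have h1 : (d : ℝ) - 1 = ((d - 1 : ℕ) : ℝ) := by rw [Nat.cast_sub hd, Nat.cast_one]
    rw [h1, Real.rpow_natCast]
    gcongr
    linarith
  -- Below `R` the power in the minimum is used and leaves `R^(-a) / (1 + y)`, hence the logarithm;
  -- above `R` the minimum is bounded by `1` and the tail converges.
  have hsplit : ∫ y in Set.Ioi (0 : ℝ), y ^ (d - 1) • f y ≤
      R ^ (-a) * Real.log (1 + R) + R ^ (-a) / a := by
    rw [← Set.Ioc_union_Ioi_eq_Ioi hR0.le, setIntegral_union (Set.Ioc_disjoint_Ioi le_rfl)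
      measurableSet_Ioi (hfi'.mono_set Set.Ioc_subset_Ioi_self)
      (hfi'.mono_set (Set.Ioi_subset_Ioi hR0.le))]
    refine add_le_add ?_ ?_
    · have hlog : ∫ y in Set.Ioc 0 R, R ^ (-a) * (1 + y)⁻¹ = R ^ (-a) * Real.log (1 + R) := by
        rw [integral_const_mul, ← intervalIntegral.integral_of_le hR0.le,
          intervalIntegral.integral_comp_add_left (fun y => y⁻¹) 1,
          integral_inv_of_pos (by norm_num) (by linarith)]
        simp
      rw [← hlog]
      refine setIntegral_mono_on (hfi'.mono_set Set.Ioc_subset_Ioi_self) ?_ measurableSet_Ioc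
        fun y hy => ?_
      · refine IntegrableOn.mono_set (t := Set.Icc 0 R) (ContinuousOn.integrableOn_Icc ?_)
          Set.Ioc_subset_Icc_self
        refine continuousOn_const.mul ((by fun_prop : ContinuousOn (fun y : ℝ => 1 + y) _).inv₀
          fun y hy => ?_)
        have := hy.1
        positivity
      · have hy0 : 0 < y := hy.1
        have h1y : 0 < 1 + y := by linarith
        rw [smul_eq_mul]
        calc y ^ (d - 1) * f y
            ≤ (1 + y) ^ ((d : ℝ) - 1) * ((1 + y) ^ (-(d + a)) * ((1 + y) / R) ^ a) := by
              simp only [hf]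
              have := hpow y hy0
              gcongr
              exact min_le_right _ _
          _ = _ := by
              rw [Real.div_rpow h1y.le hR0.le, Real.rpow_neg hR0.le, ← Real.rpow_neg_one (1 + y),
                div_eq_mul_inv, ← mul_assoc, ← mul_assoc, ← Real.rpow_add h1y,
                ← Real.rpow_add h1y, mul_comm]
              congr 2; ring
    · have hI : ∫ y in Set.Ioi R, y ^ (-1 - a) = R ^ (-a) / a := by
        rw [integral_Ioi_rpow_of_lt (by linarith) hR0]
        have : -1 - a + 1 = -a := by ring
        rw [this, neg_div_neg_eq]
      rw [← hI]
      refine setIntegral_mono_on (hfi'.mono_set (Set.Ioi_subset_Ioi hR0.le))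
        (integrableOn_Ioi_rpow_of_lt (by linarith) hR0) measurableSet_Ioi fun y hy => ?_
      have hy0 : 0 < y := hR0.trans hy
      have h1y : 0 < 1 + y := by linarith
      rw [smul_eq_mul]
      calc y ^ (d - 1) * f y
          ≤ (1 + y) ^ ((d : ℝ) - 1) * ((1 + y) ^ (-(d + a)) * 1) := by
            simp only [hf]
            have := hpow y hy0
            gcongr
            exact min_le_left _ _
        _ = (1 + y) ^ (-1 - a) := by
            rw [mul_one, ← Real.rpow_add h1y]
            congr 1; ring
        _ ≤ y ^ (-1 - a) :=
            Real.rpow_le_rpow_of_nonpos hy0 (by linarith) (by linarith)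
  have hlogR : 0 ≤ Real.log R := Real.log_nonneg hR
  have hlog1 : Real.log (1 + R) ≤ 1 + Real.log R := by
    calc Real.log (1 + R) ≤ Real.log (2 * R) := Real.log_le_log (by linarith) (by linarith)
      _ = Real.log 2 + Real.log R := Real.log_mul (by norm_num) hR0.ne'
      _ ≤ _ := by linarith [Real.log_two_lt_d9]
  have hRa : 0 < R ^ (-a) := by positivity
  calc B * (d * (V * ∫ y in Set.Ioi (0 : ℝ), y ^ (d - 1) • f y))
      ≤ B * (d * (V * (R ^ (-a) * (2 + 1 / a) * (1 + Real.log R)))) := by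
        gcongr
        refine hsplit.trans ?_
        have h5 : R ^ (-a) / a = R ^ (-a) * (1 / a) := by ring
        rw [h5, mul_assoc, ← mul_add]
        gcongr
        have : 0 < 1 / a := by positivity
        nlinarith
    _ = _ := by ring

end latticeSums

/-! ### The error of one mode through its alias tails -/

section tail
variable {d : ℕ}

/-- The sum of `S ^ p` over the residue class of `k` modulo `N`, without `k` itself. -/
noncomputable def aliasTail (S : (Fin d → ℤ) → ℝ) (N : ℕ) (k : Fin d → ℤ) (p : ℕ) : ℝ :=
  ∑' m : Fin d → ℤ, if m = 0 then 0 else S (k + (N : ℤ) • m) ^ p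

variable {S : (Fin d → ℤ) → ℝ} {N : ℕ}

lemma Summable.pow_of_nonneg {ι : Type*} {f : ι → ℝ} (hf : Summable f) (h0 : ∀ i, 0 ≤ f i)
    {p : ℕ} (hp : p ≠ 0) : Summable fun i => f i ^ p := by
  refine Summable.of_norm_bounded_eventually hf ?_
  filter_upwards [hf.tendsto_cofinite_zero.eventually_le_const zero_lt_one] with i hi
  rw [Real.norm_of_nonneg (pow_nonneg (h0 i) p)]
  exact pow_le_of_le_one (h0 i) hi hp

lemma Summable.ite_zero {ι : Type*} {f : ι → ℝ} (hf : Summable f) (q : ι → Prop)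
    [DecidablePred q] : Summable fun i => if q i then 0 else f i :=
  hf.norm.of_norm_bounded fun i => by split_ifs <;> simp

lemma summable_aliasTail (hS : Summable S) (hpos : ∀ k, 0 < S k) (hN : N ≠ 0) (k : Fin d → ℤ)
    {p : ℕ} (hp : p ≠ 0) :
    Summable fun m : Fin d → ℤ => if m = 0 then 0 else S (k + (N : ℤ) • m) ^ p :=
  ((summable_alias hS hN k).pow_of_nonneg (fun _ => (hpos _).le) hp).ite_zero _

lemma aliasTail_nonneg (hpos : ∀ k, 0 < S k) (k : Fin d → ℤ) (p : ℕ) : 0 ≤ aliasTail S N k p :=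
  tsum_nonneg fun m => by
    have := hpos (k + (N : ℤ) • m)
    split_ifs <;> positivity

lemma le_aliasTail_one (hS : Summable S) (hpos : ∀ k, 0 < S k) (hN : N ≠ 0) (k : Fin d → ℤ)
    {m : Fin d → ℤ} (hm : m ≠ 0) : S (k + (N : ℤ) • m) ≤ aliasTail S N k 1 := by
  have := (summable_aliasTail hS hpos hN k one_ne_zero).le_tsum m fun l _ => by
    have := hpos (k + (N : ℤ) • l)
    split_ifs <;> positivity
  rwa [if_neg hm, pow_one] at this

lemma aliasSum_eq (hS : Summable S) (hN : N ≠ 0) (k : Fin d → ℤ) :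
    aliasSum S N k = S k + aliasTail S N k 1 := by
  rw [aliasSum, (summable_alias hS hN k).tsum_eq_add_tsum_ite 0, aliasTail]
  simp

/-- The residual at `m = 0` is the tail over the full alias sum, while every other residual is minus
a normalised alias. All bounds and limits below are read off this quotient. -/
lemma modeError_eq (hS : Summable S) (hpos : ∀ k, 0 < S k) (hN : N ≠ 0) (k : Fin d → ℤ) :
    modeError S N k = (aliasTail S N k 1 ^ 2 + aliasTail S N k 2) /
      (S k + aliasTail S N k 1) ^ 2 := by
  have hA := aliasSum_pos hS hpos hN k
  have hsum : Summable fun m => residual S N k m ^ 2 := by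
    simpa only [sq_abs] using
      (summable_residual hS hN k).abs.pow_of_nonneg (fun _ => abs_nonneg _) two_ne_zero
  rw [modeError, hsum.tsum_eq_add_tsum_ite 0, ← aliasSum_eq hS hN, add_div]
  congr 1
  · rw [← div_pow]
    congr 1
    have := aliasSum_eq hS hN k
    simp only [residual, if_true, smul_zero, add_zero]
    field_simp
    linarith
  · rw [aliasTail, ← tsum_div_const]
    refine tsum_congr fun m => ?_
    split_ifs with h
    · simp
    · rw [residual, if_neg h, zero_sub, neg_sq, div_pow]

/-- Each alias in the tail is at most the whole tail. -/
lemma aliasTail_two_le (hS : Summable S) (hpos : ∀ k, 0 < S k) (hN : N ≠ 0) (k : Fin d → ℤ) :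
    aliasTail S N k 2 ≤ aliasTail S N k 1 ^ 2 := by
  rw [sq, aliasTail, aliasTail, ← tsum_mul_left]
  refine Summable.tsum_le_tsum (fun m => ?_) (summable_aliasTail hS hpos hN k two_ne_zero)
    ((summable_aliasTail hS hpos hN k one_ne_zero).mul_left _)
  split_ifs with h
  · simp
  · rw [pow_one, sq]
    exact mul_le_mul_of_nonneg_right (le_aliasTail_one hS hpos hN k h) (hpos _).le

lemma modeError_nonneg (k : Fin d → ℤ) : 0 ≤ modeError S N k := tsum_nonneg fun _ => sq_nonneg _

lemma modeError_le (hS : Summable S) (hpos : ∀ k, 0 < S k) (hN : N ≠ 0) (k : Fin d → ℤ) :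
    modeError S N k ≤ 2 * (aliasTail S N k 1 / (S k + aliasTail S N k 1)) ^ 2 := by
  rw [modeError_eq hS hpos hN, div_pow, mul_div_assoc']
  gcongr
  linarith [aliasTail_two_le hS hpos hN k]

lemma modeError_le_two (hS : Summable S) (hpos : ∀ k, 0 < S k) (hN : N ≠ 0) (k : Fin d → ℤ) :
    modeError S N k ≤ 2 := by
  refine (modeError_le hS hpos hN k).trans ?_
  have h1 := aliasTail_nonneg (N := N) hpos k 1
  have h2 := hpos k
  have h3 : aliasTail S N k 1 / (S k + aliasTail S N k 1) ≤ 1 := by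
    rw [div_le_one (by linarith)]; linarith
  have h4 : 0 ≤ aliasTail S N k 1 / (S k + aliasTail S N k 1) := by positivity
  nlinarith

lemma modeError_le_tail_div (hS : Summable S) (hpos : ∀ k, 0 < S k) (hN : N ≠ 0)
    (k : Fin d → ℤ) : modeError S N k ≤ 2 * (aliasTail S N k 1 / S k) ^ 2 := by
  refine (modeError_le hS hpos hN k).trans ?_
  have h1 := aliasTail_nonneg (N := N) hpos k 1
  have h2 := hpos k
  gcongr
  linarith

lemma le_modeError (hS : Summable S) (hpos : ∀ k, 0 < S k) (hN : N ≠ 0) (k : Fin d → ℤ) :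
    (aliasTail S N k 1 / (S k + aliasTail S N k 1)) ^ 2 ≤ modeError S N k := by
  rw [modeError_eq hS hpos hN, div_pow]
  gcongr
  linarith [aliasTail_nonneg (N := N) hpos k 2]

/-- The error of the mode `k` is at most of order `(|k| / N) ^ γ`. -/
def HasModeBound (S : (Fin d → ℤ) → ℝ) (γ : ℝ) : Prop :=
  ∃ C : ℝ, 0 < C ∧ ∀ N : ℕ, N ≠ 0 → ∀ k, modeError S N k ≤ C * ((1 + ‖k‖) / N) ^ γ

lemma HasModeBound.mono (hS : Summable S) (hpos : ∀ k, 0 < S k) {γ γ' : ℝ}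
    (h : HasModeBound S γ) (h0 : 0 ≤ γ') (hγ : γ' ≤ γ) : HasModeBound S γ' := by
  obtain ⟨C, hC, hb⟩ := h
  refine ⟨C + 2, by positivity, fun N hN k => ?_⟩
  have hN0 : (0 : ℝ) < N := by positivity
  have hx : 0 < (1 + ‖k‖) / N := by positivity
  -- Lowering the exponent weakens the bound when the ratio is at most `1`; otherwise the universal
  -- bound `2` takes over, whence `C + 2`.
  rcases le_total ((1 + ‖k‖) / N) 1 with h1 | h1
  · calc modeError S N k ≤ C * ((1 + ‖k‖) / N) ^ γ := hb N hN k
      _ ≤ C * ((1 + ‖k‖) / N) ^ γ' :=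
          mul_le_mul_of_nonneg_left (Real.rpow_le_rpow_of_exponent_ge hx h1 hγ) hC.le
      _ ≤ _ := by gcongr; linarith
  · have h2 := Real.one_le_rpow h1 h0
    calc modeError S N k ≤ 2 := modeError_le_two hS hpos hN k
      _ ≤ (C + 2) * 1 := by linarith
      _ ≤ _ := by gcongr

end tail

/-! ### Power-law spectra: two-sided mode bounds -/

/-- `S` decays on the lattice like a function `G` homogeneous of degree `-α`. -/
structure PowerLaw {d : ℕ} (S : (Fin d → ℤ) → ℝ) (α : ℝ) (G : (Fin d → ℝ) → ℝ) : Prop where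
  pos : ∀ k, 0 < S k
  lower : ∃ c : ℝ, 0 < c ∧ ∀ k, c * (1 + ‖k‖) ^ (-α) ≤ S k
  upper : ∃ C : ℝ, 0 < C ∧ ∀ k, S k ≤ C * (1 + ‖k‖) ^ (-α)
  profile_pos : ∀ v, v ≠ 0 → 0 < G v
  tendsto : ∀ (k : ℕ → Fin d → ℤ) (v : Fin d → ℝ), v ≠ 0 →
    Tendsto (fun N : ℕ => (N : ℝ)⁻¹ • fun i => (k N i : ℝ)) atTop (𝓝 v) →
    Tendsto (fun N : ℕ => (N : ℝ) ^ α * S (k N)) atTop (𝓝 (G v))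

section powerLaw
variable {d : ℕ} {S : (Fin d → ℤ) → ℝ} {α : ℝ} {G : (Fin d → ℝ) → ℝ}

/-- The spectrum dominates a multiple of `(1 + ‖k‖)^(-α)`, so its summability forces that of the
power. -/
lemma PowerLaw.lt_exponent (h : PowerLaw S α G) (hd : 0 < d) (hS : Summable S) : (d : ℝ) < α := by
  obtain ⟨c, hc, hl⟩ := h.lower
  refine lt_of_summable_one_add_norm_rpow hd (Summable.of_nonneg_of_le (fun k => by positivity)
    (fun k => ?_) (hS.mul_left c⁻¹))
  rw [inv_mul_eq_div, le_div_iff₀ hc, mul_comm]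
  exact hl k

lemma one_le_norm_of_ne_zero {m : Fin d → ℤ} (hm : m ≠ 0) : 1 ≤ ‖m‖ := by
  obtain ⟨i, hi⟩ := Function.ne_iff.mp hm
  refine le_trans ?_ (norm_le_pi_norm m i)
  rw [Int.norm_eq_abs]
  exact_mod_cast Int.one_le_abs hi

lemma le_norm_add_smul {N : ℕ} (k m : Fin d → ℤ) :
    N * ‖m‖ - ‖k‖ ≤ ‖k + (N : ℤ) • m‖ := by
  have h1 : ‖(N : ℤ) • m‖ = N * ‖m‖ := by
    rw [← norm_intCast_fun, ← norm_intCast_fun]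
    have : (fun i => (((N : ℤ) • m) i : ℝ)) = (N : ℝ) • fun i => (m i : ℝ) := by
      ext i; simp
    rw [this, norm_smul, RCLike.norm_natCast]
  have h2 := norm_sub_norm_le ((N : ℤ) • m) (-k)
  rw [norm_neg, sub_neg_eq_add, add_comm, h1] at h2
  rwa [add_comm k, add_comm] at *

lemma norm_add_smul_le {N : ℕ} (k m : Fin d → ℤ) :
    ‖k + (N : ℤ) • m‖ ≤ ‖k‖ + N * ‖m‖ := by
  have h1 : ‖(N : ℤ) • m‖ = N * ‖m‖ := by
    rw [← norm_intCast_fun, ← norm_intCast_fun]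
    have : (fun i => (((N : ℤ) • m) i : ℝ)) = (N : ℝ) • fun i => (m i : ℝ) := by
      ext i; simp
    rw [this, norm_smul, RCLike.norm_natCast]
  rw [← h1]
  exact norm_add_le _ _

lemma PowerLaw.exists_aliasTail_le (h : PowerLaw S α G) (hα : (d : ℝ) < α) (hS : Summable S) :
    ∃ C : ℝ, 0 < C ∧ ∀ N : ℕ, N ≠ 0 → ∀ k : Fin d → ℤ, 2 * ‖k‖ ≤ N →
      aliasTail S N k 1 ≤ C * (N : ℝ) ^ (-α) := by
  obtain ⟨C, hC, hu⟩ := h.upper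
  have hα0 : 0 < α := (Nat.cast_nonneg d).trans_lt hα
  have hsum := summable_one_add_norm_rpow hα
  have hsp : 0 < ∑' m : Fin d → ℤ, (1 + ‖m‖) ^ (-α) :=
    hsum.tsum_pos (fun m => by positivity) 0 (by positivity)
  refine ⟨C * 4 ^ α * ∑' m : Fin d → ℤ, (1 + ‖m‖) ^ (-α), by positivity, fun N hN k hk => ?_⟩
  have hN0 : (0 : ℝ) < N := by positivity
  calc aliasTail S N k 1 ≤ ∑' m : Fin d → ℤ, C * 4 ^ α * (N : ℝ) ^ (-α) * (1 + ‖m‖) ^ (-α) := by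
        refine Summable.tsum_le_tsum (fun m => ?_) (summable_aliasTail hS h.pos hN k one_ne_zero)
          (hsum.mul_left _)
        split_ifs with hm
        · positivity
        · have h1 := one_le_norm_of_ne_zero hm
          have h2 := le_norm_add_smul (N := N) k m
          -- From `‖k‖ ≤ N / 2` and `‖m‖ ≥ 1`: `N ‖m‖ - N / 2 ≥ N ‖m‖ / 2 ≥ N (1 + ‖m‖) / 4`. This
          -- is the source of `4 ^ α`.
          have h3 : N / 4 * (1 + ‖m‖) ≤ 1 + ‖k + (N : ℤ) • m‖ := by nlinarith
          rw [pow_one]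
          calc S (k + (N : ℤ) • m) ≤ C * (1 + ‖k + (N : ℤ) • m‖) ^ (-α) := hu _
            _ ≤ C * (N / 4 * (1 + ‖m‖)) ^ (-α) := by
                refine mul_le_mul_of_nonneg_left ?_ hC.le
                exact Real.rpow_le_rpow_of_nonpos (by positivity) h3 (by linarith)
            _ = _ := by
                rw [Real.mul_rpow (by positivity) (by positivity),
                  Real.div_rpow hN0.le (by norm_num), Real.rpow_neg (by norm_num : (0 : ℝ) ≤ 4),
                  div_inv_eq_mul]
                ring
    _ = _ := by rw [tsum_mul_left]; ring

/-- For `‖k‖ ≤ N / 2` the ratio of tail to spectrum is of order `((1 + ‖k‖) / N)^α`, and the error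
is quadratic in it. For larger `k` the right-hand side is already bounded below. -/
lemma PowerLaw.hasModeBound (h : PowerLaw S α G) (hα : (d : ℝ) < α) (hS : Summable S) :
    HasModeBound S (2 * α) := by
  obtain ⟨C, hC, ht⟩ := h.exists_aliasTail_le hα hS
  obtain ⟨c, hc, hl⟩ := h.lower
  have hα0 : 0 < α := (Nat.cast_nonneg d).trans_lt hα
  refine ⟨2 * (C / c) ^ 2 + 2 * 2 ^ (2 * α), by positivity, fun N hN k => ?_⟩
  have hN0 : (0 : ℝ) < N := by positivity
  have hk0 : 0 < 1 + ‖k‖ := by positivity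
  have hx : 0 < (1 + ‖k‖) / N := by positivity
  rcases le_total (2 * ‖k‖) N with hk | hk
  · have h1 : aliasTail S N k 1 / S k ≤ C / c * ((1 + ‖k‖) / N) ^ α := by
      calc aliasTail S N k 1 / S k ≤ C * (N : ℝ) ^ (-α) / (c * (1 + ‖k‖) ^ (-α)) := by
            gcongr
            · exact ht N hN k hk
            · exact hl k
        _ = _ := by
            rw [Real.div_rpow hk0.le hN0.le, Real.rpow_neg hN0.le, Real.rpow_neg hk0.le]
            field_simp
    calc modeError S N k ≤ 2 * (aliasTail S N k 1 / S k) ^ 2 :=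
          modeError_le_tail_div hS h.pos hN k
      _ ≤ 2 * (C / c * ((1 + ‖k‖) / N) ^ α) ^ 2 := by
          have := div_nonneg (aliasTail_nonneg (N := N) h.pos k 1) (h.pos k).le
          gcongr
      _ = 2 * (C / c) ^ 2 * ((1 + ‖k‖) / N) ^ (2 * α) := by
          rw [mul_pow, ← Real.rpow_natCast (((1 + ‖k‖) / N) ^ α), ← Real.rpow_mul hx.le,
            mul_comm α]
          push_cast; ring
      _ ≤ _ := by gcongr; linarith [show (0 : ℝ) < 2 * 2 ^ (2 * α) by positivity]
  · have h2 : 1 ≤ 2 * ((1 + ‖k‖) / N) := by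
      rw [mul_div_assoc', le_div_iff₀ hN0]; linarith
    calc modeError S N k ≤ 2 * 1 := by
          rw [mul_one]; exact modeError_le_two hS h.pos hN k
      _ ≤ 2 * (2 * ((1 + ‖k‖) / N)) ^ (2 * α) := by
          gcongr; exact Real.one_le_rpow h2 (by positivity)
      _ = 2 * 2 ^ (2 * α) * ((1 + ‖k‖) / N) ^ (2 * α) := by
          rw [Real.mul_rpow (by norm_num) hx.le, mul_assoc]
      _ ≤ _ := by gcongr; linarith [show (0 : ℝ) < 2 * (C / c) ^ 2 by positivity]

lemma PowerLaw.exists_le_modeError (h : PowerLaw S α G) (hd : 0 < d) (hS : Summable S) :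
    ∃ c : ℝ, 0 < c ∧ ∀ N : ℕ, N ≠ 0 → ∀ k : Fin d → ℤ, 2 * ‖k‖ ≤ N →
      c * ((1 + ‖k‖) / N) ^ (2 * α) ≤ modeError S N k := by
  have hα := h.lt_exponent hd hS
  obtain ⟨C, hC, ht⟩ := h.exists_aliasTail_le hα hS
  obtain ⟨c, hc, hl⟩ := h.lower
  obtain ⟨C', hC', hu⟩ := h.upper
  have hα0 : 0 < α := (Nat.cast_nonneg d).trans_lt hα
  have : Nonempty (Fin d) := ⟨⟨0, hd⟩⟩
  set D : ℝ := C' + C * 2 ^ α with hD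
  refine ⟨(c * 3 ^ (-α) / D) ^ 2, by positivity, fun N hN k hk => ?_⟩
  have hN0 : (0 : ℝ) < N := by positivity
  have hN1 : (1 : ℝ) ≤ N := by exact_mod_cast Nat.one_le_iff_ne_zero.2 hN
  have hk0 : 0 < 1 + ‖k‖ := by positivity
  have hx : 0 < (1 + ‖k‖) / N := by positivity
  -- A single alias, `m = (1, …, 1)`, already has the order of the whole tail: it satisfies `1 + ‖k
  -- + N m‖ ≤ 3 N`.
  have h1 : c * 3 ^ (-α) * (N : ℝ) ^ (-α) ≤ aliasTail S N k 1 := by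
    have hone : (1 : Fin d → ℤ) ≠ 0 := one_ne_zero
    have hnorm : ‖(1 : Fin d → ℤ)‖ ≤ 1 :=
      (pi_norm_le_iff_of_nonneg zero_le_one).2 fun i => by simp
    have h3 := norm_add_smul_le (N := N) k 1
    calc c * 3 ^ (-α) * (N : ℝ) ^ (-α) = c * (3 * N) ^ (-α) := by
          rw [Real.mul_rpow (by norm_num) hN0.le, mul_assoc]
      _ ≤ c * (1 + ‖k + (N : ℤ) • (1 : Fin d → ℤ)‖) ^ (-α) := by
          refine mul_le_mul_of_nonneg_left ?_ hc.le
          exact Real.rpow_le_rpow_of_nonpos (by positivity) (by nlinarith) (by linarith)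
      _ ≤ S (k + (N : ℤ) • 1) := hl _
      _ ≤ _ := le_aliasTail_one hS h.pos hN k hone
  have h2 : S k + aliasTail S N k 1 ≤ D * (1 + ‖k‖) ^ (-α) := by
    rw [hD, add_mul]
    refine add_le_add (hu k) ((ht N hN k hk).trans ?_)
    rw [mul_assoc]
    refine mul_le_mul_of_nonneg_left ?_ hC.le
    calc (N : ℝ) ^ (-α) ≤ ((1 + ‖k‖) / 2) ^ (-α) :=
          Real.rpow_le_rpow_of_nonpos (by positivity) (by linarith) (by linarith)
      _ = _ := by
          rw [Real.div_rpow hk0.le (by norm_num), Real.rpow_neg (by norm_num : (0 : ℝ) ≤ 2),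
            div_inv_eq_mul, mul_comm]
  have h3 : c * 3 ^ (-α) / D * ((1 + ‖k‖) / N) ^ α ≤
      aliasTail S N k 1 / (S k + aliasTail S N k 1) := by
    have hpos : 0 < S k + aliasTail S N k 1 :=
      add_pos_of_pos_of_nonneg (h.pos k) (aliasTail_nonneg h.pos k 1)
    calc c * 3 ^ (-α) / D * ((1 + ‖k‖) / N) ^ α
        = c * 3 ^ (-α) * (N : ℝ) ^ (-α) / (D * (1 + ‖k‖) ^ (-α)) := by
          rw [Real.div_rpow hk0.le hN0.le, Real.rpow_neg hN0.le, Real.rpow_neg hk0.le]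
          field_simp
      _ ≤ _ := div_le_div₀ (aliasTail_nonneg h.pos k 1) h1 hpos h2
  calc (c * 3 ^ (-α) / D) ^ 2 * ((1 + ‖k‖) / N) ^ (2 * α)
      = (c * 3 ^ (-α) / D * ((1 + ‖k‖) / N) ^ α) ^ 2 := by
        rw [mul_pow, ← Real.rpow_natCast (((1 + ‖k‖) / N) ^ α), ← Real.rpow_mul hx.le,
          mul_comm α]
        norm_num
    _ ≤ _ := pow_le_pow_left₀ (by positivity) h3 2
    _ ≤ _ := le_modeError hS h.pos hN k

end powerLaw

/-! ### Gaussian spectra: mode bounds of every order -/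

section gaussian
variable {d : ℕ} {S : (Fin d → ℤ) → ℝ} {c a : ℝ}

lemma exists_exp_neg_le {b : ℝ} (hb : 0 < b) (s : ℝ) :
    ∃ C : ℝ, 0 < C ∧ ∀ x : ℝ, 1 ≤ x → Real.exp (-(b * x)) ≤ C * x ^ (-s) := by
  set n := ⌈s⌉₊
  refine ⟨n.factorial / b ^ n, by positivity, fun x hx => ?_⟩
  have hx0 : 0 < x := by linarith
  have h1 := Real.pow_div_factorial_le_exp (b * x) (by positivity) n
  have h2 : Real.exp (-(b * x)) ≤ n.factorial / (b * x) ^ n := by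
    rw [Real.exp_neg, inv_le_comm₀ (Real.exp_pos _) (by positivity), inv_div]
    exact h1
  refine h2.trans ?_
  rw [mul_pow, ← div_div, Real.rpow_neg hx0.le, ← div_eq_mul_inv]
  refine div_le_div_of_nonneg_left (by positivity) (by positivity) ?_
  rw [← Real.rpow_natCast]
  exact Real.rpow_le_rpow_of_exponent_le hx (Nat.le_ceil s)

/-- Integers satisfy `|n| ≤ n²`. -/
lemma norm_le_sum_sq (k : Fin d → ℤ) : ‖k‖ ≤ ∑ i, (k i : ℝ) ^ 2 := by
  refine (pi_norm_le_iff_of_nonneg (Finset.sum_nonneg fun i _ => sq_nonneg _)).2 fun i => ?_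
  refine le_trans ?_ (Finset.single_le_sum (f := fun i => (k i : ℝ) ^ 2)
    (fun i _ => sq_nonneg _) (Finset.mem_univ i))
  have : |k i| ≤ k i ^ 2 := by
    rw [← sq_abs]; exact Int.le_self_sq _
  rw [Int.norm_eq_abs]
  exact_mod_cast this

lemma exists_exp_neg_sum_sq_le {b : ℝ} (hb : 0 < b) (s : ℝ) :
    ∃ C : ℝ, 0 < C ∧ ∀ k : Fin d → ℤ,
      Real.exp (-(b * ∑ i, (k i : ℝ) ^ 2)) ≤ C * (1 + ‖k‖) ^ (-s) := by
  obtain ⟨C, hC, h⟩ := exists_exp_neg_le hb s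
  refine ⟨Real.exp b * C, by positivity, fun k => ?_⟩
  calc Real.exp (-(b * ∑ i, (k i : ℝ) ^ 2)) ≤ Real.exp (b + -(b * (1 + ‖k‖))) := by
        refine Real.exp_le_exp.2 ?_
        nlinarith [norm_le_sum_sq k]
    _ = Real.exp b * Real.exp (-(b * (1 + ‖k‖))) := Real.exp_add _ _
    _ ≤ _ := by
        rw [mul_assoc]
        exact mul_le_mul_of_nonneg_left (h _ (by linarith [norm_nonneg k])) (Real.exp_pos b).le

lemma summable_exp_neg_sum_sq {b : ℝ} (hb : 0 < b) :
    Summable fun k : Fin d → ℤ => Real.exp (-(b * ∑ i, (k i : ℝ) ^ 2)) := by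
  obtain ⟨C, hC, h⟩ := exists_exp_neg_sum_sq_le (d := d) hb (d + 1)
  exact Summable.of_nonneg_of_le (fun k => (Real.exp_pos _).le) h
    ((summable_one_add_norm_rpow (by linarith)).mul_left C)

/-- A Gaussian spectrum is exponentially small at all aliases of a frequency that lies in the
interior of the fundamental cell. -/
lemma exists_gaussian_aliasTail_le (hc : 0 < c) (ha : 0 < a)
    (hG : ∀ k, S k = c * Real.exp (-(a * ∑ i, (k i : ℝ) ^ 2))) (hS : Summable S)
    {η : ℝ} (hη : 0 < η) :
    ∃ C : ℝ, 0 < C ∧ ∀ N : ℕ, N ≠ 0 → ∀ k : Fin d → ℤ, 2 * ‖k‖ ≤ (1 - η) * N →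
      aliasTail S N k 1 ≤ C * Real.exp (-(a * η / 2 * N)) * S k := by
  have hpos : ∀ k, 0 < S k := fun k => by rw [hG]; positivity
  have hsum := summable_exp_neg_sum_sq (d := d) (b := a * η / 2) (by positivity)
  refine ⟨_, hsum.tsum_pos (fun k => (Real.exp_pos _).le) 0 (Real.exp_pos _), fun N hN k hk => ?_⟩
  have hN1 : (1 : ℝ) ≤ N := by exact_mod_cast Nat.one_le_iff_ne_zero.2 hN
  rw [mul_assoc, ← tsum_mul_right]
  refine Summable.tsum_le_tsum (fun m => ?_) (summable_aliasTail hS hpos hN k one_ne_zero)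
    (hsum.mul_right _)
  split_ifs with hm
  · have := hpos k; positivity
  rw [pow_one, hG, hG, ← mul_assoc, mul_left_comm]
  refine mul_le_mul_of_nonneg_left ?_ hc.le
  rw [← Real.exp_add, ← Real.exp_add]
  refine Real.exp_le_exp.2 ?_
  set J : ℝ := ∑ i, (m i : ℝ) ^ 2 with hJ
  have hJ1 : 1 ≤ J := (one_le_norm_of_ne_zero hm).trans (norm_le_sum_sq m)
  -- In the expansion of `|k + N m|²` the cross term `2 N k·m` costs at most `(1 - η) N² |m|²`,
  -- because `2 |k i| ≤ (1 - η) N` and `|m i| ≤ (m i)²`.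
  have hkey : ∑ i, (k i : ℝ) ^ 2 + η * N ^ 2 * J ≤ ∑ i, ((k + (N : ℤ) • m) i : ℝ) ^ 2 := by
    rw [hJ, Finset.mul_sum, ← Finset.sum_add_distrib]
    refine Finset.sum_le_sum fun i _ => ?_
    have h1 : |(k i : ℝ)| ≤ ‖k‖ := by
      rw [← Int.norm_eq_abs]; exact norm_le_pi_norm k i
    have h2 : |(m i : ℝ)| ≤ (m i : ℝ) ^ 2 := by
      have : |m i| ≤ m i ^ 2 := by rw [← sq_abs]; exact Int.le_self_sq _
      exact_mod_cast this
    have h3 : -(|(k i : ℝ)| * |(m i : ℝ)|) ≤ k i * m i := by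
      rw [← abs_mul]; exact neg_abs_le _
    have h4 : 2 * (|(k i : ℝ)| * |(m i : ℝ)|) ≤ (1 - η) * N * (m i : ℝ) ^ 2 := by
      have h5 : 0 ≤ (1 - η) * N := le_trans (by positivity) hk
      calc 2 * (|(k i : ℝ)| * |(m i : ℝ)|) = (2 * |(k i : ℝ)|) * |(m i : ℝ)| := by ring
        _ ≤ ((1 - η) * N) * (m i : ℝ) ^ 2 :=
            mul_le_mul (by linarith) h2 (abs_nonneg _) h5
    simp only [Pi.add_apply, Pi.smul_apply, smul_eq_mul]
    push_cast
    nlinarith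
  have h6 : N * ((1 + J) / 2) ≤ N ^ 2 * J := by
    have : (N : ℝ) ≤ N ^ 2 := by nlinarith
    nlinarith
  -- The gain is shared: the part in `N` gives the exponential decay, the part in `J` the
  -- summability over `m`.
  have h7 : (N + J) / 2 ≤ N ^ 2 * J := by nlinarith
  have h8 : a * η * ((N + J) / 2) ≤ a * η * (N ^ 2 * J) := by gcongr
  nlinarith

lemma gaussian_hasModeBound (hc : 0 < c) (ha : 0 < a)
    (hG : ∀ k, S k = c * Real.exp (-(a * ∑ i, (k i : ℝ) ^ 2))) (hS : Summable S)
    {γ : ℝ} (hγ : 0 ≤ γ) : HasModeBound S γ := by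
  have hpos : ∀ k, 0 < S k := fun k => by rw [hG]; positivity
  -- With `η = 1/2` the modes `4 ‖k‖ ≤ N` have exponentially small error, below any power of `1 /
  -- N`; for the others `4 (1 + ‖k‖) / N ≥ 1` and the bound `2` suffices.
  obtain ⟨C, hC, ht⟩ := exists_gaussian_aliasTail_le hc ha hG hS (η := 1 / 2) (by norm_num)
  obtain ⟨C', hC', he⟩ := exists_exp_neg_le (b := a * (1 / 2) / 2) (by positivity) (γ / 2)
  refine ⟨2 * (C * C') ^ 2 + 2 * 4 ^ γ, by positivity, fun N hN k => ?_⟩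
  have hN0 : (0 : ℝ) < N := by positivity
  have hN1 : (1 : ℝ) ≤ N := by exact_mod_cast Nat.one_le_iff_ne_zero.2 hN
  have hk0 : 0 < 1 + ‖k‖ := by positivity
  have hx : 0 < (1 + ‖k‖) / N := by positivity
  rcases le_total (4 * ‖k‖) N with hk | hk
  · have h1 : aliasTail S N k 1 / S k ≤ C * C' * (N : ℝ) ^ (-(γ / 2)) := by
      rw [div_le_iff₀ (hpos k)]
      refine (ht N hN k (by linarith)).trans ?_
      rw [mul_assoc C C']
      exact mul_le_mul_of_nonneg_right (mul_le_mul_of_nonneg_left (he N hN1) hC.le) (hpos k).le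
    calc modeError S N k ≤ 2 * (aliasTail S N k 1 / S k) ^ 2 :=
          modeError_le_tail_div hS hpos hN k
      _ ≤ 2 * (C * C' * (N : ℝ) ^ (-(γ / 2))) ^ 2 := by
          have := div_nonneg (aliasTail_nonneg (N := N) hpos k 1) (hpos k).le
          gcongr
      _ = 2 * (C * C') ^ 2 * (1 / N) ^ γ := by
          rw [mul_pow, ← Real.rpow_natCast ((N : ℝ) ^ (-(γ / 2))), ← Real.rpow_mul hN0.le,
            one_div, Real.inv_rpow hN0.le, ← Real.rpow_neg hN0.le]
          push_cast
          ring_nf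
      _ ≤ 2 * (C * C') ^ 2 * ((1 + ‖k‖) / N) ^ γ := by
          gcongr
          linarith [norm_nonneg k]
      _ ≤ _ := by gcongr; linarith [show (0 : ℝ) < 2 * 4 ^ γ by positivity]
  · have h2 : 1 ≤ 4 * ((1 + ‖k‖) / N) := by
      rw [mul_div_assoc', le_div_iff₀ hN0]; linarith
    calc modeError S N k ≤ 2 * 1 := by
          rw [mul_one]; exact modeError_le_two hS hpos hN k
      _ ≤ 2 * (4 * ((1 + ‖k‖) / N)) ^ γ := by
          gcongr; exact Real.one_le_rpow h2 hγ
      _ = 2 * 4 ^ γ * ((1 + ‖k‖) / N) ^ γ := by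
          rw [Real.mul_rpow (by norm_num) hx.le, mul_assoc]
      _ ≤ _ := by gcongr; linarith [show (0 : ℝ) < 2 * (C * C') ^ 2 by positivity]

end gaussian

/-! ### Scaling limits of alias tails and mode errors -/

section limits
variable {d : ℕ} {S : (Fin d → ℤ) → ℝ} {α : ℝ} {G : (Fin d → ℝ) → ℝ}
  {k : ℕ → Fin d → ℤ} {u : Fin d → ℝ}

lemma tendsto_gridFloor (u : Fin d → ℝ) :
    Tendsto (fun N : ℕ => (N : ℝ)⁻¹ • fun i => (gridFloor N u i : ℝ)) atTop (𝓝 u) := by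
  rw [tendsto_iff_norm_sub_tendsto_zero]
  refine squeeze_zero' (Eventually.of_forall fun N => norm_nonneg _) ?_
    tendsto_inv_atTop_nhds_zero_nat
  filter_upwards [eventually_ne_atTop 0] with N hN
  have hN' : (N : ℝ) ≠ 0 := by exact_mod_cast hN
  have : (N : ℝ)⁻¹ • (fun i => (gridFloor N u i : ℝ)) - u
      = (N : ℝ)⁻¹ • ((fun i => (gridFloor N u i : ℝ)) - (N : ℝ) • u) := by
    rw [smul_sub, inv_smul_smul₀ hN']
  rw [this, norm_smul, norm_inv, RCLike.norm_natCast]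
  exact mul_le_of_le_one_right (by positivity) (norm_gridFloor_sub_le _ _)

lemma tendsto_scaled_add_smul
    (hk : Tendsto (fun N : ℕ => (N : ℝ)⁻¹ • fun i => (k N i : ℝ)) atTop (𝓝 u)) (m : Fin d → ℤ) :
    Tendsto (fun N : ℕ => (N : ℝ)⁻¹ • fun i => ((k N + (N : ℤ) • m) i : ℝ)) atTop
      (𝓝 (u + fun i => (m i : ℝ))) := by
  refine (hk.add_const _).congr' ?_
  filter_upwards [eventually_ne_atTop 0] with N hN
  have : (N : ℝ) ≠ 0 := by exact_mod_cast hN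
  ext i
  simp only [Pi.add_apply, Pi.smul_apply, smul_eq_mul]
  push_cast
  field_simp

/-- A summable majorant of the rescaled spectrum at the aliases of a frequency. -/
lemma PowerLaw.exists_majorant (h : PowerLaw S α G) (hα : (d : ℝ) < α)
    (hk : Tendsto (fun N : ℕ => (N : ℝ)⁻¹ • fun i => (k N i : ℝ)) atTop (𝓝 u))
    (hu : ∀ m : Fin d → ℤ, m ≠ 0 → (u + fun i => (m i : ℝ)) ≠ 0) :
    ∃ b : (Fin d → ℤ) → ℝ, Summable b ∧ (∀ m, 0 ≤ b m) ∧
      ∀ᶠ N : ℕ in atTop, ∀ m, m ≠ 0 → (N : ℝ) ^ α * S (k N + (N : ℤ) • m) ≤ b m := by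
  obtain ⟨C, hC, hup⟩ := h.upper
  have hα0 : 0 < α := (Nat.cast_nonneg d).trans_lt hα
  -- The point `u` may lie outside the fundamental cell, so finitely many aliases can come close to
  -- the origin. They are dominated by their limits plus `1`; for `‖m‖ > 2 ρ` the estimate `‖k N + N
  -- m‖ ≥ N ‖m‖ / 2` gives a uniform power.
  set ρ : ℝ := ‖u‖ + 1 with hρ
  have hρ1 : 1 ≤ ρ := by linarith [norm_nonneg u]
  set F : Set (Fin d → ℤ) := {m | ‖m‖ ≤ 2 * ρ} with hF
  have hFf : F.Finite := finite_norm_le _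
  classical
  refine ⟨fun m => C * 4 ^ α * (1 + ‖m‖) ^ (-α) +
    if m ∈ F then |G (u + fun i => (m i : ℝ))| + 1 else 0, ?_, fun m => ?_, ?_⟩
  · refine ((summable_one_add_norm_rpow hα).mul_left _).add
      (summable_of_hasFiniteSupport (hFf.subset fun m hm => ?_))
    by_contra hmF
    exact hm (if_neg hmF)
  · dsimp only
    split_ifs <;> positivity
  · have h1 : ∀ᶠ N : ℕ in atTop, ∀ m ∈ F, m ≠ 0 →
        (N : ℝ) ^ α * S (k N + (N : ℤ) • m) ≤ |G (u + fun i => (m i : ℝ))| + 1 := by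
      rw [eventually_all_finite hFf]
      intro m _
      by_cases hm : m = 0
      · exact Eventually.of_forall fun N h0 => (h0 hm).elim
      · have h2 := h.tendsto _ _ (hu m hm) (tendsto_scaled_add_smul hk m)
        filter_upwards [h2.eventually_le_const
          (show G (u + fun i => (m i : ℝ)) < |G (u + fun i => (m i : ℝ))| + 1 by
            linarith [le_abs_self (G (u + fun i => (m i : ℝ)))])] with N hN _
        exact hN
    have h2 : ∀ᶠ N : ℕ in atTop, ‖(N : ℝ)⁻¹ • fun i => (k N i : ℝ)‖ ≤ ρ :=
      hk.norm.eventually_le_const (by linarith)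
    filter_upwards [h1, h2, eventually_ne_atTop 0] with N hN1 hN2 hN0 m hm
    have hNp : (0 : ℝ) < N := by positivity
    by_cases hmF : m ∈ F
    · rw [if_pos hmF]
      have := hN1 m hmF hm
      have : 0 ≤ C * 4 ^ α * (1 + ‖m‖) ^ (-α) := by positivity
      linarith
    · rw [if_neg hmF, add_zero]
      have hm2 : 2 * ρ < ‖m‖ := not_le.1 hmF
      rw [norm_smul, norm_inv, RCLike.norm_natCast, norm_intCast_fun, inv_mul_le_iff₀ hNp] at hN2
      have h3 := le_norm_add_smul (N := N) (k N) m
      have h4 : N / 4 * (1 + ‖m‖) ≤ 1 + ‖k N + (N : ℤ) • m‖ := by nlinarith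
      calc (N : ℝ) ^ α * S (k N + (N : ℤ) • m)
          ≤ (N : ℝ) ^ α * (C * (1 + ‖k N + (N : ℤ) • m‖) ^ (-α)) := by gcongr; exact hup _
        _ ≤ (N : ℝ) ^ α * (C * (N / 4 * (1 + ‖m‖)) ^ (-α)) := by
            refine mul_le_mul_of_nonneg_left (mul_le_mul_of_nonneg_left ?_ hC.le) (by positivity)
            exact Real.rpow_le_rpow_of_nonpos (by positivity) h4 (by linarith)
        _ = _ := by
            rw [Real.mul_rpow (by positivity) (by positivity),
              Real.div_rpow hNp.le (by norm_num), Real.rpow_neg (by norm_num : (0 : ℝ) ≤ 4),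
              div_inv_eq_mul, Real.rpow_neg hNp.le]
            have : (N : ℝ) ^ α ≠ 0 := by positivity
            field_simp

/-- The rescaled alias tail converges to the alias tail of the profile. -/
lemma PowerLaw.tendsto_aliasTail (h : PowerLaw S α G) (hd : 0 < d) (hα : (d : ℝ) < α)
    (hk : Tendsto (fun N : ℕ => (N : ℝ)⁻¹ • fun i => (k N i : ℝ)) atTop (𝓝 u))
    (hu : ∀ m : Fin d → ℤ, m ≠ 0 → (u + fun i => (m i : ℝ)) ≠ 0) {p : ℕ} (hp : p ≠ 0) :
    ∃ τ : ℝ, 0 < τ ∧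
      (τ = ∑' m : Fin d → ℤ, if m = 0 then 0 else G (u + fun i => (m i : ℝ)) ^ p) ∧
      Tendsto (fun N : ℕ => ((N : ℝ) ^ α) ^ p * aliasTail S N (k N) p) atTop (𝓝 τ) := by
  obtain ⟨b, hb, hb0, hbN⟩ := h.exists_majorant hα hk hu
  have hlim : ∀ m : Fin d → ℤ, m ≠ 0 → Tendsto (fun N : ℕ => (N : ℝ) ^ α * S (k N + (N : ℤ) • m))
      atTop (𝓝 (G (u + fun i => (m i : ℝ)))) := fun m hm =>
    h.tendsto _ _ (hu m hm) (tendsto_scaled_add_smul hk m)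
  have hGb : ∀ m : Fin d → ℤ, m ≠ 0 → G (u + fun i => (m i : ℝ)) ≤ b m := fun m hm =>
    le_of_tendsto (hlim m hm) (hbN.mono fun N hN => hN m hm)
  have hsum : Summable fun m : Fin d → ℤ =>
      if m = 0 then 0 else G (u + fun i => (m i : ℝ)) ^ p := by
    refine Summable.of_nonneg_of_le (fun m => ?_) (fun m => ?_) (hb.pow_of_nonneg hb0 hp)
    · split_ifs with hm
      · exact le_rfl
      · exact pow_nonneg (h.profile_pos _ (hu m hm)).le _
    · split_ifs with hm
      · exact pow_nonneg (hb0 m) _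
      · exact pow_le_pow_left₀ (h.profile_pos _ (hu m hm)).le (hGb m hm) p
  have : Nonempty (Fin d) := ⟨⟨0, hd⟩⟩
  refine ⟨_, hsum.tsum_pos (fun m => ?_) 1 ?_, rfl, ?_⟩
  · split_ifs with hm
    · exact le_rfl
    · exact pow_nonneg (h.profile_pos _ (hu m hm)).le _
  · rw [if_neg one_ne_zero]
    exact pow_pos (h.profile_pos _ (hu 1 one_ne_zero)) _
  · simp_rw [aliasTail, ← tsum_mul_left]
    refine tendsto_tsum_of_dominated_convergence (hb.pow_of_nonneg hb0 hp) (fun m => ?_) ?_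
    · by_cases hm : m = 0
      · simp [hm]
      · simp only [hm, if_false, ← mul_pow]
        exact (hlim m hm).pow p
    · filter_upwards [hbN] with N hN m
      split_ifs with hm
      · simpa using pow_nonneg (hb0 m) p
      · rw [← mul_pow]
        have h0 : 0 ≤ (N : ℝ) ^ α * S (k N + (N : ℤ) • m) :=
          mul_nonneg (by positivity) (h.pos _).le
        rw [Real.norm_of_nonneg (pow_nonneg h0 p)]
        exact pow_le_pow_left₀ h0 (hN m hm) p

/-- Numerator and denominator of `modeError_eq` both scale like `N^(-2 α)`, so the powers cancel in
the limit. -/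
lemma PowerLaw.exists_tendsto_modeError (h : PowerLaw S α G) (hd : 0 < d) (hS : Summable S)
    (hu : ∀ m : Fin d → ℤ, (u + fun i => (m i : ℝ)) ≠ 0) :
    ∃ ψ : ℝ, 0 < ψ ∧ ∀ k : ℕ → Fin d → ℤ,
      Tendsto (fun N : ℕ => (N : ℝ)⁻¹ • fun i => (k N i : ℝ)) atTop (𝓝 u) →
      Tendsto (fun N : ℕ => modeError S N (k N)) atTop (𝓝 ψ) := by
  have hα := h.lt_exponent hd hS
  have hu0 : u ≠ 0 := fun h0 => hu 0 (by ext i; simp [h0])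
  have hGu := h.profile_pos u hu0
  -- Any sequence with limit `u` may produce the constants, since the explicit formula for the
  -- limiting tails depends on `u` alone.
  have hfloor := tendsto_gridFloor u
  obtain ⟨τ₁, h1, e1, -⟩ := h.tendsto_aliasTail hd hα hfloor (fun m _ => hu m) one_ne_zero
  obtain ⟨τ₂, h2, e2, -⟩ := h.tendsto_aliasTail hd hα hfloor (fun m _ => hu m) two_ne_zero
  refine ⟨(τ₁ ^ 2 + τ₂) / (G u + τ₁) ^ 2, by positivity, fun k hk => ?_⟩
  obtain ⟨t₁, -, e1', l1⟩ := h.tendsto_aliasTail hd hα hk (fun m _ => hu m) one_ne_zero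
  obtain ⟨t₂, -, e2', l2⟩ := h.tendsto_aliasTail hd hα hk (fun m _ => hu m) two_ne_zero
  rw [← e1] at e1'
  rw [← e2] at e2'
  subst e1' e2'
  have l0 := h.tendsto k u hu0 hk
  refine (((l1.pow 2).add l2).div ((l0.add l1).pow 2) (by positivity)).congr' ?_
  filter_upwards [eventually_ne_atTop 0] with N hN
  have hNα : (N : ℝ) ^ α ≠ 0 := by positivity
  rw [Pi.div_apply, modeError_eq hS h.pos hN, pow_one, ← mul_add, mul_pow, mul_pow, ← mul_add,
    mul_div_mul_left _ _ (pow_ne_zero 2 hNα)]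

end limits

/-! ### Fast and slow decay of the Teacher -/

section mainRegimes
variable {d : ℕ} {S T : (Fin d → ℤ) → ℝ} {α αT : ℝ} {G GT : (Fin d → ℝ) → ℝ}

/-- If the spectrum of the Teacher decays fast, the error is dominated by the aliasing of the
fixed modes. -/
theorem PowerLaw.exists_tendsto_tsum (h : PowerLaw S α G) (hd : 0 < d) (hS : Summable S)
    (hT : ∀ k, 0 < T k) (hTα : Summable fun k => T k * (1 + ‖k‖) ^ (2 * α)) :
    ∃ C : ℝ, 0 < C ∧ Tendsto (fun N : ℕ => (N : ℝ) ^ (2 * α) * ∑' k, T k * modeError S N k)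
      atTop (𝓝 C) := by
  have hα := h.lt_exponent hd hS
  have hα0 : 0 < α := (Nat.cast_nonneg d).trans_lt hα
  obtain ⟨B, hB, hb⟩ := h.hasModeBound hα hS
  -- A fixed mode rescales to `u = 0`, where the profile is not controlled; the alias tail omits `m
  -- = 0`, so only nonzero integer points enter.
  have hz : ∀ m : Fin d → ℤ, m ≠ 0 → ((0 : Fin d → ℝ) + fun i => (m i : ℝ)) ≠ 0 := by
    intro m hm h0
    apply hm
    ext i
    simpa using congrFun h0 i
  have hk0 : ∀ k : Fin d → ℤ,
      Tendsto (fun N : ℕ => (N : ℝ)⁻¹ • fun i => (k i : ℝ)) atTop (𝓝 0) := by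
    intro k
    simpa using (tendsto_inv_atTop_nhds_zero_nat (𝕜 := ℝ)).smul_const (fun i => (k i : ℝ))
  obtain ⟨τ₁, h1, e1, -⟩ := h.tendsto_aliasTail hd hα (hk0 0) hz one_ne_zero
  obtain ⟨τ₂, h2, e2, -⟩ := h.tendsto_aliasTail hd hα (hk0 0) hz two_ne_zero
  have hNα : Tendsto (fun N : ℕ => (N : ℝ) ^ α) atTop atTop :=
    (tendsto_rpow_atTop hα0).comp tendsto_natCast_atTop_atTop
  have hmode : ∀ k, Tendsto (fun N : ℕ => (N : ℝ) ^ (2 * α) * (T k * modeError S N k)) atTop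
      (𝓝 (T k * ((τ₁ ^ 2 + τ₂) / S k ^ 2))) := by
    intro k
    obtain ⟨t₁, -, e1', l1⟩ := h.tendsto_aliasTail hd hα (hk0 k) hz one_ne_zero
    obtain ⟨t₂, -, e2', l2⟩ := h.tendsto_aliasTail hd hα (hk0 k) hz two_ne_zero
    rw [← e1] at e1'
    rw [← e2] at e2'
    subst e1' e2'
    -- The mode is fixed while its aliases escape to infinity: the tail vanishes and the denominator
    -- tends to `S k ^ 2`.
    have l3 : Tendsto (fun N : ℕ => aliasTail S N k 1) atTop (𝓝 0) := by
      have := (hNα.inv_tendsto_atTop).mul l1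
      rw [zero_mul] at this
      refine this.congr' ?_
      filter_upwards [eventually_ne_atTop 0] with N hN
      have : (N : ℝ) ^ α ≠ 0 := by positivity
      simp only [Pi.inv_apply, pow_one]
      field_simp
    have l4 : Tendsto (fun N : ℕ => S k + aliasTail S N k 1) atTop (𝓝 (S k)) := by
      simpa using l3.const_add (S k)
    have hSk := h.pos k
    refine ((((l1.pow 2).add l2).div (l4.pow 2) (by positivity)).const_mul (T k)).congr' ?_
    filter_upwards [eventually_ne_atTop 0] with N hN
    have hN0 : (0 : ℝ) ≤ N := Nat.cast_nonneg N
    have e : (N : ℝ) ^ (2 * α) = ((N : ℝ) ^ α) ^ 2 := by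
      rw [← Real.rpow_natCast ((N : ℝ) ^ α), ← Real.rpow_mul hN0, mul_comm]; norm_num
    rw [Pi.div_apply, modeError_eq hS h.pos hN, e, pow_one, mul_pow, ← mul_add]
    ring
  have hbound : ∀ᶠ N : ℕ in atTop, ∀ k, ‖(N : ℝ) ^ (2 * α) * (T k * modeError S N k)‖ ≤
      B * (T k * (1 + ‖k‖) ^ (2 * α)) := by
    filter_upwards [eventually_ne_atTop 0] with N hN k
    have hN0 : (0 : ℝ) < N := by positivity
    have hTk := hT k
    rw [Real.norm_of_nonneg (mul_nonneg (by positivity)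
      (mul_nonneg hTk.le (modeError_nonneg k)))]
    calc (N : ℝ) ^ (2 * α) * (T k * modeError S N k)
        ≤ (N : ℝ) ^ (2 * α) * (T k * (B * ((1 + ‖k‖) / N) ^ (2 * α))) := by
          gcongr; exact hb N hN k
      _ = _ := by
          rw [Real.div_rpow (by positivity) hN0.le]
          have : (N : ℝ) ^ (2 * α) ≠ 0 := by positivity
          field_simp
  have hconv := tendsto_tsum_of_dominated_convergence (hTα.mul_left B) hmode hbound
  simp_rw [tsum_mul_left] at hconv
  refine ⟨_, ?_, hconv⟩
  have hle : ∀ k, T k * ((τ₁ ^ 2 + τ₂) / S k ^ 2) ≤ B * (T k * (1 + ‖k‖) ^ (2 * α)) := fun k =>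
    le_of_tendsto (hmode k).norm (hbound.mono fun N hN => hN k) |>.trans' (le_abs_self _)
  have hpos : ∀ k, 0 < T k * ((τ₁ ^ 2 + τ₂) / S k ^ 2) := fun k => by
    have := hT k; have := h.pos k; positivity
  exact (Summable.of_nonneg_of_le (fun k => (hpos k).le) hle (hTα.mul_left B)).tsum_pos
    (fun k => (hpos k).le) 0 (hpos 0)

/-- In polar coordinates the exponent `a` gives integrability at the origin and `b` at infinity. -/
lemma integrable_min_rpow_norm (hd : 0 < d) {a b : ℝ} (ha : -(d : ℝ) < a) (hb : b < -(d : ℝ)) :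
    Integrable fun u : Fin d → ℝ => min (‖u‖ ^ a) (‖u‖ ^ b) := by
  have : Nonempty (Fin d) := ⟨⟨0, hd⟩⟩
  rw [integrable_fun_norm_addHaar volume (f := fun y => min (y ^ a) (y ^ b)),
    Module.finrank_fin_fun, ← Set.Ioc_union_Ioi_eq_Ioi zero_le_one]
  have hd1 : ((d - 1 : ℕ) : ℝ) = d - 1 := by rw [Nat.cast_sub hd, Nat.cast_one]
  have hmeas : Measurable fun y : ℝ => y ^ (d - 1) • min (y ^ a) (y ^ b) := by fun_prop
  have hnorm : ∀ y : ℝ, 0 < y →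
      ‖y ^ (d - 1) • min (y ^ a) (y ^ b)‖ = y ^ (d - 1) * min (y ^ a) (y ^ b) := by
    intro y hy
    rw [smul_eq_mul, Real.norm_of_nonneg (by positivity)]
  have hpow : ∀ y e : ℝ, 0 < y → y ^ (d - 1) * y ^ e = y ^ ((d : ℝ) - 1 + e) := by
    intro y e hy
    rw [← Real.rpow_natCast, ← Real.rpow_add hy, hd1]
  refine IntegrableOn.union ?_ ?_
  · have h1 : IntegrableOn (fun y : ℝ => y ^ ((d : ℝ) - 1 + a)) (Set.Ioc 0 1) := by
      rw [← intervalIntegrable_iff_integrableOn_Ioc_of_le zero_le_one]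
      exact intervalIntegral.intervalIntegrable_rpow' (by linarith)
    refine h1.mono' hmeas.aestronglyMeasurable
      (ae_restrict_of_forall_mem measurableSet_Ioc fun y hy => ?_)
    rw [hnorm y hy.1, ← hpow y a hy.1]
    have := hy.1
    gcongr
    exact min_le_left _ _
  · have h1 : IntegrableOn (fun y : ℝ => y ^ ((d : ℝ) - 1 + b)) (Set.Ioi 1) :=
      integrableOn_Ioi_rpow_of_lt (by linarith) zero_lt_one
    refine h1.mono' hmeas.aestronglyMeasurable
      (ae_restrict_of_forall_mem measurableSet_Ioi fun y hy => ?_)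
    have hy0 : 0 < y := zero_lt_one.trans hy
    rw [hnorm y hy0, ← hpow y b hy0]
    gcongr
    exact min_le_right _ _

/-- If the spectrum of the Teacher decays slowly, the error is dominated by the modes of
frequency of order `N`. -/
theorem PowerLaw.exists_tendsto_tsum_of_modeBound (hT : PowerLaw T αT GT) (hd : 0 < d)
    (hTs : Summable T) (hS : Summable S) (hpos : ∀ k, 0 < S k) {γ : ℝ} (hγ : αT - d < γ)
    (hγT : γ ≤ αT) (hb : HasModeBound S γ) (ψ : (Fin d → ℝ) → ℝ)
    (hψ : ∀ᵐ u : Fin d → ℝ, Tendsto (fun N : ℕ => modeError S N (gridFloor N u)) atTop (𝓝 (ψ u)))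
    (hψ0 : ∀ᵐ u : Fin d → ℝ, (∀ i, u i ∈ Set.Ioo (1 / 2) (1 : ℝ)) → 0 < ψ u) :
    ∃ C : ℝ, 0 < C ∧ Tendsto (fun N : ℕ => (N : ℝ) ^ (αT - d) * ∑' k, T k * modeError S N k)
      atTop (𝓝 C) := by
  have : Nonempty (Fin d) := ⟨⟨0, hd⟩⟩
  have hdα := hT.lt_exponent hd hTs
  have hγ0 : 0 ≤ γ := by linarith
  have hα0 : 0 < αT := (Nat.cast_nonneg d).trans_lt hdα
  obtain ⟨B, hB, hb⟩ := hb
  obtain ⟨A, hA, hup⟩ := hT.upper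
  -- The integral of `F N` is exactly `N^(αT - d)` times the spectral sum.
  set F : ℕ → (Fin d → ℝ) → ℝ := fun N u =>
    (N : ℝ) ^ αT * (T (gridFloor N u) * modeError S N (gridFloor N u)) with hF
  have hne : ∀ᵐ u : Fin d → ℝ, u ≠ 0 := by
    rw [ae_iff]; simp
  have hFm : ∀ N, Measurable (F N) := fun N =>
    (measurable_comp_gridFloor (fun k => T k * modeError S N k) N).const_mul _
  have hF0 : ∀ N u, 0 ≤ F N u := fun N u =>
    mul_nonneg (by positivity) (mul_nonneg (hT.pos _).le (modeError_nonneg _))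
  have hbound : ∀ N : ℕ, N ≠ 0 → ∀ u : Fin d → ℝ, u ≠ 0 →
      F N u ≤ A * (B + 2) * min (‖u‖ ^ (γ - αT)) (‖u‖ ^ (-αT)) := by
    intro N hN u hu
    have hN0 : (0 : ℝ) < N := by positivity
    have hup0 : 0 < ‖u‖ := norm_pos_iff.2 hu
    set x : ℝ := (1 + ‖gridFloor N u‖) / N with hx
    have hx0 : 0 < x := by positivity
    -- Since `γ ≤ αT`, both exponents of `x` below are nonpositive, so this inequality replaces `x`
    -- by `‖u‖`. The majorant is integrable at `0` because `γ > αT - d` and at infinity because `αT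
    -- > d`.
    have hux : ‖u‖ ≤ x := by
      rw [hx, le_div_iff₀ hN0]
      have := norm_le_one_add_norm_gridFloor N u
      rwa [norm_smul, RCLike.norm_natCast, mul_comm] at this
    have hm : modeError S N (gridFloor N u) ≤ (B + 2) * min (x ^ γ) 1 := by
      rw [mul_min_of_nonneg _ _ (by positivity)]
      refine le_min ((hb N hN _).trans ?_) ((modeError_le_two hS hpos hN _).trans (by linarith))
      rw [← hx]; gcongr; linarith
    have hTx : (N : ℝ) ^ αT * T (gridFloor N u) ≤ A * x ^ (-αT) := by
      calc (N : ℝ) ^ αT * T (gridFloor N u)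
          ≤ (N : ℝ) ^ αT * (A * (1 + ‖gridFloor N u‖) ^ (-αT)) := by gcongr; exact hup _
        _ = _ := by
          rw [hx, Real.div_rpow (by positivity) hN0.le, Real.rpow_neg hN0.le, div_inv_eq_mul]
          ring
    calc F N u = ((N : ℝ) ^ αT * T (gridFloor N u)) * modeError S N (gridFloor N u) := by
          simp only [hF]; ring
      _ ≤ (A * x ^ (-αT)) * ((B + 2) * min (x ^ γ) 1) := by
          have := modeError_nonneg (S := S) (N := N) (gridFloor N u)
          gcongr
      _ = A * (B + 2) * min (x ^ (γ - αT)) (x ^ (-αT)) := by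
          have : min (x ^ (γ - αT)) (x ^ (-αT)) = x ^ (-αT) * min (x ^ γ) 1 := by
            rw [mul_min_of_nonneg _ _ (by positivity), mul_one, ← Real.rpow_add hx0]
            congr 2; ring
          rw [this]; ring
      _ ≤ _ := by
          have h1 : x ^ (γ - αT) ≤ ‖u‖ ^ (γ - αT) :=
            Real.rpow_le_rpow_of_nonpos hup0 hux (by linarith)
          have h2 : x ^ (-αT) ≤ ‖u‖ ^ (-αT) :=
            Real.rpow_le_rpow_of_nonpos hup0 hux (by linarith)
          gcongr
  have hbi : Integrable fun u : Fin d → ℝ =>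
      A * (B + 2) * min (‖u‖ ^ (γ - αT)) (‖u‖ ^ (-αT)) :=
    (integrable_min_rpow_norm hd (by linarith) (by linarith)).const_mul _
  have hFb : ∀ N : ℕ, N ≠ 0 → ∀ᵐ u : Fin d → ℝ,
      ‖F N u‖ ≤ A * (B + 2) * min (‖u‖ ^ (γ - αT)) (‖u‖ ^ (-αT)) := by
    intro N hN
    filter_upwards [hne] with u hu
    rw [Real.norm_of_nonneg (hF0 N u)]
    exact hbound N hN u hu
  have hlim : ∀ᵐ u : Fin d → ℝ, Tendsto (fun N => F N u) atTop (𝓝 (GT u * ψ u)) := by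
    filter_upwards [hne, hψ] with u hu hu2
    simpa only [hF, mul_assoc] using (hT.tendsto _ u hu (tendsto_gridFloor u)).mul hu2
  have hconv : Tendsto (fun N => ∫ u, F N u) atTop (𝓝 (∫ u, GT u * ψ u)) :=
    tendsto_integral_filter_of_dominated_convergence _
      (Eventually.of_forall fun N => (hFm N).aestronglyMeasurable)
      ((eventually_ne_atTop 0).mono hFb) hbi hlim
  refine ⟨_, ?_, hconv.congr' ?_⟩
  · have hnn : ∀ᵐ u : Fin d → ℝ, 0 ≤ GT u * ψ u := by
      filter_upwards [hlim] with u hu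
      exact ge_of_tendsto' hu fun N => hF0 N u
    have hle : ∀ᵐ u : Fin d → ℝ,
        ‖GT u * ψ u‖ ≤ A * (B + 2) * min (‖u‖ ^ (γ - αT)) (‖u‖ ^ (-αT)) := by
      filter_upwards [hlim, hne] with u hu hu0
      refine le_of_tendsto hu.norm ((eventually_ne_atTop 0).mono fun N hN => ?_)
      rw [Real.norm_of_nonneg (hF0 N u)]
      exact hbound N hN u hu0
    have hmeas : AEStronglyMeasurable (fun u : Fin d → ℝ => GT u * ψ u) volume :=
      aestronglyMeasurable_of_tendsto_ae atTop (fun N => (hFm N).aestronglyMeasurable) hlim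
    rw [integral_pos_iff_support_of_nonneg_ae hnn (hbi.mono' hmeas hle)]
    -- The limit integrand is nonnegative, and it is positive almost everywhere on the cube `(1/2,
    -- 1)^d`, which has positive volume.
    have hcell : 0 < volume (Set.univ.pi fun _ : Fin d => Set.Ioo (1 / 2) (1 : ℝ)) := by
      rw [volume_pi_pi]
      simp only [Real.volume_Ioo, Finset.prod_const]
      exact ENNReal.pow_pos (ENNReal.ofReal_pos.2 (by norm_num)) _
    refine hcell.trans_le (measure_mono_ae ?_)
    filter_upwards [hψ0, hne] with u hu hu0 hmem
    exact (mul_pos (hT.profile_pos u hu0) (hu fun i => hmem i (Set.mem_univ i))).ne'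
  · filter_upwards [eventually_ne_atTop 0] with N hN
    have hN0 : (0 : ℝ) < N := by positivity
    have hFi : Integrable (F N) := hbi.mono' (hFm N).aestronglyMeasurable (hFb N hN)
    have hgi : Integrable fun u => T (gridFloor N u) * modeError S N (gridFloor N u) := by
      have := hFi.const_mul ((N : ℝ) ^ αT)⁻¹
      refine this.congr (ae_of_all _ fun u => ?_)
      have : (N : ℝ) ^ αT ≠ 0 := by positivity
      simp only [hF]
      field_simp
    rw [(hasSum_gridFloor hN0 (g := fun k => T k * modeError S N k) hgi).tsum_eq, ← mul_assoc,
      ← Real.rpow_natCast, ← Real.rpow_add hN0, sub_add_cancel, ← integral_const_mul]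

end mainRegimes

/-! ### The critical case -/

section critical
variable {d : ℕ} {S T : (Fin d → ℤ) → ℝ} {α αT : ℝ} {G GT : (Fin d → ℝ) → ℝ}

lemma summable_mul_modeError {N : ℕ} (hTs : Summable T) (hT : ∀ k, 0 < T k) (hS : Summable S)
    (hpos : ∀ k, 0 < S k) (hN : N ≠ 0) : Summable fun k => T k * modeError S N k :=
  Summable.of_nonneg_of_le (fun k => mul_nonneg (hT k).le (modeError_nonneg k))
    (fun k => mul_le_mul_of_nonneg_left (modeError_le_two hS hpos hN k) (hT k).le)
    (hTs.mul_right 2)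

/-- In the critical regime all scales contribute equally, up to a logarithm. -/
theorem PowerLaw.exists_log_bounds (hT : PowerLaw T αT GT) (h : PowerLaw S α G) (hd : 0 < d)
    (hTs : Summable T) (hS : Summable S) (hcrit : αT - d = 2 * α) :
    ∃ c C : ℝ, 0 < c ∧ 0 < C ∧ ∀ᶠ N : ℕ in atTop,
      c * Real.log N ≤ (N : ℝ) ^ (2 * α) * ∑' k, T k * modeError S N k ∧
      (N : ℝ) ^ (2 * α) * ∑' k, T k * modeError S N k ≤ C * Real.log N := by
  have hα := h.lt_exponent hd hS
  have hα0 : 0 < α := (Nat.cast_nonneg d).trans_lt hα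
  have hαT : αT = d + 2 * α := by linarith
  obtain ⟨B, hB, hb⟩ := h.hasModeBound hα hS
  obtain ⟨A, hA, hup⟩ := hT.upper
  obtain ⟨a, ha, hlow⟩ := hT.lower
  obtain ⟨b, hb0, hmode⟩ := h.exists_le_modeError hd hS
  obtain ⟨D, hD, hDle⟩ := exists_tsum_le_log hd (a := 2 * α) (by positivity)
  obtain ⟨e, he, hele⟩ := exists_log_le_tsum hd
  have hlogN : Tendsto (fun N : ℕ => Real.log N) atTop atTop :=
    Real.tendsto_log_atTop.comp tendsto_natCast_atTop_atTop
  -- The `e / 2` comes from `log (N/2 - 1) ≥ log (N/4) ≥ (log N) / 2`, and the final `2` from `1 +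
  -- log N ≤ 2 log N`.
  refine ⟨a * b * (e / 2), A * (B + 2) * D * 2, by positivity, by positivity, ?_⟩
  filter_upwards [hlogN.eventually_ge_atTop (2 * Real.log 4), hlogN.eventually_ge_atTop 1,
    eventually_ge_atTop 4] with N hN1 hN2 hN3
  have hN : N ≠ 0 := by omega
  have hN0 : (0 : ℝ) < N := by positivity
  have hN4 : (4 : ℝ) ≤ N := by exact_mod_cast hN3
  have hNα : (N : ℝ) ^ (2 * α) * (N : ℝ) ^ (-(2 * α)) = 1 := by
    rw [← Real.rpow_add hN0, add_neg_cancel, Real.rpow_zero]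
  have hsum := summable_mul_modeError hTs hT.pos hS h.pos hN
  constructor
  -- At criticality the two lower bounds multiply to `N^(-2 α) (1 + ‖k‖)^(-d)`. The cutoff `(N/2 -
  -- 1) + 1` has the form of the truncation in `exists_log_le_tsum`.
  · have hle : ∀ k : Fin d → ℤ, a * b * (N : ℝ) ^ (-(2 * α)) *
        (if ‖k‖ ≤ ((N : ℝ) / 2 - 1) + 1 then (1 + ‖k‖) ^ (-(d : ℝ)) else 0) ≤
        T k * modeError S N k := by
      intro k
      have hk0 : 0 < 1 + ‖k‖ := by positivity
      split_ifs with hk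
      · calc a * b * (N : ℝ) ^ (-(2 * α)) * (1 + ‖k‖) ^ (-(d : ℝ))
            = (a * (1 + ‖k‖) ^ (-αT)) * (b * ((1 + ‖k‖) / N) ^ (2 * α)) := by
              rw [Real.div_rpow hk0.le hN0.le, Real.rpow_neg hN0.le, hαT, neg_add,
                Real.rpow_add hk0, Real.rpow_neg hk0.le (2 * α)]
              field_simp
          _ ≤ _ := mul_le_mul (hlow k) (hmode N hN k (by linarith)) (by positivity)
              (hT.pos k).le
      · rw [mul_zero]
        exact mul_nonneg (hT.pos k).le (modeError_nonneg k)
    have hfs : Summable fun k : Fin d → ℤ =>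
        if ‖k‖ ≤ ((N : ℝ) / 2 - 1) + 1 then (1 + ‖k‖) ^ (-(d : ℝ)) else 0 :=
      summable_of_hasFiniteSupport ((finite_norm_le _).subset fun k hk => by
        by_contra h
        exact hk (if_neg h))
    have h1 := Summable.tsum_le_tsum hle (hfs.mul_left _) hsum
    rw [tsum_mul_left] at h1
    have h2 := hele ((N : ℝ) / 2 - 1) (by linarith)
    have h3 : Real.log N / 2 ≤ Real.log ((N : ℝ) / 2 - 1) := by
      calc Real.log N / 2 ≤ Real.log N - Real.log 4 := by linarith
        _ = Real.log (N / 4) := (Real.log_div hN0.ne' (by norm_num)).symm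
        _ ≤ _ := Real.log_le_log (by positivity) (by linarith)
    calc a * b * (e / 2) * Real.log N = a * b * (e * (Real.log N / 2)) := by ring
      _ ≤ a * b * ∑' k : Fin d → ℤ,
            (if ‖k‖ ≤ ((N : ℝ) / 2 - 1) + 1 then (1 + ‖k‖) ^ (-(d : ℝ)) else 0) := by
          gcongr
          exact (mul_le_mul_of_nonneg_left h3 he.le).trans h2
      _ = (N : ℝ) ^ (2 * α) * (a * b * (N : ℝ) ^ (-(2 * α)) * ∑' k : Fin d → ℤ,
            (if ‖k‖ ≤ ((N : ℝ) / 2 - 1) + 1 then (1 + ‖k‖) ^ (-(d : ℝ)) else 0)) := by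
          rw [mul_comm (a * b) ((N : ℝ) ^ (-(2 * α))), mul_assoc ((N : ℝ) ^ (-(2 * α))),
            ← mul_assoc, hNα, one_mul]
      _ ≤ _ := by gcongr
  · obtain ⟨hs, hle⟩ := hDle N (by linarith)
    have h1 : ∀ k, T k * modeError S N k ≤ A * (B + 2) *
        ((1 + ‖k‖) ^ (-(d + 2 * α)) * min 1 (((1 + ‖k‖) / N) ^ (2 * α))) := by
      intro k
      have hm : modeError S N k ≤ (B + 2) * min 1 (((1 + ‖k‖) / N) ^ (2 * α)) := by
        rw [mul_min_of_nonneg _ _ (by positivity)]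
        refine le_min ((modeError_le_two hS h.pos hN _).trans (by linarith))
          ((hb N hN _).trans ?_)
        gcongr; linarith
      calc T k * modeError S N k ≤ (A * (1 + ‖k‖) ^ (-αT)) *
            ((B + 2) * min 1 (((1 + ‖k‖) / N) ^ (2 * α))) :=
            mul_le_mul (hup k) hm (modeError_nonneg k) (by positivity)
        _ = _ := by rw [hαT]; ring
    have h2 := Summable.tsum_le_tsum h1 hsum (hs.mul_left _)
    rw [tsum_mul_left] at h2
    calc (N : ℝ) ^ (2 * α) * ∑' k, T k * modeError S N k
        ≤ (N : ℝ) ^ (2 * α) * (A * (B + 2) * (D * (N : ℝ) ^ (-(2 * α)) * (1 + Real.log N))) := by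
          gcongr
          exact h2.trans (by gcongr)
      _ = A * (B + 2) * D * (1 + Real.log N) *
            ((N : ℝ) ^ (2 * α) * (N : ℝ) ^ (-(2 * α))) := by ring
      _ ≤ A * (B + 2) * D * (2 * Real.log N) * 1 := by
          rw [hNα]
          gcongr
          linarith
      _ = _ := by ring

end critical

/-! ### Gaussian Teacher or Student -/

section gaussianRegimes
variable {d : ℕ} {S T : (Fin d → ℤ) → ℝ} {c a c' a' : ℝ}

lemma summable_gaussian_mul_rpow (hc : 0 < c) (ha : 0 < a)
    (hG : ∀ k, T k = c * Real.exp (-(a * ∑ i, (k i : ℝ) ^ 2))) (s : ℝ) :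
    Summable fun k : Fin d → ℤ => T k * (1 + ‖k‖) ^ s := by
  obtain ⟨C, hC, h⟩ := exists_exp_neg_sum_sq_le (d := d) ha (d + 1 + s)
  refine Summable.of_nonneg_of_le (fun k => ?_) (fun k => ?_)
    ((summable_one_add_norm_rpow (d := d) (s := d + 1) (by linarith)).mul_left (c * C))
  · rw [hG]; positivity
  · have hk0 : 0 < 1 + ‖k‖ := by positivity
    calc T k * (1 + ‖k‖) ^ s ≤ c * (C * (1 + ‖k‖) ^ (-(d + 1 + s))) * (1 + ‖k‖) ^ s := by
          rw [hG]; gcongr; exact h k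
      _ = c * C * (1 + ‖k‖) ^ (-((d : ℝ) + 1)) := by
          rw [mul_assoc, mul_assoc C, ← Real.rpow_add hk0, mul_assoc]
          congr 3; ring

/-- A Gaussian Teacher and a Gaussian Student: the error decays faster than every power. -/
theorem tendsto_tsum_of_gaussian (hc : 0 < c) (ha : 0 < a)
    (hT : ∀ k, T k = c * Real.exp (-(a * ∑ i, (k i : ℝ) ^ 2))) (hTs : Summable T)
    (hc' : 0 < c') (ha' : 0 < a')
    (hS : ∀ k, S k = c' * Real.exp (-(a' * ∑ i, (k i : ℝ) ^ 2))) (hSs : Summable S) (x : ℝ) :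
    Tendsto (fun N : ℕ => (N : ℝ) ^ x * ∑' k, T k * modeError S N k) atTop (𝓝 0) := by
  have hTp : ∀ k, 0 < T k := fun k => by rw [hT]; positivity
  have hSp : ∀ k, 0 < S k := fun k => by rw [hS]; positivity
  -- A mode bound of nonnegative order larger than `x` leaves a negative power of `N`.
  set y : ℝ := max x 0 + 1 with hy
  have hy0 : 0 ≤ y := by positivity
  obtain ⟨B, hB, hb⟩ := gaussian_hasModeBound hc' ha' hS hSs hy0
  set Q : ℝ := ∑' k, T k * (1 + ‖k‖) ^ y with hQ
  have hQs := summable_gaussian_mul_rpow hc ha hT y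
  have h0 : Tendsto (fun N : ℕ => B * Q * (N : ℝ) ^ (-(y - x))) atTop (𝓝 0) := by
    have : 0 < y - x := by linarith [le_max_left x 0]
    simpa using ((tendsto_rpow_neg_atTop this).comp tendsto_natCast_atTop_atTop).const_mul (B * Q)
  refine squeeze_zero' (Eventually.of_forall fun N => mul_nonneg (by positivity)
    (tsum_nonneg fun k => mul_nonneg (hTp k).le (modeError_nonneg k))) ?_ h0
  filter_upwards [eventually_ne_atTop 0] with N hN
  have hN0 : (0 : ℝ) < N := by positivity
  have h1 : ∑' k, T k * modeError S N k ≤ B * (N : ℝ) ^ (-y) * Q := by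
    rw [hQ, ← tsum_mul_left]
    refine Summable.tsum_le_tsum (fun k => ?_) (summable_mul_modeError hTs hTp hSs hSp hN)
      (hQs.mul_left _)
    calc T k * modeError S N k ≤ T k * (B * ((1 + ‖k‖) / N) ^ y) :=
          mul_le_mul_of_nonneg_left (hb N hN k) (hTp k).le
      _ = _ := by
          rw [Real.div_rpow (by positivity) hN0.le, Real.rpow_neg hN0.le]; ring
  calc (N : ℝ) ^ x * ∑' k, T k * modeError S N k
      ≤ (N : ℝ) ^ x * (B * (N : ℝ) ^ (-y) * Q) := by gcongr
    _ = B * Q * ((N : ℝ) ^ x * (N : ℝ) ^ (-y)) := by ring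
    _ = _ := by rw [← Real.rpow_add hN0]; congr 2; ring

lemma aliasSum_add_smul {N : ℕ} (k m : Fin d → ℤ) :
    aliasSum S N (k + (N : ℤ) • m) = aliasSum S N k := by
  rw [aliasSum, aliasSum, ← (Equiv.addLeft m).tsum_eq fun l => S (k + (N : ℤ) • l)]
  exact tsum_congr fun l => by rw [Equiv.coe_addLeft, smul_add, add_assoc]

/-- If the residue class of a frequency is dominated by another mode `q`, the error of its mode is
close to `2`. -/
lemma two_mul_sq_le_modeError {N : ℕ} (hS : Summable S) (hpos : ∀ k, 0 < S k) (hN : N ≠ 0)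
    (q : Fin d → ℤ) {r : Fin d → ℤ} (hr : r ≠ 0) :
    2 * (S q / (S q + aliasTail S N q 1)) ^ 2 ≤ modeError S N (q + (N : ℤ) • r) := by
  have hA := aliasSum_eq hS hN q
  have hAp := aliasSum_pos hS hpos hN q
  rw [← hA]
  have hsum : Summable fun m => residual S N (q + (N : ℤ) • r) m ^ 2 := by
    simpa only [sq_abs] using
      (summable_residual hS hN _).abs.pow_of_nonneg (fun _ => abs_nonneg _) two_ne_zero
  have hr' : (0 : Fin d → ℤ) ≠ -r := by simpa [eq_comm] using hr
  -- Only the lost mode (`m = 0`) and the spurious wave at `q` (`m = -r`) are kept; each residual is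
  -- at least `S q / aliasSum S N q` in absolute value.
  have h1 := hsum.sum_le_tsum {0, -r} fun m _ => sq_nonneg _
  rw [Finset.sum_pair hr'] at h1
  refine le_trans ?_ h1
  have e1 : residual S N (q + (N : ℤ) • r) 0 = 1 - S (q + (N : ℤ) • r) / aliasSum S N q := by
    rw [residual, if_pos rfl, smul_zero, add_zero, aliasSum_add_smul]
  have e2 : residual S N (q + (N : ℤ) • r) (-r) = -(S q / aliasSum S N q) := by
    rw [residual, if_neg hr'.symm, aliasSum_add_smul, add_assoc, ← smul_add, add_neg_cancel,
      smul_zero, add_zero, zero_sub]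
  have h2 : S q / aliasSum S N q ≤ residual S N (q + (N : ℤ) • r) 0 := by
    rw [e1, le_sub_iff_add_le, ← add_div, div_le_one hAp, hA]
    exact add_le_add_right (le_aliasTail_one hS hpos hN q hr) _
  have h3 : 0 ≤ S q / aliasSum S N q := div_nonneg (hpos q).le hAp.le
  rw [e2, neg_sq, two_mul]
  gcongr

/-- Cell boundaries are the points with a half-integer coordinate, and half-integers are countable.
The limiting mode error is needed only off this null set. -/
lemma ae_norm_sub_round_lt : ∀ᵐ u : Fin d → ℝ, ‖fun i => u i - round (u i)‖ < 1 / 2 := by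
  have h1 : ∀ᵐ x : ℝ, |x - round x| ≠ 1 / 2 := by
    have hc : (Set.range fun n : ℤ => (n : ℝ) + 1 / 2).Countable := Set.countable_range _
    filter_upwards [hc.ae_notMem volume] with x hx h
    rcases abs_choice (x - round x) with h' | h'
    · exact hx ⟨round x, by simp only; linarith⟩
    · exact hx ⟨round x - 1, by push_cast; linarith⟩
  have h2 : ∀ᵐ u : Fin d → ℝ, ∀ i, |u i - round (u i)| ≠ 1 / 2 :=
    ae_all_iff.2 fun i => (Measure.tendsto_eval_ae_ae
      (μ := fun _ : Fin d => (volume : Measure ℝ)) (i := i)).eventually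
        (p := fun x : ℝ => |x - round x| ≠ 1 / 2) h1
  filter_upwards [h2] with u hu
  refine (pi_norm_lt_iff (by norm_num)).2 fun i => ?_
  exact lt_of_le_of_ne (abs_sub_round _) (hu i)

/-- The error of a mode under a Gaussian Student tends to `0` inside the fundamental cell and to
`2` outside. -/
lemma gaussian_tendsto_modeError (hc : 0 < c) (ha : 0 < a)
    (hG : ∀ k, S k = c * Real.exp (-(a * ∑ i, (k i : ℝ) ^ 2))) (hS : Summable S)
    {u : Fin d → ℝ} (hu : ‖fun i => u i - round (u i)‖ < 1 / 2) :
    Tendsto (fun N : ℕ => modeError S N (gridFloor N u)) atTop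
      (𝓝 (if (fun i => round (u i)) = 0 then 0 else 2)) := by
  have hpos : ∀ k, 0 < S k := fun k => by rw [hG]; positivity
  set r : Fin d → ℤ := fun i => round (u i) with hr
  set t : Fin d → ℝ := fun i => u i - round (u i) with ht
  -- `q N` is the alias of the sampled frequency brought back to the fundamental cell; rescaled, it
  -- tends to `t` with `‖t‖ < 1/2`.
  set q : ℕ → Fin d → ℤ := fun N => gridFloor N u + (N : ℤ) • (-r) with hq
  have hqr : ∀ N : ℕ, gridFloor N u = q N + (N : ℤ) • r := fun N => by simp [hq]
  have hqt : Tendsto (fun N : ℕ => (N : ℝ)⁻¹ • fun i => (q N i : ℝ)) atTop (𝓝 t) := by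
    convert tendsto_scaled_add_smul (tendsto_gridFloor u) (-r) using 2
    ext i
    simp [ht, hr, sub_eq_add_neg]
  -- This makes `(1 - η) / 2` the midpoint of `‖t‖` and `1/2`, so the tail estimate applies to `q N`
  -- for large `N`.
  set η : ℝ := (1 - 2 * ‖t‖) / 2 with hη
  have hη0 : 0 < η := by simp only [hη]; linarith
  obtain ⟨C, hC, htail⟩ := exists_gaussian_aliasTail_le hc ha hG hS hη0
  have hev : ∀ᶠ N : ℕ in atTop, N ≠ 0 ∧
      aliasTail S N (q N) 1 / S (q N) ≤ C * Real.exp (-(a * η / 2 * N)) := by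
    filter_upwards [hqt.norm.eventually_le_const (show ‖t‖ < (1 - η) / 2 by
      simp only [hη]; linarith), eventually_ne_atTop 0] with N hN hN0
    have hNp : (0 : ℝ) < N := by positivity
    refine ⟨hN0, ?_⟩
    rw [norm_smul, norm_inv, RCLike.norm_natCast, norm_intCast_fun, inv_mul_le_iff₀ hNp] at hN
    rw [div_le_iff₀ (hpos _)]
    exact htail N hN0 _ (by linarith)
  have hexp : Tendsto (fun N : ℕ => C * Real.exp (-(a * η / 2 * N))) atTop (𝓝 0) := by
    have h1 : Tendsto (fun N : ℕ => a * η / 2 * (N : ℝ)) atTop atTop :=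
      tendsto_natCast_atTop_atTop.const_mul_atTop (by positivity)
    simpa using (Real.tendsto_exp_neg_atTop_nhds_zero.comp h1).const_mul C
  have hrat : Tendsto (fun N : ℕ => aliasTail S N (q N) 1 / S (q N)) atTop (𝓝 0) :=
    squeeze_zero' (Eventually.of_forall fun N =>
      div_nonneg (aliasTail_nonneg hpos _ _) (hpos _).le) (hev.mono fun N hN => hN.2) hexp
  split_ifs with hr0
  · have hq0 : ∀ N : ℕ, gridFloor N u = q N := fun N => by rw [hqr N, hr0, smul_zero, add_zero]
    refine squeeze_zero' (Eventually.of_forall fun N => modeError_nonneg _)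
      ((eventually_ne_atTop 0).mono fun N hN => modeError_le_tail_div hS hpos hN _) ?_
    simp_rw [hq0]
    simpa using (hrat.pow 2).const_mul 2
  · refine tendsto_of_tendsto_of_tendsto_of_le_of_le'
      (g := fun N : ℕ => 2 * (1 + aliasTail S N (q N) 1 / S (q N))⁻¹ ^ 2) (h := fun _ => 2)
      ?_ tendsto_const_nhds ?_
      ((eventually_ne_atTop 0).mono fun N hN => modeError_le_two hS hpos hN _)
    · simpa using (((hrat.const_add 1).inv₀ (by norm_num)).pow 2).const_mul 2
    · filter_upwards [eventually_ne_atTop 0] with N hN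
      rw [hqr N]
      refine le_trans (le_of_eq ?_) (two_mul_sq_le_modeError hS hpos hN (q N) hr0)
      rw [one_add_div (hpos _).ne', inv_div]

end gaussianRegimes

/-! ### From decay of the Fourier transform to the lattice hypotheses -/

section decay
variable {d : ℕ} {L : ℝ} {K : (Fin d → ℝ) → ℝ} {c α : ℝ}

lemma exists_forall_le_of_cofinite {ι : Type*} {f : ι → ℝ} {C : ℝ}
    (h : ∀ᶠ i in cofinite, f i ≤ C) : ∃ C' : ℝ, 0 < C' ∧ ∀ i, f i ≤ C' := by
  obtain ⟨M, hM⟩ := ((eventually_cofinite.1 h).image f).bddAbove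
  refine ⟨max 1 (max C M), by positivity, fun i => ?_⟩
  by_cases hi : f i ≤ C
  · exact hi.trans ((le_max_left _ _).trans (le_max_right _ _))
  · exact (hM ⟨i, hi, rfl⟩).trans ((le_max_right _ _).trans (le_max_right _ _))

lemma rpow_le_max {p q x : ℝ} (hp : 0 < p) (hpx : p ≤ x) (hxq : x ≤ q) (α : ℝ) :
    x ^ α ≤ max (p ^ α) (q ^ α) := by
  rcases le_total 0 α with h | h
  · exact (Real.rpow_le_rpow (hp.le.trans hpx) hxq h).trans (le_max_right _ _)
  · exact (Real.rpow_le_rpow_of_nonpos hp hpx h).trans (le_max_left _ _)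

/-- The Euclidean length of `(2π / L) v`. -/
noncomputable def scaledNorm (L : ℝ) (v : Fin d → ℝ) : ℝ :=
  Real.sqrt (∑ i, (2 * Real.pi / L * v i) ^ 2)

lemma freqNorm_eq (k : Fin d → ℤ) : freqNorm L k = scaledNorm L fun i => (k i : ℝ) := rfl

lemma continuous_scaledNorm : Continuous (scaledNorm L : (Fin d → ℝ) → ℝ) := by
  unfold scaledNorm; fun_prop

lemma le_scaledNorm (hL : 0 < L) (v : Fin d → ℝ) : 2 * Real.pi / L * ‖v‖ ≤ scaledNorm L v := by
  have ha : 0 < 2 * Real.pi / L := by positivity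
  rw [← le_div_iff₀' ha]
  refine (pi_norm_le_iff_of_nonneg (div_nonneg (Real.sqrt_nonneg _) ha.le)).2 fun i => ?_
  rw [le_div_iff₀' ha]
  refine Real.le_sqrt_of_sq_le ?_
  refine le_trans (le_of_eq ?_) (Finset.single_le_sum
    (f := fun i => (2 * Real.pi / L * v i) ^ 2) (fun i _ => sq_nonneg _) (Finset.mem_univ i))
  simp only [mul_pow, Real.norm_eq_abs, sq_abs]

lemma scaledNorm_le (hL : 0 < L) (v : Fin d → ℝ) :
    scaledNorm L v ≤ 2 * Real.pi / L * d * ‖v‖ := by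
  have ha : 0 < 2 * Real.pi / L := by positivity
  refine Real.sqrt_le_iff.2 ⟨by positivity, ?_⟩
  have h1 : ∀ i, (2 * Real.pi / L * v i) ^ 2 ≤ (2 * Real.pi / L * ‖v‖) ^ 2 := by
    intro i
    rw [mul_pow, mul_pow]
    gcongr 1
    rw [← sq_abs (v i)]
    have := norm_le_pi_norm v i
    rw [Real.norm_eq_abs] at this
    gcongr
  refine (Finset.sum_le_sum fun i _ => h1 i).trans ?_
  rw [Finset.sum_const, Finset.card_univ, Fintype.card_fin, nsmul_eq_mul]
  have h2 : (d : ℝ) ≤ (d : ℝ) ^ 2 := by exact_mod_cast Nat.le_self_pow two_ne_zero d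
  calc (d : ℝ) * (2 * Real.pi / L * ‖v‖) ^ 2 ≤ (d : ℝ) ^ 2 * (2 * Real.pi / L * ‖v‖) ^ 2 := by
        gcongr
    _ = _ := by ring

lemma scaledNorm_smul {r : ℝ} (hr : 0 ≤ r) (v : Fin d → ℝ) :
    scaledNorm L (r • v) = r * scaledNorm L v := by
  rw [scaledNorm, scaledNorm, ← Real.sqrt_sq hr, ← Real.sqrt_mul (sq_nonneg _), Finset.mul_sum,
    Real.sqrt_sq hr]
  congr 1
  refine Finset.sum_congr rfl fun i _ => ?_
  simp only [Pi.smul_apply, smul_eq_mul]; ring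

lemma HasPowerLawDecay.tendsto_spectrum (h : HasPowerLawDecay L K c α) :
    Tendsto (fun k : Fin d → ℤ => kernelSpectrum L K k * freqNorm L k ^ α)
      (comap (freqNorm L) atTop) (𝓝 (L ^ (-(d : ℝ) / 2) * c)) := by
  have h1 : (fun k : Fin d → ℤ => (fourierTransform L K k).re - c * freqNorm L k ^ (-α))
      =o[comap (freqNorm L) atTop] fun k : Fin d → ℤ => freqNorm L k ^ (-α) := by
    rw [HasPowerLawDecay] at h
    refine (isBigO_of_le _ fun k => ?_).trans_isLittleO h
    rw [← Complex.ofReal_re (c * freqNorm L k ^ (-α)), ← Complex.sub_re]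
    exact Complex.abs_re_le_norm _
  have h2 := (h1.tendsto_div_nhds_zero.add_const c).const_mul (L ^ (-(d : ℝ) / 2))
  rw [zero_add] at h2
  refine h2.congr' ?_
  filter_upwards [tendsto_comap.eventually_gt_atTop 0] with k hk
  rw [kernelSpectrum, Real.rpow_neg hk.le]
  have : freqNorm L k ^ α ≠ 0 := (Real.rpow_pos_of_pos hk _).ne'
  field_simp
  ring

/-- Off the origin `(1 + ‖k‖) / |w|` lies between positive constants, so the asymptotics give
two-sided bounds outside a finite set, and positivity of the spectrum absorbs the exceptions. The
profile is the homogeneous function `κ |w|^(-α)`. -/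
theorem HasPowerLawDecay.powerLaw (hd : 0 < d) (hL : 0 < L) (hK : IsPositiveDefiniteKernel L K)
    (hs : Summable (fourierTransform L K)) (hc : 0 < c) (h : HasPowerLawDecay L K c α) :
    ∃ G, PowerLaw (kernelSpectrum L K) α G := by
  set κ : ℝ := L ^ (-(d : ℝ) / 2) * c with hκ
  have hκ0 : 0 < κ := by positivity
  set a : ℝ := 2 * Real.pi / L with ha
  have ha0 : 0 < a := by positivity
  have hd0 : (0 : ℝ) < d := by exact_mod_cast hd
  have hpos : ∀ k, 0 < kernelSpectrum L K k := hK.spectrum_pos hL hs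
  have hlim := h.tendsto_spectrum
  have hcof : Tendsto (freqNorm L : (Fin d → ℤ) → ℝ) cofinite atTop := by
    refine tendsto_atTop_mono (fun k => ?_) (tendsto_norm_cofinite.const_mul_atTop ha0)
    rw [freqNorm_eq, ← norm_intCast_fun]
    exact le_scaledNorm hL _
  have hlimc := hlim.mono_left (tendsto_iff_comap.1 hcof)
  have hne : ∀ᶠ k : Fin d → ℤ in cofinite, k ≠ 0 := by
    exact (Set.finite_singleton (0 : Fin d → ℤ)).eventually_cofinite_notMem
  have hratio : ∀ k : Fin d → ℤ, k ≠ 0 → 0 < freqNorm L k ∧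
      1 / (a * d) ≤ (1 + ‖k‖) / freqNorm L k ∧ (1 + ‖k‖) / freqNorm L k ≤ 2 / a := by
    intro k hk
    have h1 := one_le_norm_of_ne_zero hk
    have h2 := le_scaledNorm hL fun i => (k i : ℝ)
    have h3 := scaledNorm_le hL fun i => (k i : ℝ)
    rw [norm_intCast_fun, ← freqNorm_eq] at h2 h3
    have h4 : 0 < freqNorm L k := lt_of_lt_of_le (by positivity) h2
    refine ⟨h4, ?_, ?_⟩
    · rw [div_le_div_iff₀ (by positivity) h4]
      have : 0 < a * d := by positivity
      nlinarith
    · rw [div_le_div_iff₀ h4 ha0]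
      nlinarith
  have hsplit : ∀ k : Fin d → ℤ, k ≠ 0 → kernelSpectrum L K k * (1 + ‖k‖) ^ α =
      kernelSpectrum L K k * freqNorm L k ^ α * ((1 + ‖k‖) / freqNorm L k) ^ α := by
    intro k hk
    have h1 := (hratio k hk).1
    rw [Real.div_rpow (by positivity) h1.le]
    have : freqNorm L k ^ α ≠ 0 := (Real.rpow_pos_of_pos h1 _).ne'
    field_simp
  have hbd : ∀ β : ℝ, ∃ M : ℝ, 0 < M ∧
      ∀ k : Fin d → ℤ, k ≠ 0 → ((1 + ‖k‖) / freqNorm L k) ^ β ≤ M := fun β =>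
    ⟨max ((1 / (a * d)) ^ β) ((2 / a) ^ β), by positivity, fun k hk =>
      rpow_le_max (by positivity) (hratio k hk).2.1 (hratio k hk).2.2 β⟩
  obtain ⟨M₁, hM₁, hb₁⟩ := hbd α
  obtain ⟨M₂, hM₂, hb₂⟩ := hbd (-α)
  obtain ⟨C₁, hC₁, hup⟩ : ∃ C : ℝ, 0 < C ∧ ∀ k, kernelSpectrum L K k * (1 + ‖k‖) ^ α ≤ C := by
    refine exists_forall_le_of_cofinite (C := 2 * κ * M₁) ?_
    filter_upwards [hne, hlimc.eventually_le_const (show κ < 2 * κ by linarith)] with k hk hk2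
    have h1 := (hratio k hk).1
    rw [hsplit k hk]
    exact mul_le_mul hk2 (hb₁ k hk) (by positivity) (by positivity)
  -- The lower bound is an upper bound for the inverse, so the same passage from cofinite to all `k`
  -- applies.
  obtain ⟨C₂, hC₂, hlow⟩ : ∃ C : ℝ, 0 < C ∧ ∀ k, (kernelSpectrum L K k * (1 + ‖k‖) ^ α)⁻¹ ≤ C := by
    refine exists_forall_le_of_cofinite (C := (κ / 2)⁻¹ * M₂) ?_
    filter_upwards [hne, hlimc.eventually_const_le (show κ / 2 < κ by linarith)] with k hk hk2
    have h1 := (hratio k hk).1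
    rw [hsplit k hk, mul_inv, ← Real.rpow_neg (by positivity)]
    exact mul_le_mul (inv_anti₀ (by positivity) hk2) (hb₂ k hk) (by positivity) (by positivity)
  have hsN : ∀ v : Fin d → ℝ, v ≠ 0 → 0 < scaledNorm L v := fun v hv =>
    lt_of_lt_of_le (mul_pos ha0 (norm_pos_iff.2 hv)) (le_scaledNorm hL v)
  refine ⟨fun v => κ * scaledNorm L v ^ (-α), hpos, ⟨C₂⁻¹, by positivity, fun k => ?_⟩,
    ⟨C₁, hC₁, fun k => ?_⟩, fun v hv => ?_, fun k v hv hk => ?_⟩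
  · have hk0 : 0 < 1 + ‖k‖ := by positivity
    have h1 := hlow k
    have h2 : 0 < kernelSpectrum L K k * (1 + ‖k‖) ^ α := mul_pos (hpos k) (by positivity)
    rw [inv_le_comm₀ h2 hC₂] at h1
    rw [Real.rpow_neg hk0.le, ← div_eq_mul_inv, div_le_iff₀ (by positivity)]
    exact h1
  · have hk0 : 0 < 1 + ‖k‖ := by positivity
    rw [Real.rpow_neg hk0.le, ← div_eq_mul_inv, le_div_iff₀ (by positivity)]
    exact hup k
  · have := hsN v hv
    positivity
  · have hv0 := hsN v hv
    have h1 := (continuous_scaledNorm (L := L)).continuousAt.tendsto.comp hk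
    -- Homogeneity of the length factors out `N` and leaves a rescaled point that converges to `v`.
    have h2 : ∀ᶠ N : ℕ in atTop, freqNorm L (k N) =
        N * scaledNorm L ((N : ℝ)⁻¹ • fun i => (k N i : ℝ)) := by
      filter_upwards [eventually_ne_atTop 0] with N hN
      have : (N : ℝ) ≠ 0 := by exact_mod_cast hN
      rw [scaledNorm_smul (by positivity), mul_inv_cancel_left₀ this, freqNorm_eq]
    have h3 : Tendsto (fun N => freqNorm L (k N)) atTop atTop :=
      (tendsto_natCast_atTop_atTop.atTop_mul_pos hv0 h1).congr' (h2.mono fun N hN => hN.symm)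
    have h4 := hlim.comp (tendsto_comap_iff.2 h3)
    have h5 := h4.mul (h1.rpow_const (p := -α) (Or.inl hv0.ne'))
    refine h5.congr' ?_
    filter_upwards [h2, h1.eventually_const_lt hv0, eventually_ne_atTop 0] with N hN hN2 hN3
    have hN0 : (0 : ℝ) < N := by positivity
    simp only [Function.comp_apply] at hN2 ⊢
    rw [hN, Real.mul_rpow hN0.le hN2.le, Real.rpow_neg hN2.le]
    generalize scaledNorm L ((N : ℝ)⁻¹ • fun i => (k N i : ℝ)) = y at hN2
    have : y ^ α ≠ 0 := (Real.rpow_pos_of_pos hN2 _).ne'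
    field_simp

lemma IsGaussianKernel.exists_spectrum_eq (hL : 0 < L) (h : IsGaussianKernel L K) :
    ∃ c a : ℝ, 0 < c ∧ 0 < a ∧
      ∀ k : Fin d → ℤ, kernelSpectrum L K k = c * Real.exp (-(a * ∑ i, (k i : ℝ) ^ 2)) := by
  obtain ⟨c, σ, hc, hσ, hk⟩ := h
  refine ⟨L ^ (-(d : ℝ) / 2) * c, σ ^ 2 * (2 * Real.pi / L) ^ 2 / 2, by positivity, by positivity,
    fun k => ?_⟩
  rw [kernelSpectrum, hk, Complex.ofReal_re, mul_assoc]
  congr 3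
  rw [freqNorm, Real.sq_sqrt (Finset.sum_nonneg fun i _ => sq_nonneg _)]
  simp only [freq, mul_pow, ← Finset.mul_sum]
  ring

end decay

/-! ### Translation from powers of `N` to powers of `n` -/

section exponents
variable {d : ℕ} {E f : ℕ → ℝ} {x C : ℝ}

lemma natCast_pow_rpow (hd : 0 < d) (N : ℕ) (y : ℝ) :
    ((N : ℝ) ^ d) ^ (-(1 / (d : ℝ) * y)) = (N : ℝ) ^ (-y) := by
  have : (d : ℝ) ≠ 0 := by positivity
  rw [← Real.rpow_natCast, ← Real.rpow_mul (Nat.cast_nonneg N)]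
  congr 1
  field_simp

lemma ScalesWithExponent.of_tendsto (hd : 0 < d) (hC : 0 < C)
    (h : Tendsto (fun N : ℕ => (N : ℝ) ^ x * E N) atTop (𝓝 C)) :
    ScalesWithExponent d E (1 / (d : ℝ) * x) := by
  refine ⟨C, hC, ?_⟩
  simp_rw [natCast_pow_rpow hd]
  have hne : ∀ᶠ N : ℕ in atTop, (N : ℝ) ^ (-x) ≠ 0 := by
    filter_upwards [eventually_ne_atTop 0] with N hN
    positivity
  rw [isLittleO_iff_tendsto' (hne.mono fun N hN h0 => (hN h0).elim)]
  have h1 := h.sub_const C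
  rw [sub_self] at h1
  refine h1.congr' ?_
  filter_upwards [eventually_ne_atTop 0] with N hN
  have : (N : ℝ) ^ x ≠ 0 := by positivity
  rw [Real.rpow_neg (Nat.cast_nonneg N)]
  field_simp

/-- After division by `log N`, constants and `log log N` disappear. The asymmetric bounds cover both
the pure power and the critical case. -/
lemma tendsto_log_div_log (hd : 0 < d) {c : ℝ} (hc : 0 < c) (hC : 0 < C)
    (h : ∀ᶠ N : ℕ in atTop, c ≤ (N : ℝ) ^ x * E N ∧ (N : ℝ) ^ x * E N ≤ C * Real.log N) :
    Tendsto (fun N : ℕ => Real.log (E N) / Real.log ((N : ℝ) ^ d)) atTop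
      (𝓝 (-(1 / (d : ℝ) * x))) := by
  have hd0 : (d : ℝ) ≠ 0 := by positivity
  have hlogN : Tendsto (fun N : ℕ => Real.log N) atTop atTop :=
    Real.tendsto_log_atTop.comp tendsto_natCast_atTop_atTop
  have hlow : Tendsto (fun N : ℕ => Real.log c / Real.log N) atTop (𝓝 0) :=
    hlogN.const_div_atTop _
  have hup : Tendsto (fun N : ℕ => Real.log C / Real.log N +
      Real.log (Real.log N) / Real.log N) atTop (𝓝 0) := by
    have h1 := (Real.isLittleO_log_id_atTop.tendsto_div_nhds_zero).comp hlogN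
    simpa using (hlogN.const_div_atTop (Real.log C)).add h1
  have hmid : Tendsto (fun N : ℕ => Real.log ((N : ℝ) ^ x * E N) / Real.log N) atTop (𝓝 0) := by
    refine tendsto_of_tendsto_of_tendsto_of_le_of_le' hlow hup ?_ ?_
    · filter_upwards [h, hlogN.eventually_gt_atTop 0] with N hN hN1
      gcongr
      exact hN.1
    · filter_upwards [h, hlogN.eventually_gt_atTop 0] with N hN hN1
      rw [← add_div, ← Real.log_mul hC.ne' hN1.ne']
      exact div_le_div_of_nonneg_right (Real.log_le_log (hc.trans_le hN.1) hN.2) hN1.le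
  have h2 := (hmid.sub_const x).const_mul (1 / (d : ℝ))
  rw [zero_sub, mul_neg] at h2
  refine h2.congr' ?_
  filter_upwards [h, hlogN.eventually_gt_atTop 0, eventually_ne_atTop 0] with N hN hN1 hN0
  have hNx : (0 : ℝ) < (N : ℝ) ^ x := by positivity
  have hE : 0 < E N := pos_of_mul_pos_right (hc.trans_le hN.1) hNx.le
  rw [Real.log_mul hNx.ne' hE.ne', Real.log_rpow (by positivity), Real.log_pow]
  field_simp
  ring

lemma tendsto_log_div_log_of_tendsto (hd : 0 < d) (hC : 0 < C)
    (h : Tendsto (fun N : ℕ => (N : ℝ) ^ x * E N) atTop (𝓝 C)) :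
    Tendsto (fun N : ℕ => Real.log (E N) / Real.log ((N : ℝ) ^ d)) atTop
      (𝓝 (-(1 / (d : ℝ) * x))) := by
  have hlogN : Tendsto (fun N : ℕ => Real.log N) atTop atTop :=
    Real.tendsto_log_atTop.comp tendsto_natCast_atTop_atTop
  refine tendsto_log_div_log hd (half_pos hC) (show 0 < 2 * C by positivity) ?_
  filter_upwards [h.eventually_const_le (half_lt_self hC),
    h.eventually_le_const (show C < 2 * C by linarith), hlogN.eventually_ge_atTop 1]
    with N h1 h2 h3
  exact ⟨h1, h2.trans (le_mul_of_one_le_right (by positivity) h3)⟩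

lemma isTheta_of_log_bounds (hd : 0 < d) {c : ℝ} (hc : 0 < c)
    (h : ∀ᶠ N : ℕ in atTop, c * Real.log N ≤ (N : ℝ) ^ x * E N ∧
      (N : ℝ) ^ x * E N ≤ C * Real.log N) :
    E =Θ[atTop] fun N : ℕ => ((N : ℝ) ^ d) ^ (-(1 / (d : ℝ) * x)) * Real.log ((N : ℝ) ^ d) := by
  have hd0 : (0 : ℝ) < d := by positivity
  simp_rw [natCast_pow_rpow hd, Real.log_pow]
  have hE : ∀ᶠ N : ℕ in atTop, 0 ≤ E N ∧ c * ((N : ℝ) ^ (-x) * Real.log N) ≤ E N ∧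
      E N ≤ C * ((N : ℝ) ^ (-x) * Real.log N) ∧ 0 ≤ (N : ℝ) ^ (-x) * Real.log N := by
    filter_upwards [h, eventually_ge_atTop 1] with N hN hN1
    have hN0 : (0 : ℝ) < N := by exact_mod_cast hN1
    have hlog : 0 ≤ Real.log N := Real.log_nonneg (by exact_mod_cast hN1)
    have hxx : (N : ℝ) ^ (-x) * ((N : ℝ) ^ x * E N) = E N := by
      rw [← mul_assoc, ← Real.rpow_add hN0, neg_add_cancel, Real.rpow_zero, one_mul]
    have h1 := mul_le_mul_of_nonneg_left hN.1 (show 0 ≤ (N : ℝ) ^ (-x) by positivity)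
    have h2 := mul_le_mul_of_nonneg_left hN.2 (show 0 ≤ (N : ℝ) ^ (-x) by positivity)
    rw [hxx] at h1 h2
    exact ⟨le_trans (by positivity) h1, by linarith, by linarith, by positivity⟩
  constructor
  · refine IsBigO.of_bound (C / d) (hE.mono fun N hN => ?_)
    rw [Real.norm_of_nonneg hN.1, mul_left_comm, norm_mul, Real.norm_of_nonneg hd0.le,
      Real.norm_of_nonneg hN.2.2.2, ← mul_assoc, div_mul_cancel₀ _ hd0.ne']
    exact hN.2.2.1
  · refine IsBigO.of_bound (d / c) (hE.mono fun N hN => ?_)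
    rw [Real.norm_of_nonneg hN.1, mul_left_comm, norm_mul, Real.norm_of_nonneg hd0.le,
      Real.norm_of_nonneg hN.2.2.2, div_mul_eq_mul_div, mul_div_assoc]
    gcongr
    rw [le_div_iff₀' hc]
    exact hN.2.1

end exponents
end TeacherStudent

/-! ### The theorem: assembling the regimes -/

open TeacherStudent
theorem theorem1 {d : ℕ} (hd : 0 < d) {L : ℝ} (hL : 0 < L)
    {Ω : Type*} [MeasurableSpace Ω] (P : Measure Ω) [IsProbabilityMeasure P]
    (K_T K_S : (Fin d → ℝ) → ℝ)
    (hT : IsPositiveDefiniteKernel L K_T) (hS : IsPositiveDefiniteKernel L K_S)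
    -- `K(0) = L^(-d/2) ∑ K̃(w) < ∞`
    (hT₀ : Summable (fourierTransform L K_T)) (hS₀ : Summable (fourierTransform L K_S))
    (Z : (Fin d → ℝ) → Ω → ℝ) (hZ : IsGaussianField K_T Z P) :
    -- power-law Teacher and Student
    (∀ c_T α_T c_S α_S β : ℝ, 0 < c_T → 0 < c_S →
      HasPowerLawDecay L K_T c_T α_T → HasPowerLawDecay L K_S c_S α_S →
      β = 1 / (d : ℝ) * min (α_T - d) (2 * α_S) →
        (α_T - d ≠ 2 * α_S → ScalesWithExponent d (expectedMSE L K_S Z P) β) ∧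
        (α_T - d = 2 * α_S → expectedMSE L K_S Z P =Θ[atTop]
          fun N : ℕ => ((N : ℝ) ^ d) ^ (-β) * Real.log ((N : ℝ) ^ d)) ∧
        Tendsto (fun N : ℕ => Real.log (expectedMSE L K_S Z P N) / Real.log ((N : ℝ) ^ d))
          atTop (𝓝 (-β))) ∧
    -- Gaussian Teacher (`α_T = ∞`), power-law Student
    (∀ c_S α_S : ℝ, 0 < c_S → IsGaussianKernel L K_T → HasPowerLawDecay L K_S c_S α_S →
      ScalesWithExponent d (expectedMSE L K_S Z P) (1 / (d : ℝ) * (2 * α_S))) ∧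
    -- power-law Teacher, Gaussian Student (`α_S = ∞`)
    (∀ c_T α_T : ℝ, 0 < c_T → HasPowerLawDecay L K_T c_T α_T → IsGaussianKernel L K_S →
      ScalesWithExponent d (expectedMSE L K_S Z P) (1 / (d : ℝ) * (α_T - d))) ∧
    -- Gaussian Teacher and Student (`β = ∞`): decay faster than every power of `n`
    (IsGaussianKernel L K_T → IsGaussianKernel L K_S →
      ∀ b : ℝ, expectedMSE L K_S Z P =o[atTop] fun N : ℕ => ((N : ℝ) ^ d) ^ (-b)) := by
  have hTs := summable_spectrum hT₀
  have hSs := summable_spectrum hS₀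
  have hTp := hT.spectrum_pos hL hT₀
  have hSp := hS.spectrum_pos hL hS₀
  have hMSE : ∀ᶠ N : ℕ in atTop,
      ∑' k, kernelSpectrum L K_T k * modeError (kernelSpectrum L K_S) N k =
        expectedMSE L K_S Z P N := by
    filter_upwards [eventually_ne_atTop 0] with N hN
    exact (hasSum_expectedMSE hL hT hS hT₀ hS₀ hZ hN).tsum_eq
  have transfer : ∀ {x C : ℝ}, Tendsto (fun N : ℕ => (N : ℝ) ^ x *
      ∑' k, kernelSpectrum L K_T k * modeError (kernelSpectrum L K_S) N k) atTop (𝓝 C) →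
      Tendsto (fun N : ℕ => (N : ℝ) ^ x * expectedMSE L K_S Z P N) atTop (𝓝 C) := fun h =>
    h.congr' (hMSE.mono fun N hN => by rw [hN])
  have : Nonempty (Fin d) := ⟨⟨0, hd⟩⟩
  refine ⟨fun c_T α_T c_S α_S β hcT hcS hdT hdS hβ => ?_, fun c_S α_S hcS hgT hdS => ?_,
    fun c_T α_T hcT hdT hgS => ?_, fun hgT hgS b => ?_⟩
  · obtain ⟨GT, hPT⟩ := hdT.powerLaw hd hL hT hT₀ hcT
    obtain ⟨GS, hPS⟩ := hdS.powerLaw hd hL hS hS₀ hcS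
    have hαT := hPT.lt_exponent hd hTs
    have hαS := hPS.lt_exponent hd hSs
    have hαS0 : 0 < α_S := (Nat.cast_nonneg d).trans_lt hαS
    rcases lt_trichotomy (α_T - d) (2 * α_S) with hlt | heq | hgt
    · rw [min_eq_left hlt.le] at hβ
      -- Integer points are excluded because there some alias rescales to the origin; they form a
      -- null set.
      have hae : ∀ᵐ u : Fin d → ℝ, ∀ m : Fin d → ℤ, (u + fun i => (m i : ℝ)) ≠ 0 := by
        refine ae_all_iff.2 fun m => ?_
        filter_upwards [(Set.countable_singleton (-fun i => (m i : ℝ))).ae_notMem volume]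
          with u hu h0
        exact hu (eq_neg_of_add_eq_zero_left h0)
      have hlim : ∀ u : Fin d → ℝ, ∃ ψ : ℝ, (∀ m : Fin d → ℤ, (u + fun i => (m i : ℝ)) ≠ 0) →
          0 < ψ ∧ Tendsto (fun N : ℕ => modeError (kernelSpectrum L K_S) N (gridFloor N u)) atTop
            (𝓝 ψ) := by
        intro u
        by_cases hu : ∀ m : Fin d → ℤ, (u + fun i => (m i : ℝ)) ≠ 0
        · obtain ⟨ψ, h1, h2⟩ := hPS.exists_tendsto_modeError hd hSs hu
          exact ⟨ψ, fun _ => ⟨h1, h2 _ (tendsto_gridFloor u)⟩⟩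
        · exact ⟨0, fun h => (hu h).elim⟩
      choose ψ hψ using hlim
      -- The order is capped at `α_T`, as the domination in the slow regime requires; it still
      -- exceeds `α_T - d`.
      have hb : HasModeBound (kernelSpectrum L K_S) (min (2 * α_S) α_T) :=
        (hPS.hasModeBound hαS hSs).mono hSs hSp
          (le_min (by positivity) ((Nat.cast_nonneg d).trans hαT.le)) (min_le_left _ _)
      obtain ⟨C, hC, hconv⟩ := hPT.exists_tendsto_tsum_of_modeBound hd hTs hSs hSp
        (lt_min hlt (by linarith [show (0 : ℝ) < d by positivity])) (min_le_right _ _) hb ψ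
        (hae.mono fun u hu => (hψ u hu).2) (hae.mono fun u hu _ => (hψ u hu).1)
      rw [hβ]
      exact ⟨fun _ => .of_tendsto hd hC (transfer hconv), fun h => (hlt.ne h).elim,
        tendsto_log_div_log_of_tendsto hd hC (transfer hconv)⟩
    · rw [heq, min_self] at hβ
      obtain ⟨c, C, hc, hC, hbd⟩ := hPT.exists_log_bounds hPS hd hTs hSs heq
      have hbd' : ∀ᶠ N : ℕ in atTop,
          c * Real.log N ≤ (N : ℝ) ^ (2 * α_S) * expectedMSE L K_S Z P N ∧
          (N : ℝ) ^ (2 * α_S) * expectedMSE L K_S Z P N ≤ C * Real.log N := by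
        filter_upwards [hbd, hMSE] with N h1 h2
        rwa [h2] at h1
      have hlogN : Tendsto (fun N : ℕ => Real.log N) atTop atTop :=
        Real.tendsto_log_atTop.comp tendsto_natCast_atTop_atTop
      rw [hβ]
      refine ⟨fun h => (h heq).elim, fun _ => isTheta_of_log_bounds hd hc hbd',
        tendsto_log_div_log hd hc hC ?_⟩
      filter_upwards [hbd', hlogN.eventually_ge_atTop 1] with N h1 h2
      exact ⟨(le_mul_of_one_le_right hc.le h2).trans h1.1, h1.2⟩
    · rw [min_eq_right hgt.le] at hβ
      have hsum : Summable fun k => kernelSpectrum L K_T k * (1 + ‖k‖) ^ (2 * α_S) := by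
        obtain ⟨A, hA, hup⟩ := hPT.upper
        refine Summable.of_nonneg_of_le (fun k => mul_nonneg (hTp k).le (by positivity))
          (fun k => ?_) ((summable_one_add_norm_rpow (d := d) (s := α_T - 2 * α_S)
            (by linarith)).mul_left A)
        have hk0 : 0 < 1 + ‖k‖ := by positivity
        calc kernelSpectrum L K_T k * (1 + ‖k‖) ^ (2 * α_S)
            ≤ A * (1 + ‖k‖) ^ (-α_T) * (1 + ‖k‖) ^ (2 * α_S) := by gcongr; exact hup k
          _ = _ := by rw [mul_assoc, ← Real.rpow_add hk0]; congr 2; ring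
      obtain ⟨C, hC, hconv⟩ := hPS.exists_tendsto_tsum hd hSs hTp hsum
      rw [hβ]
      exact ⟨fun _ => .of_tendsto hd hC (transfer hconv), fun h => (hgt.ne' h).elim,
        tendsto_log_div_log_of_tendsto hd hC (transfer hconv)⟩
  · obtain ⟨GS, hPS⟩ := hdS.powerLaw hd hL hS hS₀ hcS
    obtain ⟨c, a, hc, ha, hg⟩ := hgT.exists_spectrum_eq hL
    obtain ⟨C, hC, hconv⟩ := hPS.exists_tendsto_tsum hd hSs hTp
      (summable_gaussian_mul_rpow hc ha hg (2 * α_S))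
    exact .of_tendsto hd hC (transfer hconv)
  · obtain ⟨GT, hPT⟩ := hdT.powerLaw hd hL hT hT₀ hcT
    obtain ⟨c, a, hc, ha, hg⟩ := hgS.exists_spectrum_eq hL
    have hαT := hPT.lt_exponent hd hTs
    obtain ⟨C, hC, hconv⟩ := hPT.exists_tendsto_tsum_of_modeBound hd hTs hSs hSp
      (γ := α_T) (by linarith [show (0 : ℝ) < d by positivity]) le_rfl
      (gaussian_hasModeBound hc ha hg hSs ((Nat.cast_nonneg d).trans hαT.le))
      (fun u => if (fun i => round (u i)) = 0 then 0 else 2)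
      (ae_norm_sub_round_lt.mono fun u hu => gaussian_tendsto_modeError hc ha hg hSs hu)
      (Eventually.of_forall fun u hu => by
        have hne : (fun i => round (u i)) ≠ 0 := by
          intro h0
          have h1 := congrFun h0 ⟨0, hd⟩
          have h2 := hu ⟨0, hd⟩
          rw [Pi.zero_apply, round_eq, Int.floor_eq_iff] at h1
          push_cast at h1
          linarith [h1.2, h2.1]
        rw [if_neg hne]
        norm_num)
    exact .of_tendsto hd hC (transfer hconv)
  · obtain ⟨c, a, hc, ha, hg⟩ := hgT.exists_spectrum_eq hL
    obtain ⟨c', a', hc', ha', hg'⟩ := hgS.exists_spectrum_eq hL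
    -- The power `n^b` equals `N^(d b)`.
    have hconv := transfer (tendsto_tsum_of_gaussian hc ha hg hTs hc' ha' hg' hSs (d * b))
    have hpow : ∀ N : ℕ, ((N : ℝ) ^ d) ^ (-b) = (N : ℝ) ^ (-(d * b)) := fun N => by
      rw [← Real.rpow_natCast, ← Real.rpow_mul (Nat.cast_nonneg N), mul_neg]
    simp_rw [hpow]
    have hne : ∀ᶠ N : ℕ in atTop, (N : ℝ) ^ (-(d * b)) ≠ 0 := by
      filter_upwards [eventually_ne_atTop 0] with N hN
      positivity
    rw [isLittleO_iff_tendsto' (hne.mono fun N hN h0 => (hN h0).elim)]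
    refine hconv.congr' ((eventually_ne_atTop 0).mono fun N hN => ?_)
    dsimp only
    rw [Real.rpow_neg (Nat.cast_nonneg N), div_inv_eq_mul, mul_comm]
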